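/- Let $0<s<1$. Let $R^+=[1-s,1]\times[0,1]$ and $R^-=[1-2s,1-s]\times[s,1+s]$, and let $X_s$ be the genus-2 homothety surface obtained from $R^+\cup R^-$ by the identifications $A:(1,y)\sim(1-s,sy)$ for $0\le y\le 1$; $B:(x,1)\sim(x,0)$ for $1-s\le x\le 1$; $C:(1-s,1+sy)\sim(1-2s,s+y)$ for $0\le y\le1$; $D:(x,1+s)\sim(x,s)$ for $1-2s\le x\le 1-s$. These four pairs of sides and the common segment $\{1-s\}\times[s,1]$, called $E$, are the edges of $X_s$; all vertices of the polygon are identified to one point, the singular point. A linear trajectory of slope $m\in\mathbb R$ is a curve $\tau:I\to X_s$ on an interval $I$, taken forward ($x$-coordinate locally increasing) and maximal, that is regular on the interior of $I$ (i.e. avoids the singular point) and there is, in local charts, a line of slope $m$ traversed at locally constant speed. It is a saddle connection if $I$ is compact and both endpoints are mapped to the singular point; it is closed if its image is homeomorphic to a circle and it is not a saddle connection. On $T^2=\mathbb R^2/\mathbb Z^2$ let $A$ be the image of the vertical and $B$ the image of the horizontal side of the unit square, and let the corner $0$ play the role of the singular point. The cutting sequence of a trajectory starting at time $0$ is the finite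 or infinite word of names of the edges that it meets at its successive times $t>0$, with the following conventions. If the trajectory ends at the singular point (on $T^2$: at its first return to the corner), the letter recorded at the end is $A$. If it starts at the lower left corner of $R^+$ (on $T^2$: at the corner) and its slope is not $0$, it is considered to enter through the bottom edge, and an initial letter $B$ is recorded. A trajectory of slope $0$ does not record the horizontal edges. For $\xi\ge0$ let $w(\xi)$ be the cutting sequence of the trajectory of slope $\xi$ on $T^2$ that starts at the corner; it is infinite if $\xi\notin\mathbb Q$, and has length $k+n$ if $\xi=k/n$ in lowest terms. Put $$\Delta_s^-(x)=\Big(\frac{1-s}{s}\Big)^2\sum_{j=1}^\infty s^j\lceil jx\rceil,\qquad \Delta_s^+(x)=\frac{1-s}{s}+\Big(\frac{1-s}{s}\Big)^2\sum_{j=1}^\infty s^j\lfloor jx\rfloor .$$ Let $\xi\ge0$. (i) If $\xi\notin\mathbb Q$ and $m=\Delta_s^{-}(\xi)$ or $m=\Delta_s^+(\xi)$, then the forward trajectory of slope $m$ starting at any point of the edge $E$ and moving into $R^+$ has the cutting sequence $w(\xi)$. (Endpoints included; at its top endpoint, $E$ is identified with the lower left corner $(1-s,0)$ of $R^+$, from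 which the trajectory then starts.) (ii) If $\xi\in\mathbb Q$, then the forward trajectory of slope $\Delta_s^+(\xi)$ starting at the top $(1-s,s)$ of the left-hand copy of edge $A$ is a saddle connection and has the cutting sequence $w(\xi)$. (iii) If $\xi\in\mathbb Q$, then the forward trajectory of slope $\Delta_s^-(\xi)$ starting at the bottom $(1-s,0)$ of the left-hand copy of edge $A$ is a saddle connection and has the cutting sequence $w(\xi)$. (iv) If $\xi=k/n$ with integers $k\ge0$, $n>0$, $\gcd(k,n)=1$, and $\Delta_s^-(\xi)<m<\Delta_s^+(\xi)$, then $$y_0=\frac{s^2}{1-s}\,m-\frac{s^n}{1-s^n}\sum_{\ell=1}^{k}\Big(\frac1s\Big)^{\lfloor(\ell-1)n/k\rfloor}$$ lies in $(0,s)$, and the trajectory of slope $m$ starting at the point $(1-s,y_0)$ of edge $A$ is closed and has the same cutting sequence as some trajectory of slope $\xi$ on $T^2$ that never meets the corner. In each case the trajectory in question exists, and the assertions hold for every parametrization of it. -/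

import Mathlib

open Set Filter Topology

namespace HomothetySurface

noncomputable section

/-! ### The staircase functions -/

/-- `Δ_s^-(x) = ((1-s)/s)^2 ∑_{j ≥ 1} s^j ⌈j x⌉`. -/
def deltaMinus (s x : ℝ) : ℝ :=
  ((1 - s) / s) ^ 2 * ∑' j : ℕ, s ^ (j + 1) * (⌈((j : ℝ) + 1) * x⌉ : ℝ)

/-- `Δ_s^+(x) = (1-s)/s + ((1-s)/s)^2 ∑_{j ≥ 1} s^j ⌊j x⌋`. -/
def deltaPlus (s x : ℝ) : ℝ :=
  (1 - s) / s + ((1 - s) / s) ^ 2 * ∑' j : ℕ, s ^ (j + 1) * (⌊((j : ℝ) + 1) * x⌋ : ℝ)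

/-! ### The surface `X_s` -/

/-- The names of the edges of `X_s`. -/
inductive Edge
  | A | B | C | D | E

/-- The eight-sided polygon `R_s^+ ∪ R_s^-`, placed in the plane: the right rectangle is
`R_s^+ = [1-s, 1] × [0, 1]`, the left one is `R_s^- = [1-2s, 1-s] × [s, 1+s]`, and they meet along
the segment `{1-s} × [s, 1]`, which is the edge `E`. -/
def polygon (s : ℝ) : Set (ℝ × ℝ) :=
  (Icc (1 - s) 1 ×ˢ Icc 0 1) ∪ (Icc (1 - 2 * s) (1 - s) ×ˢ Icc s (1 + s))

/-- For each edge, one segment of the polygon that represents it: the right-hand side of length `1`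
of `R_s^+` for `A`, the top of `R_s^+` for `B`, the right-hand side of length `s` of `R_s^-` for `C`,
the top of `R_s^-` for `D`, and the common segment of the two rectangles for `E`. -/
def side (s : ℝ) : Edge → Set (ℝ × ℝ)
  | .A => {1} ×ˢ Icc 0 1
  | .B => Icc (1 - s) 1 ×ˢ {1}
  | .C => {1 - s} ×ˢ Icc 1 (1 + s)
  | .D => Icc (1 - 2 * s) (1 - s) ×ˢ {1 + s}
  | .E => {1 - s} ×ˢ Icc s 1

/-- The direct homothety that glues `side s e` to the opposite side of the polygon: scaling by `s`
onto `{1-s} × [0, s]` for `A`, translation down by `1` for `B` and `D`, scaling by `1/s` onto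
`{1-2s} × [s, 1+s]` for `C`. The edge `E` is interior to the polygon, nothing is glued there. -/
def glue (s : ℝ) : Edge → ℝ × ℝ → ℝ × ℝ
  | .A, z => (1 - s + s * (z.1 - 1), s * z.2)
  | .B, z => (z.1, z.2 - 1)
  | .C, z => (1 - 2 * s + (z.1 - (1 - s)) / s, s + (z.2 - 1) / s)
  | .D, z => (z.1, z.2 - 1)
  | .E, z => z

/-- The equivalence relation on the polygon generated by the edge identifications. -/
def glueSetoid (s : ℝ) : Setoid (polygon s) :=
  Relation.EqvGen.setoid fun p q => ∃ e : Edge, p.1 ∈ side s e ∧ q.1 = glue s e p.1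

/-- The surface `X_s`, as a topological space: the polygon with its sides identified. -/
def Surface (s : ℝ) : Type := Quotient (glueSetoid s)

instance (s : ℝ) : TopologicalSpace (Surface s) :=
  inferInstanceAs (TopologicalSpace (Quotient (glueSetoid s)))

/-- The point `z` of the plane lies in the polygon and represents the point `x` of `X_s`. -/
def Represents (s : ℝ) (z : ℝ × ℝ) (x : Surface s) : Prop :=
  ∃ h : z ∈ polygon s, x = Quotient.mk (glueSetoid s) ⟨z, h⟩

/-- The eight vertices of the polygon. -/
def vertices (s : ℝ) : Set (ℝ × ℝ) :=
  {(1 - s, 0), (1, 0), (1, 1), (1 - s, 1),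
    (1 - 2 * s, s), (1 - s, s), (1 - 2 * s, 1 + s), (1 - s, 1 + s)}

/-- The singular set `Z` of `X_s`, the image of the vertices (it is a single point). -/
def singularSet (s : ℝ) : Set (Surface s) := {x | ∃ z ∈ vertices s, Represents s z x}

/-- The edge of `X_s` with a given name. -/
def edge (s : ℝ) (e : Edge) : Set (Surface s) := {x | ∃ z ∈ side s e, Represents s z x}

/-! ### Linear trajectories -/

/-- The point reached at time `r` from `p` with the constant velocity `c • (1, m)`. -/
def line (p : ℝ × ℝ) (c m r : ℝ) : ℝ × ℝ := (p.1 + c * r, p.2 + c * r * m)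

/-- Near the time `t`, the curve `τ` is, in a chart of the homothety structure of `X_s`, a straight
line of slope `m` run through to the right at constant speed. If the point `p` of the polygon lies on
a side `e`, the chart consists of the part of the polygon near `p` and, beyond the side, of the part
of the polygon near `glue s e p`, pulled back by the homothety `glue s e`. -/
def LinearAt {s : ℝ} (m : ℝ) (τ : ℝ → Surface s) (t : ℝ) : Prop :=
  ∃ p : ℝ × ℝ, ∃ c : ℝ, 0 < c ∧ Represents s p (τ t) ∧
    ∀ᶠ u in 𝓝 t, Represents s (line p c m (u - t)) (τ u) ∨
      ∃ e : Edge, p ∈ side s e ∧ Represents s (glue s e (line p c m (u - t))) (τ u)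

/-- The curve `τ : I → X_s` is a linear trajectory of slope `m`, parametrized in the forward direction
and with locally constant speed; values of `τ` outside the interval `I` are irrelevant. -/
structure IsLinearTrajectory {s : ℝ} (m : ℝ) (I : Set ℝ) (τ : ℝ → Surface s) : Prop where
  ordConnected : I.OrdConnected
  nontrivial : I.Nontrivial
  continuousOn : ContinuousOn τ I
  regular : ∀ t ∈ interior I, τ t ∉ singularSet s
  linear : ∀ t ∈ interior I, LinearAt m τ t

/-- A linear trajectory whose domain cannot be extended to a larger interval. -/
def IsMaximalTrajectory {s : ℝ} (m : ℝ) (I : Set ℝ) (τ : ℝ → Surface s) : Prop :=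
  IsLinearTrajectory m I τ ∧
    ∀ (J : Set ℝ) (σ : ℝ → Surface s),
      IsLinearTrajectory m J σ → I ⊆ J → EqOn σ τ I → J = I

/-- `τ : I → X_s` is a maximal linear trajectory of slope `m` that, at time `0`, starts at the point
of `X_s` represented by the point `p` of the polygon and from there moves into the polygon. (If `p` is
a vertex, this says which of the trajectories that emanate from the singular point is meant.) -/
def IsTrajectoryFrom {s : ℝ} (m : ℝ) (p : ℝ × ℝ) (I : Set ℝ) (τ : ℝ → Surface s) : Prop :=
  IsMaximalTrajectory m I τ ∧
    ∃ c : ℝ, 0 < c ∧ ∀ᶠ u in 𝓝[≥] (0 : ℝ), u ∈ I ∧ Represents s (line p c m u) (τ u)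

/-- The domain is compact and both endpoints are mapped to the singular set. -/
def IsSaddleConnection {s : ℝ} (I : Set ℝ) (τ : ℝ → Surface s) : Prop :=
  ∃ a b : ℝ, a < b ∧ I = Icc a b ∧ τ a ∈ singularSet s ∧ τ b ∈ singularSet s

/-- The image is homeomorphic to a circle and the trajectory is not a saddle connection. -/
def IsClosedTrajectory {s : ℝ} (I : Set ℝ) (τ : ℝ → Surface s) : Prop :=
  Nonempty ((τ '' I) ≃ₜ Circle) ∧ ¬ IsSaddleConnection I τ

/-! ### Cutting sequences

A word of length `N ≤ ∞` is given by `w : ℕ → Edge`, of which only the values `w i` with `i < N`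
matter. -/

/-- Let `R u e` mean that at time `u` the letter `e` is recorded. The word `w` of length `N` is the
cutting sequence if the recorded times form a sequence `t 0 < t 1 < …` of length `N`, and `w i` is
the letter recorded at `t i`. -/
def IsCuttingSequence (R : ℝ → Edge → Prop) (N : ℕ∞) (w : ℕ → Edge) : Prop :=
  ∃ t : ℕ → ℝ,
    (∀ i j : ℕ, i < j → (j : ℕ∞) < N → t i < t j) ∧
    (∀ i : ℕ, (i : ℕ∞) < N → R (t i) (w i)) ∧
    ∀ u e, R u e → ∃ i : ℕ, (i : ℕ∞) < N ∧ t i = u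

/-- The two records have a cutting sequence, and it is the same. -/
def SameCuttingSequence (R R' : ℝ → Edge → Prop) : Prop :=
  ∃ (N : ℕ∞) (w : ℕ → Edge), IsCuttingSequence R N w ∧ IsCuttingSequence R' N w

/-- The letters recorded by the trajectory `τ : I → X_s` of slope `m` that starts at `p` in `R_s^+`:
at each time `u > 0` at which `τ` meets an edge, the name of this edge. A horizontal trajectory does
not cross the horizontal edges `B`, `D`. Conventions at the singular point: if the trajectory ends
there, the letter recorded at the end is `A`; if it starts at the lower left corner of `R_s^+` (and is
not horizontal), it is considered to enter `R_s^+` across the bottom edge, and the letter `B` is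
recorded at time `0`. -/
def surfaceRecord {s : ℝ} (m : ℝ) (p : ℝ × ℝ) (I : Set ℝ) (τ : ℝ → Surface s)
    (u : ℝ) (e : Edge) : Prop :=
  u ∈ I ∧
    ((u = 0 ∧ p = (1 - s, 0) ∧ m ≠ 0 ∧ e = .B) ∨
      (0 < u ∧ τ u ∈ singularSet s ∧ e = .A) ∨
      (0 < u ∧ τ u ∉ singularSet s ∧ τ u ∈ edge s e ∧ (e = .B ∨ e = .D → m ≠ 0)))

/-- The forward trajectory of slope `ξ` on the torus `T² = ℝ²/ℤ²`, starting at `q`. -/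
def torusTrajectory (ξ : ℝ) (q : UnitAddCircle × UnitAddCircle) (u : ℝ) :
    UnitAddCircle × UnitAddCircle :=
  q + ((u : UnitAddCircle), ((ξ * u : ℝ) : UnitAddCircle))

/-- The letters recorded by the forward trajectory of slope `ξ` on `T²` that starts at `q`. The
vertical edge of the unit square is `A`, the horizontal one is `B`, and the corner `0` is considered
as a singular point, where a trajectory ends, with the same conventions as on `X_s`. -/
def torusRecord (ξ : ℝ) (q : UnitAddCircle × UnitAddCircle) (u : ℝ) (e : Edge) : Prop :=
  (∀ v, 0 < v → v < u → torusTrajectory ξ q v ≠ 0) ∧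
    ((u = 0 ∧ q = 0 ∧ ξ ≠ 0 ∧ e = .B) ∨
      (0 < u ∧ torusTrajectory ξ q u = 0 ∧ e = .A) ∨
      (0 < u ∧ torusTrajectory ξ q u ≠ 0 ∧
        (((torusTrajectory ξ q u).1 = 0 ∧ e = .A) ∨
          ((torusTrajectory ξ q u).2 = 0 ∧ ξ ≠ 0 ∧ e = .B))))

end

end HomothetySurface

namespace HomothetySurface

noncomputable section

set_option linter.unusedSectionVars false

/-! ### Normal forms of points of the polygon -/

/-! A trajectory of nonnegative slope that moves to the right inside `R_s^+` stays there until it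
hits a corner: `B` glues the top to the bottom, and `A` glues the right side into the left one. So
`R_s^+` acts as a cylinder of circumference 1 and width `s`, and the trajectory is coded by the
heights `z j` at which it enters on the left. After `b j` crossings of `B` it exits at `z j + m * s
- b j` and re-enters at `s` times this height. The return map is thus a contraction of slope `s`
with a jump, and the word is `B^(b 0) A B^(b 1) A ⋯`. The line of slope `ξ` on the torus has such a
word with `b j = ⌈(j+1)ξ⌉ - ⌈jξ⌉`, so it remains to see that this choice of `b` keeps the exit
heights in `(0, 1)`, or makes them arrive at `1` exactly at the end of a saddle connection
(`IsItinerary`).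

The contraction is compared with the rotation by `ξ` through an explicit series. Put `K = s * m / (1
- s)`, so that `K = s * K + m * s`, and let `W⁺(x)` be the average of `⌈x - (i+1)ξ⌉ - ⌈x⌉` with
weights `(1 - s) * s ^ i`; let `W⁻` be the same with floors. Both have period 1, and `W⁺(x + ξ) = s
* W⁺(x) - (⌈x + ξ⌉ - ⌈x⌉)` by `weightedSum_ceilDrop_add`. Hence the heights `s * (K + W⁺(jξ))` form
an exact orbit, and any other orbit with the same `b` differs from it by a geometric error
(`exit_eq_ceil`, and `exit_eq_floor` for floors).

Since `W⁻(0) ≤ W⁺(x) ≤ W⁺(0)`, the exits of the exact orbit lie in `(0, 1)` when `-W⁻(0) < K < 1 -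
W⁺(0)`; by `deltaMinus_eq` and `deltaPlus_eq` this says that `m` lies strictly between the two
staircase values. If `ξ` is irrational the two values coincide, and an orbit starting on `E` is
squeezed between the ceiling orbit from `s` and the floor orbit from `1`. If `ξ = k / n`, the
ceiling orbit at the upper end and the floor orbit at the lower end reach the corner after `n`
columns; for slopes in between, the ceiling orbit has period `n` with distinct heights, which makes
the trajectory a simple loop.

That this describes every trajectory with the given start, in every parametrization, rests on
uniqueness: `X_s` is Hausdorff and a chart at a regular point determines the curve nearby, so a
maximal trajectory contains every explicit curve that shares a short piece with it
(`IsMaximalTrajectory.subset`, applied in `Enters.eqOn`). -/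

open Classical in
/-- A representative of each gluing class: `(1, 1)` for the vertices, the point on `side s e` for
the points of an edge `e`, and the point itself in the interior of the rectangles. -/
def normalForm (s : ℝ) (z : ℝ × ℝ) : ℝ × ℝ :=
  if z ∈ vertices s then (1, 1)
  else if z.1 = 1 - s ∧ z.2 < s then (1, z.2 / s)
  else if z.1 = 1 - 2 * s then (1 - s, 1 + s * (z.2 - s))
  else if z.2 = 0 then (z.1, 1)
  else if z.2 = s ∧ z.1 < 1 - s then (z.1, 1 + s)
  else z

section normalForm

variable {s : ℝ}

theorem mem_vertices_iff {x y : ℝ} : (x, y) ∈ vertices s ↔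
    (x = 1 - s ∧ y = 0) ∨ (x = 1 ∧ y = 0) ∨ (x = 1 ∧ y = 1) ∨ (x = 1 - s ∧ y = 1) ∨
      (x = 1 - 2 * s ∧ y = s) ∨ (x = 1 - s ∧ y = s) ∨ (x = 1 - 2 * s ∧ y = 1 + s) ∨
      (x = 1 - s ∧ y = 1 + s) := by
  simp [vertices]

theorem mem_polygon_iff {x y : ℝ} : (x, y) ∈ polygon s ↔
    ((1 - s ≤ x ∧ x ≤ 1) ∧ 0 ≤ y ∧ y ≤ 1) ∨
      ((1 - 2 * s ≤ x ∧ x ≤ 1 - s) ∧ s ≤ y ∧ y ≤ 1 + s) := by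
  simp only [polygon, mem_union, mem_prod, mem_Icc]

theorem mem_side_iff {e : Edge} {x y : ℝ} : (x, y) ∈ side s e ↔
    (e = .A ∧ x = 1 ∧ 0 ≤ y ∧ y ≤ 1) ∨ (e = .B ∧ (1 - s ≤ x ∧ x ≤ 1) ∧ y = 1) ∨
      (e = .C ∧ x = 1 - s ∧ 1 ≤ y ∧ y ≤ 1 + s) ∨
      (e = .D ∧ (1 - 2 * s ≤ x ∧ x ≤ 1 - s) ∧ y = 1 + s) ∨
      (e = .E ∧ x = 1 - s ∧ s ≤ y ∧ y ≤ 1) := by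
  cases e <;> simp [side]

theorem normalForm_of_mem_vertices {z : ℝ × ℝ} (hz : z ∈ vertices s) :
    normalForm s z = (1, 1) := if_pos hz

variable (hs0 : 0 < s) (hs1 : s < 1)
include hs0 hs1

theorem not_mem_vertices_left {y : ℝ} (h0 : 0 < y) (h1 : y < s) : (1 - s, y) ∉ vertices s := by
  rw [mem_vertices_iff]; grind

theorem normalForm_left {y : ℝ} (h0 : 0 < y) (h1 : y < s) :
    normalForm s (1 - s, y) = (1, y / s) := by
  rw [normalForm, if_neg (not_mem_vertices_left hs0 hs1 h0 h1), if_pos ⟨rfl, h1⟩]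

theorem not_mem_vertices_A {y : ℝ} (h0 : 0 < y) (h1 : y < 1) : (1, y) ∉ vertices s := by
  rw [mem_vertices_iff]; grind

theorem normalForm_A {y : ℝ} (h0 : 0 < y) (h1 : y < 1) : normalForm s (1, y) = (1, y) := by
  rw [normalForm, if_neg (not_mem_vertices_A hs0 hs1 h0 h1)]
  grind

theorem not_mem_vertices_of_mem_Ioo {x : ℝ} (h0 : 1 - s < x) (h1 : x < 1) (y : ℝ) :
    (x, y) ∉ vertices s := by
  rw [mem_vertices_iff]; grind

theorem normalForm_right {x y : ℝ} (h0 : 1 - s < x) (h1 : x < 1) (hy : y ≠ 0) :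
    normalForm s (x, y) = (x, y) := by
  rw [normalForm, if_neg (not_mem_vertices_of_mem_Ioo hs0 hs1 h0 h1 y)]
  grind

theorem normalForm_bottom {x : ℝ} (h0 : 1 - s < x) (h1 : x < 1) :
    normalForm s (x, 0) = (x, 1) := by
  rw [normalForm, if_neg (not_mem_vertices_of_mem_Ioo hs0 hs1 h0 h1 0)]
  grind

theorem not_mem_vertices_of_mem_Ioo' {x : ℝ} (h0 : 1 - 2 * s < x) (h1 : x < 1 - s) (y : ℝ) :
    (x, y) ∉ vertices s := by
  rw [mem_vertices_iff]; grind

theorem normalForm_upper {x y : ℝ} (h0 : 1 - 2 * s < x) (h1 : x < 1 - s) (hy : s < y) :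
    normalForm s (x, y) = (x, y) := by
  rw [normalForm, if_neg (not_mem_vertices_of_mem_Ioo' hs0 hs1 h0 h1 y)]
  grind

theorem normalForm_upper_bottom {x : ℝ} (h0 : 1 - 2 * s < x) (h1 : x < 1 - s) :
    normalForm s (x, s) = (x, 1 + s) := by
  rw [normalForm, if_neg (not_mem_vertices_of_mem_Ioo' hs0 hs1 h0 h1 s)]
  grind

theorem not_mem_vertices_upper_left {y : ℝ} (h0 : s < y) (h1 : y < 1 + s) :
    (1 - 2 * s, y) ∉ vertices s := by
  rw [mem_vertices_iff]; grind

theorem normalForm_upper_left {y : ℝ} (h0 : s < y) (h1 : y < 1 + s) :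
    normalForm s (1 - 2 * s, y) = (1 - s, 1 + s * (y - s)) := by
  rw [normalForm, if_neg (not_mem_vertices_upper_left hs0 hs1 h0 h1)]
  grind

theorem not_mem_vertices_mid {y : ℝ} (h0 : s < y) (h1 : y ≠ 1) (h2 : y < 1 + s) :
    (1 - s, y) ∉ vertices s := by
  rw [mem_vertices_iff]; grind

theorem normalForm_mid {y : ℝ} (h0 : s < y) (h1 : y ≠ 1) (h2 : y < 1 + s) :
    normalForm s (1 - s, y) = (1 - s, y) := by
  rw [normalForm, if_neg (not_mem_vertices_mid hs0 hs1 h0 h1 h2)]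
  grind

theorem normalForm_of_mem_side {e : Edge} {z : ℝ × ℝ} (hz : z ∈ side s e) (hv : z ∉ vertices s) :
    normalForm s z = z := by
  obtain ⟨x, y⟩ := z
  rw [normalForm, if_neg hv]
  rw [mem_vertices_iff] at hv
  rw [mem_side_iff] at hz
  grind

theorem mem_side_unique {e e' : Edge} {z : ℝ × ℝ} (hz : z ∈ side s e) (hz' : z ∈ side s e')
    (hv : z ∉ vertices s) : e = e' := by
  obtain ⟨x, y⟩ := z
  rw [mem_vertices_iff] at hv
  rw [mem_side_iff] at hz hz'
  grind

/-- Relation of a point of the polygon to its normal form. -/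
theorem normalForm_spec {z : ℝ × ℝ} (hz : z ∈ polygon s) (hv : z ∉ vertices s) :
    normalForm s z ∈ polygon s ∧ normalForm s z ∉ vertices s ∧
      (normalForm s z = z ∨
        ∃ e, e ≠ .E ∧ normalForm s z ∈ side s e ∧ z = glue s e (normalForm s z)) := by
  obtain ⟨x, y⟩ := z
  rw [normalForm, if_neg hv]
  have hv' := hv
  rw [mem_vertices_iff] at hv'
  have hz' := hz
  rw [mem_polygon_iff] at hz'
  split_ifs with h1 h2 h3 h4
  · obtain ⟨rfl, h1⟩ : x = 1 - s ∧ y < s := h1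
    have hy0 : 0 < y := by grind
    have hy : 0 < y / s := by positivity
    have hy1 : y / s < 1 := by rw [div_lt_one hs0]; exact h1
    refine ⟨?_, ?_, .inr ⟨.A, by simp, ?_, ?_⟩⟩
    · rw [mem_polygon_iff]; grind
    · exact not_mem_vertices_A hs0 hs1 hy hy1
    · rw [mem_side_iff]; grind
    · simp only [glue]; ext <;> simp; field_simp
  · obtain rfl : x = 1 - 2 * s := h2
    have hy0 : s < y := by grind
    have hy1 : y < 1 + s := by grind
    have h3 : 0 < s * (y - s) := by nlinarith
    have h4 : s * (y - s) < s := by nlinarith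
    refine ⟨?_, ?_, .inr ⟨.C, by simp, ?_, ?_⟩⟩
    · rw [mem_polygon_iff]; grind
    · exact not_mem_vertices_mid hs0 hs1 (by dsimp only; linarith) (by dsimp only; linarith) (by dsimp only; linarith)
    · rw [mem_side_iff]; grind
    · simp only [glue]; ext <;> simp; field_simp; ring
  · obtain rfl : y = 0 := h3
    have : 1 - s < x ∧ x < 1 := by grind
    refine ⟨?_, not_mem_vertices_of_mem_Ioo hs0 hs1 this.1 this.2 1, .inr ⟨.B, by simp, ?_, ?_⟩⟩
    · rw [mem_polygon_iff]; grind
    · rw [mem_side_iff]; grind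
    · simp [glue]
  · obtain ⟨rfl, h4⟩ : y = s ∧ x < 1 - s := h4
    have : 1 - 2 * y < x ∧ x < 1 - y := by grind
    refine ⟨?_, not_mem_vertices_of_mem_Ioo' hs0 hs1 this.1 this.2 _, .inr ⟨.D, by simp, ?_, ?_⟩⟩
    · rw [mem_polygon_iff]; grind
    · rw [mem_side_iff]; grind
    · simp [glue]
  · exact ⟨hz, hv, .inl rfl⟩

/-- Invariance under each generating identification lets the normal form descend to `X_s`. It turns
questions about the generated equivalence relation into computations in the plane. -/
theorem normalForm_glue {e : Edge} {z : ℝ × ℝ} (hz : z ∈ side s e) :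
    normalForm s (glue s e z) = normalForm s z := by
  obtain ⟨x, y⟩ := z
  rw [mem_side_iff] at hz
  by_cases hv : (x, y) ∈ vertices s
  · rw [normalForm_of_mem_vertices hv]
    apply normalForm_of_mem_vertices
    rw [mem_vertices_iff] at hv
    rcases hz with ⟨rfl, rfl, h⟩ | ⟨rfl, h, rfl⟩ | ⟨rfl, rfl, h⟩ | ⟨rfl, h, rfl⟩ | ⟨rfl, rfl, h⟩
    · have : y = 0 ∨ y = 1 := by grind
      simp only [glue]; rw [mem_vertices_iff]; rcases this with rfl | rfl <;> grind
    · have : x = 1 - s ∨ x = 1 := by grind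
      simp only [glue]; rw [mem_vertices_iff]; grind
    · have : y = 1 ∨ y = 1 + s := by grind
      simp only [glue]; rw [mem_vertices_iff]; rcases this with rfl | rfl <;> simp
      right; right; field_simp; simp; grind
    · have : x = 1 - s ∨ x = 1 - 2 * s := by grind
      simp only [glue]; rw [mem_vertices_iff]; grind
    · simp only [glue]; rw [mem_vertices_iff]; grind
  · have hv' := hv
    rw [mem_vertices_iff] at hv'
    rcases hz with ⟨rfl, rfl, h⟩ | ⟨rfl, h, rfl⟩ | ⟨rfl, rfl, h⟩ | ⟨rfl, h, rfl⟩ | ⟨rfl, rfl, h⟩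
    · have h0 : 0 < y := by grind
      have h1 : y < 1 := by grind
      rw [normalForm_A hs0 hs1 h0 h1]
      have : glue s .A (1, y) = (1 - s, s * y) := by simp [glue]
      rw [this, normalForm_left hs0 hs1 (by positivity) (by nlinarith)]
      ext <;> simp; field_simp
    · have h0 : 1 - s < x := by grind
      have h1 : x < 1 := by grind
      rw [normalForm_right hs0 hs1 h0 h1 one_ne_zero]
      simp [glue, normalForm_bottom hs0 hs1 h0 h1]
    · have h0 : 1 < y := by grind
      have h1 : y < 1 + s := by grind
      rw [normalForm_mid hs0 hs1 (by linarith) h0.ne' h1]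
      have : glue s .C (1 - s, y) = (1 - 2 * s, s + (y - 1) / s) := by simp [glue]
      have h2 : 0 < (y - 1) / s := div_pos (by linarith) hs0
      have h3 : (y - 1) / s < 1 := by rw [div_lt_one hs0]; linarith
      rw [this, normalForm_upper_left hs0 hs1 (by linarith) (by linarith)]
      ext <;> simp; field_simp; ring
    · have h0 : 1 - 2 * s < x := by grind
      have h1 : x < 1 - s := by grind
      rw [normalForm_upper hs0 hs1 h0 h1 (by linarith)]
      simp [glue, normalForm_upper_bottom hs0 hs1 h0 h1]
    · rfl

end normalForm

/-! ### Points of the surface -/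

section points

variable {s : ℝ}

/-- The projection of the polygon onto the surface. -/
def toSurface (s : ℝ) (p : polygon s) : Surface s := Quotient.mk (glueSetoid s) p

theorem continuous_toSurface : Continuous (toSurface s) := continuous_quotient_mk'

theorem isQuotientMap_toSurface : IsQuotientMap (toSurface s) := isQuotientMap_quotient_mk'

theorem represents_toSurface (p : polygon s) : Represents s p (toSurface s p) := ⟨p.2, rfl⟩

theorem Represents.eq {z : ℝ × ℝ} {x : Surface s} (h : Represents s z x) :
    x = toSurface s ⟨z, h.1⟩ := h.2

theorem Represents.unique {z : ℝ × ℝ} {x x' : Surface s} (h : Represents s z x)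
    (h' : Represents s z x') : x = x' := h.eq.trans h'.eq.symm

theorem toSurface_glue {e : Edge} {p q : polygon s} (hp : p.1 ∈ side s e)
    (hq : q.1 = glue s e p.1) : toSurface s p = toSurface s q :=
  Quotient.sound (Relation.EqvGen.rel p q ⟨e, hp, hq⟩)

theorem Represents.glue_iff {e : Edge} {z : ℝ × ℝ} {x : Surface s} (hz : z ∈ side s e)
    (h1 : z ∈ polygon s) (h2 : glue s e z ∈ polygon s) :
    Represents s (glue s e z) x ↔ Represents s z x := by
  have := toSurface_glue (p := ⟨z, h1⟩) (q := ⟨_, h2⟩) hz rfl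
  constructor
  · intro h; exact ⟨h1, h.eq.trans this.symm⟩
  · intro h; exact ⟨h2, h.eq.trans this⟩

variable (hs0 : 0 < s) (hs1 : s < 1)
include hs0 hs1

theorem normalForm_eq_of_toSurface_eq {p q : polygon s} (h : toSurface s p = toSurface s q) :
    normalForm s p = normalForm s q := by
  have h' : Relation.EqvGen _ p q := Quotient.exact h
  induction h' with
  | rel p q hpq =>
    obtain ⟨e, he, hq⟩ := hpq
    rw [hq, normalForm_glue hs0 hs1 he]
  | refl => rfl
  | symm p q hpq ih => exact (ih (Quotient.sound hpq)).symm
  | trans p q r hpq hqr ih1 ih2 =>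
    exact (ih1 (Quotient.sound hpq)).trans (ih2 (Quotient.sound hqr))

theorem glue_mem_polygon {e : Edge} {z : ℝ × ℝ} (hz : z ∈ side s e) :
    z ∈ polygon s ∧ glue s e z ∈ polygon s := by
  obtain ⟨x, y⟩ := z
  rw [mem_side_iff] at hz
  rcases hz with ⟨rfl, rfl, h⟩ | ⟨rfl, h, rfl⟩ | ⟨rfl, rfl, h⟩ | ⟨rfl, h, rfl⟩ | ⟨rfl, rfl, h⟩ <;>
    simp only [glue, mem_polygon_iff]
  · have : 0 ≤ s * y := by nlinarith
    have : s * y ≤ s := by nlinarith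
    grind
  · grind
  · have h2 : 0 ≤ (y - 1) / s := div_nonneg (by linarith) hs0.le
    have h3 : (y - 1) / s ≤ 1 := by rw [div_le_one hs0]; linarith
    have : (1 - s - (1 - s)) / s = 0 := by simp
    grind
  · grind
  · grind

theorem one_one_mem_polygon : ((1 : ℝ), (1 : ℝ)) ∈ polygon s := by
  rw [mem_polygon_iff]; grind

theorem represents_vertex {z : ℝ × ℝ} (hz : z ∈ vertices s) :
    Represents s z (toSurface s ⟨(1, 1), one_one_mem_polygon hs0 hs1⟩) := by
  have key : ∀ {e : Edge} {p q : ℝ × ℝ}, p ∈ side s e → glue s e p = q → ∀ {x},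
      (Represents s p x ↔ Represents s q x) := by
    rintro e p q hp rfl x
    have := glue_mem_polygon hs0 hs1 hp
    exact (Represents.glue_iff hp this.1 this.2).symm
  have a1 : Represents s (1, 1) (toSurface s ⟨(1, 1), one_one_mem_polygon hs0 hs1⟩) :=
    represents_toSurface (⟨(1, 1), one_one_mem_polygon hs0 hs1⟩ : polygon s)
  have hne := hs0.ne'
  -- From `(1, 1)` every other vertex is reached by a chain of gluings; `.1` follows a gluing and
  -- `.2` goes against it.
  have a2 := (key (e := .A) (q := (1 - s, s)) (by rw [mem_side_iff]; grind) (by simp [glue])).1 a1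
  have a3 := (key (e := .B) (q := (1, 0)) (by rw [mem_side_iff]; grind) (by simp [glue])).1 a1
  have a4 := (key (e := .A) (q := (1 - s, 0)) (by rw [mem_side_iff]; grind) (by simp [glue])).1 a3
  have a5 := (key (e := .B) (p := (1 - s, 1)) (by rw [mem_side_iff]; grind) (by simp [glue])).2 a4
  have a6 := (key (e := .C) (q := (1 - 2 * s, s)) (by rw [mem_side_iff]; grind)
    (by simp [glue])).1 a5
  have a7 := (key (e := .D) (p := (1 - 2 * s, 1 + s)) (by rw [mem_side_iff]; grind)
    (by simp [glue])).2 a6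
  have a8 := (key (e := .D) (p := (1 - s, 1 + s)) (by rw [mem_side_iff]; grind)
    (by simp [glue])).2 a2
  obtain ⟨x, y⟩ := z
  rw [mem_vertices_iff] at hz
  rcases hz with ⟨rfl, rfl⟩ | ⟨rfl, rfl⟩ | ⟨rfl, rfl⟩ | ⟨rfl, rfl⟩ | ⟨rfl, rfl⟩ | ⟨rfl, rfl⟩ |
    ⟨rfl, rfl⟩ | ⟨rfl, rfl⟩ <;> assumption

theorem Represents.normalForm {z : ℝ × ℝ} {x : Surface s} (h : Represents s z x) :
    Represents s (normalForm s z) x := by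
  by_cases hv : z ∈ vertices s
  · rw [normalForm_of_mem_vertices hv, h.unique (represents_vertex hs0 hs1 hv)]
    exact represents_toSurface (⟨(1, 1), one_one_mem_polygon hs0 hs1⟩ : polygon s)
  · obtain ⟨h1, -, h2 | ⟨e, -, he, h2⟩⟩ := normalForm_spec hs0 hs1 h.1 hv
    · rwa [h2]
    · have h3 := h
      rw [h2] at h3
      exact (Represents.glue_iff he h1 (h2 ▸ h.1)).1 h3

theorem Represents.normalForm_eq {z z' : ℝ × ℝ} {x : Surface s} (h : Represents s z x)
    (h' : Represents s z' x) : HomothetySurface.normalForm s z = HomothetySurface.normalForm s z' :=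
  normalForm_eq_of_toSurface_eq hs0 hs1 (h.eq.symm.trans h'.eq)

theorem Represents.eq_of_normalForm_eq {z z' : ℝ × ℝ} {x x' : Surface s} (h : Represents s z x)
    (h' : Represents s z' x')
    (he : HomothetySurface.normalForm s z = HomothetySurface.normalForm s z') : x = x' := by
  have := h'.normalForm hs0 hs1
  rw [← he] at this
  exact (h.normalForm hs0 hs1).unique this

theorem normalForm_eq_one_one_iff {z : ℝ × ℝ} (hz : z ∈ polygon s) :
    HomothetySurface.normalForm s z = (1, 1) ↔ z ∈ vertices s := by
  refine ⟨fun h => ?_, normalForm_of_mem_vertices⟩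
  by_contra hv
  have := (normalForm_spec hs0 hs1 hz hv).2.1
  rw [h] at this
  exact this (by rw [mem_vertices_iff]; grind)

theorem Represents.mem_singularSet_iff {z : ℝ × ℝ} {x : Surface s} (h : Represents s z x) :
    x ∈ singularSet s ↔ z ∈ vertices s := by
  refine ⟨?_, fun hz => ⟨z, hz, h⟩⟩
  rintro ⟨z', hz', h'⟩
  rw [← normalForm_eq_one_one_iff hs0 hs1 h.1, h.normalForm_eq hs0 hs1 h']
  exact normalForm_of_mem_vertices hz'

theorem Represents.mem_edge_iff {z : ℝ × ℝ} {x : Surface s} (h : Represents s z x)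
    (hz : z ∉ vertices s) {e : Edge} :
    x ∈ edge s e ↔ HomothetySurface.normalForm s z ∈ side s e := by
  constructor
  · rintro ⟨z', hz', h'⟩
    have hv : z' ∉ vertices s := by
      rwa [← h'.mem_singularSet_iff hs0 hs1, h.mem_singularSet_iff hs0 hs1]
    rwa [h.normalForm_eq hs0 hs1 h', normalForm_of_mem_side hs0 hs1 hz' hv]
  · intro he
    exact ⟨_, he, h.normalForm hs0 hs1⟩

end points

/-! ### The surface is Hausdorff -/

/-- Compactness makes `f` a closed map: the saturation of a closed `K` is the projection of a
compact part of the relation. Normality of `X` then separates the fibres, and complements of images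
of complements turn the separating sets into open sets of `Y`. -/
theorem t2Space_of_isQuotientMap {X Y : Type*} [TopologicalSpace X] [TopologicalSpace Y]
    [CompactSpace X] [T2Space X] {f : X → Y} (hf : IsQuotientMap f)
    (h : IsClosed {p : X × X | f p.1 = f p.2}) : T2Space Y := by
  have hcl : IsClosedMap f := by
    intro K hK
    rw [← hf.isClosed_preimage]
    have : f ⁻¹' (f '' K) = Prod.snd '' ({p : X × X | f p.1 = f p.2} ∩ Prod.fst ⁻¹' K) := by
      ext x
      constructor
      · rintro ⟨k, hk, hx⟩
        exact ⟨(k, x), ⟨hx, hk⟩, rfl⟩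
      · rintro ⟨⟨k, x'⟩, ⟨hx, hk⟩, rfl⟩
        exact ⟨k, hk, hx⟩
    rw [this]
    exact ((h.inter (hK.preimage continuous_fst)).isCompact.image continuous_snd).isClosed
  have hpt : ∀ y, IsClosed (f ⁻¹' {y}) := by
    intro y
    obtain ⟨x, rfl⟩ := hf.surjective y
    rw [hf.isClosed_preimage, ← image_singleton]
    exact hcl _ isClosed_singleton
  refine ⟨fun y y' hy => ?_⟩
  obtain ⟨U, V, hU, hV, hyU, hyV, hUV⟩ := normal_separation (hpt y) (hpt y')
    ((disjoint_singleton.2 hy).preimage f)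
  refine ⟨(f '' Uᶜ)ᶜ, (f '' Vᶜ)ᶜ, (hcl _ hU.isClosed_compl).isOpen_compl,
    (hcl _ hV.isClosed_compl).isOpen_compl, ?_, ?_, ?_⟩
  · rintro ⟨x, hx, hxy⟩
    exact hx (hyU hxy)
  · rintro ⟨x, hx, hxy⟩
    exact hx (hyV hxy)
  · rw [disjoint_left]
    intro w hw hw'
    obtain ⟨x, rfl⟩ := hf.surjective w
    have h1 : x ∈ U := by by_contra hx; exact hw ⟨x, hx, rfl⟩
    have h2 : x ∈ V := by by_contra hx; exact hw' ⟨x, hx, rfl⟩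
    exact disjoint_left.1 hUV h1 h2

instance : Finite Edge :=
  Finite.of_surjective (![.A, .B, .C, .D, .E] : Fin 5 → Edge) (by
    rintro ⟨⟩
    exacts [⟨0, rfl⟩, ⟨1, rfl⟩, ⟨2, rfl⟩, ⟨3, rfl⟩, ⟨4, rfl⟩])

theorem isClosed_side (s : ℝ) (e : Edge) : IsClosed (side s e) := by
  cases e <;> simp only [side]
  · exact isClosed_singleton.prod isClosed_Icc
  · exact isClosed_Icc.prod isClosed_singleton
  · exact isClosed_singleton.prod isClosed_Icc
  · exact isClosed_Icc.prod isClosed_singleton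
  · exact isClosed_singleton.prod isClosed_Icc

theorem continuous_glue (s : ℝ) (e : Edge) : Continuous (glue s e) := by
  cases e
  · change Continuous fun z : ℝ × ℝ => (1 - s + s * (z.1 - 1), s * z.2); fun_prop
  · change Continuous fun z : ℝ × ℝ => (z.1, z.2 - 1); fun_prop
  · change Continuous fun z : ℝ × ℝ => (1 - 2 * s + (z.1 - (1 - s)) / s, s + (z.2 - 1) / s)
    fun_prop
  · change Continuous fun z : ℝ × ℝ => (z.1, z.2 - 1); fun_prop
  · exact continuous_id

theorem isCompact_polygon (s : ℝ) : IsCompact (polygon s) :=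
  (isCompact_Icc.prod isCompact_Icc).union (isCompact_Icc.prod isCompact_Icc)

instance (s : ℝ) : CompactSpace (polygon s) := isCompact_iff_compactSpace.1 (isCompact_polygon s)

theorem isClosed_vertices (s : ℝ) : IsClosed (vertices s) := by
  apply Set.Finite.isClosed
  unfold vertices
  exact Set.toFinite _

section

variable {s : ℝ} (hs0 : 0 < s) (hs1 : s < 1)
include hs0 hs1

/-- Away from the vertices a single gluing already exhausts the equivalence class. This exhibits the
relation as a finite union of closed sets, as needed for the Hausdorff property. -/
theorem toSurface_eq_iff {p q : polygon s} : toSurface s p = toSurface s q ↔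
    p = q ∨ (p.1 ∈ vertices s ∧ q.1 ∈ vertices s) ∨
      (∃ e, p.1 ∈ side s e ∧ q.1 = glue s e p.1) ∨ ∃ e, q.1 ∈ side s e ∧ p.1 = glue s e q.1 := by
  constructor
  · intro h
    have hN := normalForm_eq_of_toSurface_eq hs0 hs1 h
    by_cases hp : p.1 ∈ vertices s
    · have hq : q.1 ∈ vertices s := by
        rw [← normalForm_eq_one_one_iff hs0 hs1 q.2, ← hN, normalForm_of_mem_vertices hp]
      exact .inr (.inl ⟨hp, hq⟩)
    · have hq : q.1 ∉ vertices s := by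
        rwa [← normalForm_eq_one_one_iff hs0 hs1 q.2, ← hN,
          normalForm_eq_one_one_iff hs0 hs1 p.2]
      obtain ⟨-, hv, h2 | ⟨e, -, he, h2⟩⟩ := normalForm_spec hs0 hs1 p.2 hp
      · obtain ⟨-, -, h2' | ⟨e', -, he', h2'⟩⟩ := normalForm_spec hs0 hs1 q.2 hq
        · exact .inl (Subtype.ext (by rw [← h2, hN, h2']))
        · rw [← hN, h2] at he' h2'
          exact .inr (.inr (.inl ⟨e', he', h2'⟩))
      · obtain ⟨-, -, h2' | ⟨e', -, he', h2'⟩⟩ := normalForm_spec hs0 hs1 q.2 hq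
        · rw [hN, h2'] at he h2
          exact .inr (.inr (.inr ⟨e, he, h2⟩))
        · rw [← hN] at he' h2'
          rw [← mem_side_unique hs0 hs1 he he' hv, ← h2] at h2'
          exact .inl (Subtype.ext h2'.symm)
  · rintro (rfl | ⟨hp, hq⟩ | ⟨e, he, h⟩ | ⟨e, he, h⟩)
    · rfl
    · exact (represents_toSurface p).eq_of_normalForm_eq hs0 hs1 (represents_toSurface q)
        (by rw [normalForm_of_mem_vertices hp, normalForm_of_mem_vertices hq])
    · exact toSurface_glue he h
    · exact (toSurface_glue he h).symm

theorem t2Space_surface : T2Space (Surface s) := by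
  refine t2Space_of_isQuotientMap isQuotientMap_toSurface ?_
  simp only [toSurface_eq_iff hs0 hs1, ofPred_or, ofPred_and, ofPred_exists]
  refine .union (isClosed_eq (by fun_prop) (by fun_prop)) (.union (.inter ?_ ?_) (.union ?_ ?_))
  · exact (isClosed_vertices s).preimage (continuous_subtype_val.comp continuous_fst)
  · exact (isClosed_vertices s).preimage (continuous_subtype_val.comp continuous_snd)
  · refine isClosed_iUnion_of_finite fun e => .inter ?_ (isClosed_eq (by fun_prop) ?_)
    · exact (isClosed_side s e).preimage (continuous_subtype_val.comp continuous_fst)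
    · exact (continuous_glue s e).comp (continuous_subtype_val.comp continuous_fst)
  · refine isClosed_iUnion_of_finite fun e => .inter ?_ (isClosed_eq (by fun_prop) ?_)
    · exact (isClosed_side s e).preimage (continuous_subtype_val.comp continuous_snd)
    · exact (continuous_glue s e).comp (continuous_subtype_val.comp continuous_snd)

end

/-! ### The horizontal coordinate modulo `s` -/

/-- The first coordinate modulo `s` is well defined on the surface. -/
def horizontal {s : ℝ} (_ : s ≠ 0) : Surface s → AddCircle s :=
  Quotient.lift (fun p : polygon s => ((p.1.1 : ℝ) : AddCircle s)) (by
    intro p q h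
    have h' : Relation.EqvGen _ p q := h
    induction h' with
    | rel p q hpq =>
      obtain ⟨e, he, hq⟩ := hpq
      obtain ⟨⟨x, y⟩, hxy⟩ := p
      dsimp only at he hq ⊢
      rw [mem_side_iff] at he
      rcases he with ⟨rfl, rfl, h⟩ | ⟨rfl, h, rfl⟩ | ⟨rfl, rfl, h⟩ | ⟨rfl, h, rfl⟩ | ⟨rfl, rfl, h⟩
      · rw [hq, ← sub_eq_zero, ← AddCircle.coe_sub, AddCircle.coe_eq_zero_iff]
        exact ⟨1, by simp [glue]⟩
      · rw [hq]; simp [glue]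
      · rw [hq, ← sub_eq_zero, ← AddCircle.coe_sub, AddCircle.coe_eq_zero_iff]
        exact ⟨1, by simp [glue]; ring⟩
      · rw [hq]; simp [glue]
      · rw [hq]; simp [glue]
    | refl => rfl
    | symm p q hpq ih => exact (ih hpq).symm
    | trans p q r hpq hqr ih1 ih2 => exact (ih1 hpq).trans (ih2 hqr))

theorem Represents.horizontal_eq {s : ℝ} (hs : s ≠ 0) {z : ℝ × ℝ} {x : Surface s}
    (h : Represents s z x) : horizontal hs x = (z.1 : AddCircle s) := by
  rw [h.eq]; rfl

theorem eq_of_coe_eq_of_abs_lt {s x y : ℝ} (h : (x : AddCircle s) = y) (hxy : |x - y| < s) :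
    x = y := by
  rw [← sub_eq_zero, ← AddCircle.coe_sub, AddCircle.coe_eq_zero_iff] at h
  obtain ⟨n, hn⟩ := h
  have hs : 0 < s := (abs_nonneg _).trans_lt hxy
  rw [← hn, zsmul_eq_mul, abs_mul, abs_of_pos hs] at hxy
  have h1 : |(n : ℝ)| < 1 := by
    by_contra! h
    nlinarith
  have h2 : n = 0 := by
    rw [← Int.abs_lt_one_iff]; exact_mod_cast h1
  rw [h2, zero_smul] at hn
  linarith

/-! ### Local uniqueness of linear trajectories -/

section

variable {s : ℝ}

theorem eventually_fst_lt {p : ℝ × ℝ} {a : ℝ} (h : p.1 < a) : ∀ᶠ q in 𝓝 p, q.1 < a :=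
  continuousAt_fst.eventually_lt continuousAt_const h

theorem eventually_lt_fst {p : ℝ × ℝ} {a : ℝ} (h : a < p.1) : ∀ᶠ q in 𝓝 p, a < q.1 :=
  continuousAt_const.eventually_lt continuousAt_fst h

theorem eventually_snd_lt {p : ℝ × ℝ} {a : ℝ} (h : p.2 < a) : ∀ᶠ q in 𝓝 p, q.2 < a :=
  continuousAt_snd.eventually_lt continuousAt_const h

theorem eventually_lt_snd {p : ℝ × ℝ} {a : ℝ} (h : a < p.2) : ∀ᶠ q in 𝓝 p, a < q.2 :=
  continuousAt_const.eventually_lt continuousAt_snd h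

theorem tendsto_line (p : ℝ × ℝ) (c m t : ℝ) :
    Tendsto (fun u => line p c m (u - t)) (𝓝 t) (𝓝 p) := by
  have : Continuous fun u => line p c m (u - t) := by
    change Continuous fun u => (p.1 + c * (u - t), p.2 + c * (u - t) * m)
    fun_prop
  have h := this.tendsto t
  simpa [line] using h

variable (hs0 : 0 < s) (hs1 : s < 1)
include hs0 hs1

/-- The two halves of a chart across a vertical side do not overlap beyond the side, so the sign of
the elapsed time decides which of the two chart formulas applies. -/
theorem eventually_vertical {e : Edge} (he : e = .A ∨ e = .C) {p : ℝ × ℝ} (hp : p ∈ side s e)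
    (hv : p ∉ vertices s) : ∀ᶠ q in 𝓝 p,
      (p.1 < q.1 → q ∉ polygon s) ∧ (q.1 < p.1 → glue s e q ∉ polygon s) := by
  obtain ⟨x, y⟩ := p
  rw [mem_side_iff] at hp
  rw [mem_vertices_iff] at hv
  rcases he with rfl | rfl
  · obtain ⟨rfl, h0, h1⟩ : x = 1 ∧ 0 < y ∧ y < 1 := by grind
    filter_upwards [eventually_lt_snd (p := (1, y)) h0, eventually_snd_lt (p := (1, y)) h1]
    rintro ⟨a, b⟩ hb0 hb1
    dsimp only at hb0 hb1
    simp only [glue, mem_polygon_iff]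
    have : s * b < s := by nlinarith
    refine ⟨fun h => by grind, fun h => ?_⟩
    have : s * (a - 1) < 0 := by nlinarith
    grind
  · obtain ⟨rfl, h0, h1⟩ : x = 1 - s ∧ 1 < y ∧ y < 1 + s := by grind
    filter_upwards [eventually_lt_snd (p := (1 - s, y)) h0,
      eventually_snd_lt (p := (1 - s, y)) h1]
    rintro ⟨a, b⟩ hb0 hb1
    dsimp only at hb0 hb1
    simp only [glue, mem_polygon_iff]
    refine ⟨fun h => by grind, fun h => ?_⟩
    have : (a - (1 - s)) / s < 0 := div_neg_of_neg_of_pos (by linarith) hs0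
    grind

/-- Both chart formulas can be meaningful at once only on the side itself, where the gluing makes
them the same point; for `E` they are literally equal. -/
theorem eventually_eq_of_represents_glue {e : Edge} {p : ℝ × ℝ} (hp : p ∈ side s e)
    (hv : p ∉ vertices s) : ∀ᶠ q in 𝓝 p, ∀ x x' : Surface s,
      Represents s q x → Represents s (glue s e q) x' → x = x' := by
  suffices h : e = .E ∨ ∀ᶠ q in 𝓝 p, q ∈ polygon s → glue s e q ∈ polygon s → q ∈ side s e by
    rcases h with rfl | h
    · exact Eventually.of_forall fun q x x' h h' => h.unique h'
    · filter_upwards [h] with q hq x x' h h'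
      exact h.unique ((Represents.glue_iff (hq h.1 h'.1) h.1 h'.1).1 h')
  have hvert := fun he => eventually_vertical hs0 hs1 (e := e) he hp hv
  obtain ⟨x, y⟩ := p
  rw [mem_side_iff] at hp
  rw [mem_vertices_iff] at hv
  rcases hp with ⟨rfl, rfl, h⟩ | ⟨rfl, h, rfl⟩ | ⟨rfl, rfl, h⟩ | ⟨rfl, h, rfl⟩ | ⟨rfl, rfl, h⟩
  · right
    filter_upwards [hvert (.inl rfl), eventually_lt_snd (p := (1, y)) (a := 0) (by grind),
      eventually_snd_lt (p := (1, y)) (a := 1) (by grind)]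
    rintro ⟨a, b⟩ hq h0 h1 hq1 hq2
    rw [mem_side_iff]; grind
  · right
    filter_upwards [eventually_lt_fst (p := (x, 1)) (a := 1 - s) (by grind),
      eventually_fst_lt (p := (x, 1)) (a := 1) (by grind)]
    rintro ⟨a, b⟩ h0 h1
    simp only [glue, mem_polygon_iff, mem_side_iff]
    grind
  · right
    filter_upwards [hvert (.inr rfl), eventually_lt_snd (p := (1 - s, y)) (a := 1) (by grind),
      eventually_snd_lt (p := (1 - s, y)) (a := 1 + s) (by grind)]
    rintro ⟨a, b⟩ hq h0 h1 hq1 hq2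
    rw [mem_side_iff]; grind
  · right
    filter_upwards [eventually_lt_fst (p := (x, 1 + s)) (a := 1 - 2 * s) (by grind),
      eventually_fst_lt (p := (x, 1 + s)) (a := 1 - s) (by grind)]
    rintro ⟨a, b⟩ h0 h1
    simp only [glue, mem_polygon_iff, mem_side_iff]
    grind
  · exact .inl rfl

/-- `x` is a point at time `v` of the local trajectory through `p` in the chart of `LinearAt`. -/
def LocalLine (s : ℝ) (m : ℝ) (p : ℝ × ℝ) (c v : ℝ) (x : Surface s) : Prop :=
  Represents s (line p c m v) x ∨
    ∃ e : Edge, p ∈ side s e ∧ Represents s (glue s e (line p c m v)) x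

theorem LocalLine.eventually_unique {m c t : ℝ} {p : ℝ × ℝ} (hv : p ∉ vertices s) :
    ∀ᶠ u in 𝓝 t, ∀ x x', LocalLine s m p c (u - t) x → LocalLine s m p c (u - t) x' → x = x' := by
  by_cases hp : ∃ e, p ∈ side s e
  · obtain ⟨e, he⟩ := hp
    filter_upwards [(tendsto_line p c m t).eventually
      (eventually_eq_of_represents_glue hs0 hs1 he hv)] with u hu x x' h h'
    rcases h with h | ⟨e1, he1, h⟩ <;> rcases h' with h' | ⟨e2, he2, h'⟩
    · exact h.unique h'
    · obtain rfl := mem_side_unique hs0 hs1 he he2 hv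
      exact hu _ _ h h'
    · obtain rfl := mem_side_unique hs0 hs1 he he1 hv
      exact (hu _ _ h' h).symm
    · obtain rfl := mem_side_unique hs0 hs1 he he1 hv
      obtain rfl := mem_side_unique hs0 hs1 he he2 hv
      exact h.unique h'
  · push Not at hp
    refine Eventually.of_forall fun u x x' h h' => ?_
    rcases h with h | ⟨e1, he1, h⟩
    · rcases h' with h' | ⟨e2, he2, h'⟩
      · exact h.unique h'
      · exact absurd he2 (hp e2)
    · exact absurd he1 (hp e1)

/-- The factor `κ` is the scaling of the homothety: `s` beyond `A`, `1 / s` beyond `C`, and 1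
elsewhere. It does not depend on the speed `c`, which makes two speeds comparable, and its bound `K`
controls the displacement for short times. -/
theorem LocalLine.horizontal_eq {m : ℝ} {p : ℝ × ℝ} (hv : p ∉ vertices s) :
    ∃ (κ : ℝ → ℝ) (K : ℝ), (∀ v, 0 < κ v ∧ κ v ≤ K) ∧ ∀ c t : ℝ, 0 < c → ∀ᶠ u in 𝓝 t, ∀ x,
      LocalLine s m p c (u - t) x →
        horizontal hs0.ne' x = ((p.1 + κ (u - t) * (c * (u - t)) : ℝ) : AddCircle s) := by
  by_cases hA : ∃ e, (e = .A ∨ e = .C) ∧ p ∈ side s e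
  · obtain ⟨e, he, hp⟩ := hA
    obtain ⟨k, hk0, n, hk⟩ : ∃ k : ℝ, 0 < k ∧ ∃ n : ℤ, ∀ q, (glue s e q).1 =
        p.1 + k * (q.1 - p.1) + n • s := by
      obtain ⟨x, y⟩ := p
      rw [mem_side_iff] at hp
      rcases he with rfl | rfl
      · obtain rfl : x = 1 := by grind
        exact ⟨s, hs0, -1, fun q => by simp [glue]; ring⟩
      · obtain rfl : x = 1 - s := by grind
        exact ⟨1 / s, by positivity, -1, fun q => by simp [glue]; ring⟩
    refine ⟨fun v => if 0 < v then k else 1, max k 1, fun v => ?_, fun c t hc => ?_⟩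
    · dsimp only; split_ifs
      · exact ⟨hk0, le_max_left _ _⟩
      · exact ⟨one_pos, le_max_right _ _⟩
    · filter_upwards [(tendsto_line p c m t).eventually
        (eventually_vertical hs0 hs1 he hp hv)] with u hu x hx
      simp only [line] at hu
      have hgl : ∀ v x, Represents s (glue s e (line p c m v)) x →
          horizontal hs0.ne' x = ((p.1 + k * (c * v) : ℝ) : AddCircle s) := by
        intro v x h
        rw [h.horizontal_eq hs0.ne', hk]
        simp [line]
      rcases hx with h | ⟨e1, he1, h⟩
      · have hle : u - t ≤ 0 := by
          by_contra! hlt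
          exact hu.1 (by nlinarith) h.1
        rw [if_neg hle.not_gt, h.horizontal_eq hs0.ne']
        simp [line]
      · obtain rfl := mem_side_unique hs0 hs1 hp he1 hv
        rw [hgl _ _ h]
        have hle : 0 ≤ u - t := by
          by_contra! hlt
          exact hu.2 (by nlinarith) h.1
        rcases hle.eq_or_lt with h0 | h0
        · rw [← h0]; simp
        · rw [if_pos h0]
  · push Not at hA
    refine ⟨fun _ => 1, 1, fun v => ⟨one_pos, le_rfl⟩, fun c t hc =>
      Eventually.of_forall fun u x hx => ?_⟩
    rcases hx with h | ⟨e, he, h⟩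
    · rw [h.horizontal_eq hs0.ne']; simp [line]
    · rw [h.horizontal_eq hs0.ne']
      cases e
      · exact absurd he (hA _ (.inl rfl))
      · simp [glue, line]
      · exact absurd he (hA _ (.inr rfl))
      · simp [glue, line]
      · simp [glue, line]

/-- `LinearAt` allows any representative as base point, but the chart reaches across a side only
from the representative on `side s e`. From the glued image the formula would put the immediate past
outside the polygon, because the curve moves right and does not descend. The only exception is a
horizontal line along the bottom of a rectangle, whose base point may be moved to the top. -/
theorem LinearAt.exists_normalForm {m t : ℝ} {τ : ℝ → Surface s} (hm : 0 ≤ m)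
    (h : LinearAt m τ t) (hreg : τ t ∉ singularSet s) : ∃ p c, normalForm s p = p ∧
      p ∉ vertices s ∧ 0 < c ∧ Represents s p (τ t) ∧
        ∀ᶠ u in 𝓝 t, LocalLine s m p c (u - t) (τ u) := by
  obtain ⟨p, c, hc, hp, h⟩ := h
  have hv : p ∉ vertices s := by rwa [hp.mem_singularSet_iff hs0 hs1] at hreg
  obtain ⟨hN, hNv, hpN | ⟨e, heE, he, hpe⟩⟩ := normalForm_spec hs0 hs1 hp.1 hv
  · exact ⟨p, c, hpN, hv, hc, hp, h⟩
  by_cases hpN : normalForm s p = p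
  · exact ⟨p, c, hpN, hv, hc, hp, h⟩
  have hrep := hp.normalForm hs0 hs1
  have hns : ∀ e, p ∉ side s e := fun e he => hpN (normalForm_of_mem_side hs0 hs1 he hv)
  have h' : ∀ᶠ u in 𝓝 t, Represents s (line p c m (u - t)) (τ u) := by
    filter_upwards [h] with u hu
    rcases hu with hu | ⟨e, he, -⟩
    · exact hu
    · exact absurd he (hns e)
  have hleft : ∀ {P : ℝ → Prop}, (∀ᶠ u in 𝓝 t, P u) → ∃ u < t, P u := fun hP =>
    ((hP.filter_mono nhdsWithin_le_nhds).and
      (self_mem_nhdsWithin : Iio t ∈ 𝓝[<] t)).exists.imp fun u hu => ⟨hu.2, hu.1⟩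
  refine ⟨normalForm s p, c, normalForm_of_mem_side hs0 hs1 he hNv, hNv, hc, hrep, ?_⟩
  generalize normalForm s p = q at *
  obtain ⟨x, y⟩ := q
  subst hpe
  have hside := he
  rw [mem_side_iff] at he
  rw [mem_vertices_iff] at hNv
  rcases he with ⟨rfl, rfl, hy⟩ | ⟨rfl, hx, rfl⟩ | ⟨rfl, rfl, hy⟩ | ⟨rfl, hx, rfl⟩ | ⟨rfl, -⟩
  · exfalso
    obtain ⟨u, hut, hu⟩ := hleft h'
    have h1 := hu.1
    simp only [line, glue, mem_polygon_iff] at h1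
    have h2 : c * (u - t) < 0 := by nlinarith
    have h3 : c * (u - t) * m ≤ 0 := by nlinarith
    have h4 : s * y < s := by
      have : y < 1 := by grind
      nlinarith
    grind
  · obtain hm0 | hm0 := hm.eq_or_lt
    · filter_upwards [h'] with u hu
      right
      refine ⟨.B, hside, ?_⟩
      simpa [line, glue, ← hm0] using hu
    · exfalso
      obtain ⟨u, hut, hu1, hu2⟩ := hleft (h'.and ((tendsto_line _ c m t).eventually
        (eventually_lt_fst (p := glue s .B (x, 1)) (a := 1 - s) (by simp [glue]; grind))))
      have h1 := hu1.1
      simp only [line, glue, mem_polygon_iff] at h1 hu2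
      have h2 : c * (u - t) < 0 := by nlinarith
      have h3 : c * (u - t) * m < 0 := by nlinarith
      grind
  · exfalso
    obtain ⟨u, hut, hu⟩ := hleft h'
    have h1 := hu.1
    simp only [line, glue, mem_polygon_iff] at h1
    have h2 : c * (u - t) < 0 := by nlinarith
    have h3 : (1 - s - (1 - s)) / s = 0 := by simp
    grind
  · obtain hm0 | hm0 := hm.eq_or_lt
    · filter_upwards [h'] with u hu
      right
      refine ⟨.D, hside, ?_⟩
      simpa [line, glue, ← hm0] using hu
    · exfalso
      obtain ⟨u, hut, hu1, hu2⟩ := hleft (h'.and ((tendsto_line _ c m t).eventually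
        (eventually_fst_lt (p := glue s .D (x, 1 + s)) (a := 1 - s) (by simp [glue]; grind))))
      have h1 := hu1.1
      simp only [line, glue, mem_polygon_iff] at h1 hu2
      have h2 : c * (u - t) < 0 := by nlinarith
      have h3 : c * (u - t) * m < 0 := by nlinarith
      grind
  · exact absurd rfl heE

/-- Normal forms give both curves the same base point. At one nearby common time the horizontal
coordinates agree modulo `s` and differ by less than `s`, so the speeds are equal and one chart
formula describes both curves. -/
theorem LinearAt.eventually_eq_of_frequently_eq {m t : ℝ} {τ σ : ℝ → Surface s} (hm : 0 ≤ m)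
    (hτ : LinearAt m τ t) (hσ : LinearAt m σ t) (hreg : τ t ∉ singularSet s) (heq : τ t = σ t)
    (hfr : ∃ᶠ u in 𝓝[≠] t, τ u = σ u) : ∀ᶠ u in 𝓝 t, τ u = σ u := by
  obtain ⟨p, c, hpN, hpv, hc, hp, h⟩ := hτ.exists_normalForm hs0 hs1 hm hreg
  obtain ⟨p', c', hpN', -, hc', hp', h'⟩ := hσ.exists_normalForm hs0 hs1 hm (heq ▸ hreg)
  obtain rfl : p = p' := by
    rw [← hpN, ← hpN']
    exact hp.normalForm_eq hs0 hs1 (heq ▸ hp')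
  obtain ⟨κ, K, hκ, hhor⟩ := LocalLine.horizontal_eq hs0 hs1 (m := m) hpv
  have hK : 0 < K := (hκ 0).1.trans_le (hκ 0).2
  have hcc : c = c' := by
    have hsmall : ∀ᶠ u in 𝓝 t, K * (|c - c'| * |u - t|) < s := by
      have : Continuous fun u => K * (|c - c'| * |u - t|) := by fun_prop
      exact (this.tendsto t).eventually_lt_const (by simpa using hs0)
    have hev := (((h.and (hhor c t hc)).and (h'.and (hhor c' t hc'))).and hsmall).filter_mono
      (nhdsWithin_le_nhds (s := {t}ᶜ))
    obtain ⟨u, hu, ⟨⟨⟨hu1, hu2⟩, hu3, hu4⟩, hu5⟩, hut⟩ := (hfr.and_eventually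
      (hev.and self_mem_nhdsWithin)).exists
    have e1 := hu2 _ hu1
    rw [hu, hu4 _ hu3] at e1
    have e2 := eq_of_coe_eq_of_abs_lt e1 (by
      have : p.1 + κ (u - t) * (c' * (u - t)) - (p.1 + κ (u - t) * (c * (u - t))) =
        κ (u - t) * ((c' - c) * (u - t)) := by ring
      rw [this, abs_mul, abs_mul, abs_of_pos (hκ _).1, abs_sub_comm c' c]
      refine lt_of_le_of_lt ?_ hu5
      gcongr
      exact (hκ _).2)
    have hne : u - t ≠ 0 := sub_ne_zero.2 hut
    have := (hκ (u - t)).1.ne'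
    have e3 := mul_left_cancel₀ this (add_left_cancel e2)
    exact (mul_right_cancel₀ hne e3).symm
  subst hcc
  filter_upwards [h, h', LocalLine.eventually_unique hs0 hs1 (m := m) (c := c) (t := t) hpv]
    with u hu hu' hun
  exact hun _ _ hu hu'

end

/-! ### Uniqueness and extension of linear trajectories -/

theorem LinearAt.congr {s m t : ℝ} {τ σ : ℝ → Surface s} (h : LinearAt m τ t)
    (heq : τ =ᶠ[𝓝 t] σ) : LinearAt m σ t := by
  obtain ⟨p, c, hc, hp, h⟩ := h
  refine ⟨p, c, hc, heq.self_of_nhds ▸ hp, ?_⟩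
  filter_upwards [h, heq] with u hu hu'
  rwa [hu'] at hu

/-- Affine reparametrization. -/
theorem LinearAt.comp_affine {s m t a b : ℝ} {τ : ℝ → Surface s} (ha : 0 < a)
    (h : LinearAt m τ (a * t + b)) : LinearAt m (fun u => τ (a * u + b)) t := by
  obtain ⟨p, c, hc, hp, h⟩ := h
  refine ⟨p, c * a, by positivity, hp, ?_⟩
  have : Tendsto (fun u => a * u + b) (𝓝 t) (𝓝 (a * t + b)) :=
    (by fun_prop : Continuous fun u => a * u + b).tendsto t
  filter_upwards [this.eventually h] with u hu
  have : line p (c * a) m (u - t) = line p c m (a * u + b - (a * t + b)) := by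
    simp only [line, Prod.mk.injEq]; constructor <;> ring
  rwa [this]

theorem IsLinearTrajectory.comp_affine {s m a b : ℝ} {I : Set ℝ} {τ : ℝ → Surface s} (ha : 0 < a)
    (h : IsLinearTrajectory m I τ) :
    IsLinearTrajectory m ((fun u => a * u + b) ⁻¹' I) (fun u => τ (a * u + b)) := by
  have hc : Continuous fun u => a * u + b := by fun_prop
  have hint : ∀ t ∈ interior ((fun u => a * u + b) ⁻¹' I), a * t + b ∈ interior I := by
    intro t ht
    have hopen : IsOpenMap fun u : ℝ => a * u + b := by
      intro U hU
      have : (fun u => a * u + b) '' U = (fun v => (v - b) / a) ⁻¹' U := by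
        ext v
        constructor
        · rintro ⟨u, hu, rfl⟩
          have : (a * u + b - b) / a = u := by field_simp; ring
          rwa [mem_preimage, this]
        · intro hv
          exact ⟨_, hv, by field_simp; ring⟩
      rw [this]
      exact hU.preimage (by fun_prop)
    exact hopen.image_interior_subset _ |>.trans (interior_mono (image_preimage_subset _ _))
      ⟨t, ht, rfl⟩
  refine ⟨?_, ?_, h.continuousOn.comp hc.continuousOn fun u hu => hu, fun t ht =>
    h.regular _ (hint t ht), fun t ht => (h.linear _ (hint t ht)).comp_affine ha⟩
  · exact h.ordConnected.preimage_mono fun u v huv => by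
      have := mul_le_mul_of_nonneg_left huv ha.le
      linarith
  · obtain ⟨u, hu, v, hv, huv⟩ := h.nontrivial
    refine ⟨(u - b) / a, ?_, (v - b) / a, ?_, fun h => huv ?_⟩
    · rw [mem_preimage]; convert hu using 1; field_simp; ring
    · rw [mem_preimage]; convert hv using 1; field_simp; ring
    · have := congrArg (fun w => a * w + b) h
      field_simp at this
      linarith

theorem nonempty_interior_of_ordConnected {I : Set ℝ} (h : I.OrdConnected) (hn : I.Nontrivial) :
    (interior I).Nonempty := by
  obtain ⟨a, ha, b, hb, hab⟩ := hn.exists_lt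
  exact (nonempty_Ioo.2 hab).mono
    ((isOpen_Ioo.subset_interior_iff).2 (Ioo_subset_Icc_self.trans (h.out ha hb)))

theorem subset_closure_interior_of_ordConnected {I : Set ℝ} (h : I.OrdConnected)
    (hn : I.Nontrivial) : I ⊆ closure (interior I) :=
  subset_closure.trans ((h.convex (𝕜 := ℝ)).closure_interior_eq_closure_of_nonempty_interior
    (nonempty_interior_of_ordConnected h hn)).ge

theorem IsLinearTrajectory.congr {s m : ℝ} {I : Set ℝ} {τ σ : ℝ → Surface s}
    (h : IsLinearTrajectory m I τ) (heq : EqOn τ σ I) : IsLinearTrajectory m I σ := by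
  refine ⟨h.ordConnected, h.nontrivial, h.continuousOn.congr heq.symm, fun t ht => ?_,
    fun t ht => ?_⟩
  · rw [← heq (interior_subset ht)]; exact h.regular t ht
  · exact (h.linear t ht).congr ((mem_interior_iff_mem_nhds.1 ht) |> Filter.mem_of_superset <|
      fun u hu => heq hu)

/-- Two linear trajectories of the same slope that agree on some interval agree wherever both are
defined. -/
theorem IsLinearTrajectory.eqOn {s m : ℝ} (hs0 : 0 < s) (hs1 : s < 1) (hm : 0 ≤ m) {I J : Set ℝ}
    {τ σ : ℝ → Surface s} (hτ : IsLinearTrajectory m I τ) (hσ : IsLinearTrajectory m J σ)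
    {a b : ℝ} (hab : a < b) (haI : Ioo a b ⊆ I) (haJ : Ioo a b ⊆ J) (heq : EqOn τ σ (Ioo a b)) :
    EqOn τ σ (I ∩ J) := by
  have := t2Space_surface hs0 hs1
  have hoc : (I ∩ J).OrdConnected := hτ.ordConnected.inter hσ.ordConnected
  have hnt : (I ∩ J).Nontrivial := by
    have : (Ioo a b).Nontrivial := ⟨(2 * a + b) / 3, by constructor <;> linarith,
      (a + 2 * b) / 3, by constructor <;> linarith, fun h => by linarith⟩
    exact this.mono (subset_inter haI haJ)
  -- Connectedness argument: at a limit of interior points of agreement, Hausdorffness gives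
  -- equality and the local lemma spreads it to a neighbourhood. Endpoints of the common domain
  -- follow by continuity.
  have key : interior (I ∩ J) ⊆ interior {u | τ u = σ u} := by
    refine IsPreconnected.subset_of_closure_inter_subset ?_ isOpen_interior ?_ ?_
    · have : (interior (I ∩ J)).OrdConnected := ((hoc.convex (𝕜 := ℝ)).interior).ordConnected
      exact this.isPreconnected
    · obtain ⟨t, ht⟩ := nonempty_Ioo.2 hab
      exact ⟨t, interior_mono (subset_inter haI haJ) (by rwa [isOpen_Ioo.interior_eq]),
        mem_interior_iff_mem_nhds.2 (mem_of_superset (isOpen_Ioo.mem_nhds ht) heq)⟩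
    · rintro t ⟨htc, htI⟩
      by_cases ht : t ∈ interior {u | τ u = σ u}
      · exact ht
      rw [interior_inter] at htI
      have hfr : ∃ᶠ u in 𝓝[≠] t, τ u = σ u := by
        have h1 : ∃ᶠ u in 𝓝 t, u ∈ interior {u | τ u = σ u} := mem_closure_iff_frequently.1 htc
        rw [frequently_nhdsWithin_iff]
        exact h1.mono fun u hu => ⟨(interior_subset hu : u ∈ {u | τ u = σ u}), fun h => ht (h ▸ hu)⟩
      have hcτ : ContinuousAt τ t :=
        hτ.continuousOn.continuousAt (mem_interior_iff_mem_nhds.1 htI.1)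
      have hcσ : ContinuousAt σ t :=
        hσ.continuousOn.continuousAt (mem_interior_iff_mem_nhds.1 htI.2)
      have heq' : τ t = σ t := by
        by_contra hne
        have := (hcτ.prodMk hcσ).eventually (isClosed_diagonal.isOpen_compl.mem_nhds
          (show (τ t, σ t) ∈ (diagonal (Surface s))ᶜ from hne))
        obtain ⟨u, hu, hu'⟩ := (hfr.and_eventually (this.filter_mono nhdsWithin_le_nhds)).exists
        exact hu' hu
      exact mem_interior_iff_mem_nhds.2 ((hτ.linear t htI.1).eventually_eq_of_frequently_eq hs0 hs1
        hm (hσ.linear t htI.2) (hτ.regular t htI.1) heq' hfr)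
  exact EqOn.of_subset_closure (fun u hu => (interior_subset (key hu) : u ∈ {u | τ u = σ u}))
    (hτ.continuousOn.mono inter_subset_left) (hσ.continuousOn.mono inter_subset_right)
    interior_subset (subset_closure_interior_of_ordConnected hoc hnt)

theorem mem_interior_of_lt_of_lt {I : Set ℝ} (h : I.OrdConnected) {a t b : ℝ} (ha : a ∈ I)
    (hb : b ∈ I) (hat : a < t) (htb : t < b) : t ∈ interior I :=
  mem_interior_iff_mem_nhds.2 (mem_of_superset (Icc_mem_nhds hat htb) (h.out ha hb))

theorem exists_lt_lt_of_mem_interior {I : Set ℝ} {t : ℝ} (h : t ∈ interior I) :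
    ∃ a ∈ I, ∃ b ∈ I, a < t ∧ t < b := by
  obtain ⟨a, b, hab, hI⟩ := mem_nhds_iff_exists_Ioo_subset.1 (mem_interior_iff_mem_nhds.1 h)
  exact ⟨(a + t) / 2, hI ⟨by linarith [hab.1], by linarith [hab.1, hab.2]⟩, (t + b) / 2,
    hI ⟨by linarith [hab.1, hab.2], by linarith [hab.2]⟩, by linarith [hab.1], by linarith [hab.2]⟩

/-- A directed union of linear trajectories is a linear trajectory. -/
theorem isLinearTrajectory_sUnion {s m : ℝ} {S : Set (Set ℝ)} {τ : ℝ → Surface s}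
    (hne : S.Nonempty) (hd : ∀ I ∈ S, ∀ J ∈ S, ∀ a ∈ I, ∀ b ∈ J, ∃ K ∈ S, a ∈ K ∧ b ∈ K)
    (h : ∀ I ∈ S, IsLinearTrajectory m I τ) : IsLinearTrajectory m (⋃₀ S) τ := by
  have hint : ∀ t ∈ interior (⋃₀ S), ∃ I ∈ S, t ∈ interior I := by
    intro t ht
    obtain ⟨a, ⟨I, hI, haI⟩, b, ⟨J, hJ, hbJ⟩, hat, htb⟩ := exists_lt_lt_of_mem_interior ht
    obtain ⟨K, hK, haK, hbK⟩ := hd I hI J hJ a haI b hbJ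
    exact ⟨K, hK, mem_interior_of_lt_of_lt (h K hK).ordConnected haK hbK hat htb⟩
  refine ⟨⟨fun a ha b hb => ?_⟩, ?_, ?_, fun t ht => ?_, fun t ht => ?_⟩
  · obtain ⟨I, hI, haI⟩ := ha
    obtain ⟨J, hJ, hbJ⟩ := hb
    obtain ⟨K, hK, haK, hbK⟩ := hd I hI J hJ a haI b hbJ
    exact ((h K hK).ordConnected.out haK hbK).trans (subset_sUnion_of_mem hK)
  · obtain ⟨I, hI⟩ := hne
    exact (h I hI).nontrivial.mono (subset_sUnion_of_mem hI)
  · intro t ht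
    -- Each side of `t` is treated separately: if the union contains a point on that side,
    -- directedness puts it and `t` into one member of `S`.
    have hleft : ContinuousWithinAt τ (⋃₀ S ∩ Iic t) t := by
      by_cases hex : ∃ a ∈ ⋃₀ S, a < t
      · obtain ⟨a, ⟨I, hI, haI⟩, hat⟩ := hex
        obtain ⟨J, hJ, htJ⟩ := ht
        obtain ⟨K, hK, haK, htK⟩ := hd I hI J hJ a haI t htJ
        refine ((h K hK).continuousOn t htK).mono_of_mem_nhdsWithin ?_
        rw [mem_nhdsWithin]
        exact ⟨Ioi a, isOpen_Ioi, hat, fun u hu => (h K hK).ordConnected.out haK htK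
          ⟨le_of_lt hu.1, hu.2.2⟩⟩
      · push Not at hex
        refine (continuousWithinAt_singleton (x := t)).mono fun u hu => ?_
        exact le_antisymm hu.2 (hex u hu.1)
    have hright : ContinuousWithinAt τ (⋃₀ S ∩ Ici t) t := by
      by_cases hex : ∃ a ∈ ⋃₀ S, t < a
      · obtain ⟨a, ⟨I, hI, haI⟩, hat⟩ := hex
        obtain ⟨J, hJ, htJ⟩ := ht
        obtain ⟨K, hK, haK, htK⟩ := hd I hI J hJ a haI t htJ
        refine ((h K hK).continuousOn t htK).mono_of_mem_nhdsWithin ?_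
        rw [mem_nhdsWithin]
        exact ⟨Iio a, isOpen_Iio, hat, fun u hu => (h K hK).ordConnected.out htK haK
          ⟨hu.2.2, le_of_lt hu.1⟩⟩
      · push Not at hex
        refine (continuousWithinAt_singleton (x := t)).mono fun u hu => ?_
        exact le_antisymm (hex u hu.1) hu.2
    have := hleft.union hright
    rwa [← inter_union_distrib_left, Iic_union_Ici, inter_univ] at this
  · obtain ⟨I, hI, htI⟩ := hint t ht
    exact (h I hI).regular t htI
  · obtain ⟨I, hI, htI⟩ := hint t ht
    exact (h I hI).linear t htI

open Classical in
/-- Two linear trajectories that agree on a common interval have a common extension. -/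
theorem IsLinearTrajectory.union {s m : ℝ} {I J : Set ℝ} {τ σ : ℝ → Surface s}
    (hτ : IsLinearTrajectory m I τ) (hσ : IsLinearTrajectory m J σ) (hn : (I ∩ J).Nontrivial)
    (heq : EqOn τ σ (I ∩ J)) :
    IsLinearTrajectory m (I ∪ J) (I.piecewise τ σ) := by
  have h1 : IsLinearTrajectory m I (I.piecewise τ σ) := hτ.congr (piecewise_eqOn I τ σ).symm
  have h2 : IsLinearTrajectory m J (I.piecewise τ σ) := by
    refine hσ.congr fun u hu => ?_
    by_cases h : u ∈ I
    · rw [piecewise_eq_of_mem _ _ _ h, heq ⟨h, hu⟩]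
    · rw [piecewise_eq_of_notMem _ _ _ h]
  obtain ⟨a, ha, b, hb, hab⟩ := hn.exists_lt
  have hint : ∀ t ∈ interior (I ∪ J), t ∈ interior I ∨ t ∈ interior J := by
    intro t ht
    obtain ⟨a', ha', b', hb', hat, htb⟩ := exists_lt_lt_of_mem_interior ht
    by_cases hta : t ≤ a
    · rcases ha' with h | h
      · exact .inl (mem_interior_of_lt_of_lt hτ.ordConnected h hb.1 hat (hta.trans_lt hab))
      · exact .inr (mem_interior_of_lt_of_lt hσ.ordConnected h hb.2 hat (hta.trans_lt hab))
    · rcases hb' with h | h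
      · exact .inl (mem_interior_of_lt_of_lt hτ.ordConnected ha.1 h (not_le.1 hta) htb)
      · exact .inr (mem_interior_of_lt_of_lt hσ.ordConnected ha.2 h (not_le.1 hta) htb)
  have hoc : (I ∪ J).OrdConnected :=
    (hτ.ordConnected.isPreconnected.union a ha.1 ha.2 hσ.ordConnected.isPreconnected).ordConnected
  refine ⟨hoc, hτ.nontrivial.mono subset_union_left, ?_, fun t ht => ?_, fun t ht => ?_⟩
  · have hcl : ∀ {t K L}, IsLinearTrajectory m K (I.piecewise τ σ) → t ∈ K → K.OrdConnected →
        L.OrdConnected → a ∈ K → b ∈ K → a ∈ L → b ∈ L → K ∪ L = I ∪ J →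
        ContinuousWithinAt (I.piecewise τ σ) L t ∨ t ∉ L →
        ContinuousWithinAt (I.piecewise τ σ) (I ∪ J) t := by
      intro t K L hK htK hKo hLo haK hbK haL hbL hKL hL
      rw [← hKL]
      refine (hK.continuousOn t htK).union ?_
      rcases hL with hL | hL
      · exact hL
      · rcases lt_or_ge t b with htb | htb
        · have hta : t < a := by
            by_contra! h
            exact hL (hLo.out haL hbL ⟨h, htb.le⟩)
          refine (hK.continuousOn t htK).mono_of_mem_nhdsWithin ?_
          rw [mem_nhdsWithin]
          refine ⟨Iio a, isOpen_Iio, hta, fun u hu => ?_⟩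
          rcases lt_or_ge u t with hut | hut
          · exact absurd (hLo.out hu.2 haL ⟨hut.le, hta.le⟩) hL
          · exact hKo.out htK haK ⟨hut, le_of_lt hu.1⟩
        · have hbt : b < t := lt_of_le_of_ne htb fun h => hL (h ▸ hbL)
          refine (hK.continuousOn t htK).mono_of_mem_nhdsWithin ?_
          rw [mem_nhdsWithin]
          refine ⟨Ioi b, isOpen_Ioi, hbt, fun u hu => ?_⟩
          rcases lt_or_ge t u with hut | hut
          · exact absurd (hLo.out hbL hu.2 ⟨hbt.le, hut.le⟩) hL
          · exact hKo.out hbK htK ⟨le_of_lt hu.1, hut⟩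
    intro t ht
    by_cases htI : t ∈ I
    · refine hcl h1 htI hτ.ordConnected hσ.ordConnected ha.1 hb.1 ha.2 hb.2 rfl ?_
      by_cases htJ : t ∈ J
      · exact .inl (h2.continuousOn t htJ)
      · exact .inr htJ
    · have htJ : t ∈ J := ht.resolve_left htI
      exact hcl h2 htJ hσ.ordConnected hτ.ordConnected ha.2 hb.2 ha.1 hb.1 (union_comm _ _)
        (.inr htI)
  · rcases hint t ht with h | h
    · exact h1.regular t h
    · exact h2.regular t h
  · rcases hint t ht with h | h
    · exact h1.linear t h
    · exact h2.linear t h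

open Classical in
/-- The domain of a maximal trajectory contains the domain of every trajectory that agrees with it
on some interval. -/
theorem IsMaximalTrajectory.subset {s m : ℝ} (hs0 : 0 < s) (hs1 : s < 1) (hm : 0 ≤ m)
    {I J : Set ℝ} {τ σ : ℝ → Surface s} (hτ : IsMaximalTrajectory m I τ)
    (hσ : IsLinearTrajectory m J σ) {a b : ℝ} (hab : a < b) (haI : Ioo a b ⊆ I)
    (haJ : Ioo a b ⊆ J) (heq : EqOn τ σ (Ioo a b)) : J ⊆ I ∧ EqOn τ σ J := by
  have h := hτ.1.eqOn hs0 hs1 hm hσ hab haI haJ heq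
  have hnt : (Ioo a b).Nontrivial := ⟨(2 * a + b) / 3, by constructor <;> linarith,
      (a + 2 * b) / 3, by constructor <;> linarith, fun h => by linarith⟩
  have := hτ.2 _ _ (hτ.1.union hσ (hnt.mono (subset_inter haI haJ)) h) subset_union_left
    (piecewise_eqOn I τ σ)
  have hJ : J ⊆ I := union_eq_left.1 this
  exact ⟨hJ, fun u hu => h ⟨hJ hu, hu⟩⟩

/-- Every linear trajectory extends to a maximal one. -/
theorem IsLinearTrajectory.exists_maximal {s m : ℝ} {I : Set ℝ} {τ : ℝ → Surface s}
    (h : IsLinearTrajectory m I τ) :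
    ∃ J σ, IsMaximalTrajectory m J σ ∧ I ⊆ J ∧ EqOn σ τ I := by
  let X := {q : Set ℝ × (ℝ → Surface s) // IsLinearTrajectory m q.1 q.2 ∧ I ⊆ q.1 ∧ EqOn q.2 τ I}
  let r : X → X → Prop := fun q q' => q.1.1 ⊆ q'.1.1 ∧ EqOn q'.1.2 q.1.2 q.1.1
  have htrans : ∀ {a b c : X}, r a b → r b c → r a c := fun hab hbc =>
    ⟨hab.1.trans hbc.1, fun u hu => (hbc.2 (hab.1 hu)).trans (hab.2 hu)⟩
  obtain ⟨⟨⟨J, σ⟩, hJ, hIJ, hσ⟩, hmax⟩ := exists_maximal_of_chains_bounded (r := r) (by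
    intro C hC
    rcases C.eq_empty_or_nonempty with rfl | hne
    · exact ⟨⟨(I, τ), h, subset_rfl, fun u _ => rfl⟩, by simp⟩
    classical
    -- Upper bound of the chain: the value is read off any member defined at `u`, and comparability
    -- makes the choice immaterial.
    let ρ : ℝ → Surface s := fun u =>
      if hu : ∃ q ∈ C, u ∈ q.1.1 then hu.choose.1.2 u else τ u
    have hcmp : ∀ q ∈ C, ∀ q' ∈ C, r q q' ∨ r q' q := by
      intro q hq q' hq'
      by_cases hqq : q = q'
      · subst hqq; exact .inl ⟨subset_rfl, fun u _ => rfl⟩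
      · exact hC hq hq' hqq
    have hρ : ∀ q ∈ C, EqOn ρ q.1.2 q.1.1 := by
      intro q hq u hu
      have hex : ∃ q ∈ C, u ∈ q.1.1 := ⟨q, hq, hu⟩
      simp only [ρ, dif_pos hex]
      obtain ⟨h1, h2⟩ := hex.choose_spec
      rcases hcmp q hq _ h1 with h3 | h3
      · exact h3.2 hu
      · exact (h3.2 h2).symm
    have hlin : IsLinearTrajectory m (⋃₀ ((fun q : X => q.1.1) '' C)) ρ := by
      refine isLinearTrajectory_sUnion (hne.image _) ?_ ?_
      · rintro _ ⟨q, hq, rfl⟩ _ ⟨q', hq', rfl⟩ a ha b hb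
        rcases hcmp q hq q' hq' with h3 | h3
        · exact ⟨_, ⟨q', hq', rfl⟩, h3.1 ha, hb⟩
        · exact ⟨_, ⟨q, hq, rfl⟩, ha, h3.1 hb⟩
      · rintro _ ⟨q, hq, rfl⟩
        exact q.2.1.congr (hρ q hq).symm
    obtain ⟨q₀, hq₀⟩ := hne
    refine ⟨⟨(_, ρ), hlin, q₀.2.2.1.trans (subset_sUnion_of_mem ⟨q₀, hq₀, rfl⟩), fun u hu => ?_⟩,
      fun q hq => ⟨subset_sUnion_of_mem ⟨q, hq, rfl⟩, hρ q hq⟩⟩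
    exact (hρ q₀ hq₀ (q₀.2.2.1 hu)).trans (q₀.2.2.2 hu)) htrans
  refine ⟨J, σ, ⟨hJ, fun K ρ hK hJK hρ => ?_⟩, hIJ, hσ⟩
  have := hmax ⟨(K, ρ), hK, hIJ.trans hJK, fun u hu => (hρ (hIJ hu)).trans (hσ hu)⟩ ⟨hJK, hρ⟩
  exact this.1.antisymm hJK

/-! ### The cylinder covered by the right rectangle -/

section

variable {s : ℝ}

/-- The point of `R_s^+` nearest to `(x, y)`. -/
def clamp (hs : 0 < s) (x y : ℝ) : polygon s :=
  ⟨(max (1 - s) (min 1 x), max 0 (min 1 y)), by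
    rw [mem_polygon_iff]
    left
    simp [hs.le]⟩

/-- The point of the surface represented by `(x, y)` modulo vertical translations by integers, for
`1 - s ≤ x ≤ 1`. -/
def strip (hs : 0 < s) (x y : ℝ) : Surface s := toSurface s (clamp hs x (Int.fract y))

variable (hs0 : 0 < s)
include hs0

theorem clamp_one_eq_clamp_zero (x : ℝ) :
    toSurface s (clamp hs0 x 0) = toSurface s (clamp hs0 x 1) := by
  refine (toSurface_glue (e := .B) ?_ ?_).symm
  · simp [clamp, side, hs0.le]
  · simp [clamp, glue]

/-- The jump of `Int.fract` at integers is invisible on the surface, because `B` identifies the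
heights 0 and 1. -/
theorem continuous_strip {X : Type*} [TopologicalSpace X] {f g : X → ℝ} (hf : Continuous f)
    (hg : Continuous g) : Continuous fun u => strip hs0 (f u) (g u) := by
  have h : Continuous fun q : ℝ × ℝ => toSurface s (clamp hs0 q.1 q.2) := by
    refine continuous_toSurface.comp (Continuous.subtype_mk ?_ _)
    fun_prop
  exact ContinuousOn.comp_fract (f := fun u y => toSurface s (clamp hs0 (f u) y))
    (h.comp ((hf.comp continuous_fst).prodMk continuous_snd)).continuousOn hg
    fun u => clamp_one_eq_clamp_zero hs0 (f u)

theorem strip_add_int (x y : ℝ) (h : ℤ) : strip hs0 x (y + h) = strip hs0 x y := by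
  simp [strip]

theorem represents_strip {x y : ℝ} (hx0 : 1 - s ≤ x) (hx1 : x ≤ 1) (hy0 : 0 ≤ y) (hy1 : y ≤ 1) :
    Represents s (x, y) (strip hs0 x y) := by
  have h : ∀ y' : ℝ, 0 ≤ y' → y' ≤ 1 → Represents s (x, y') (toSurface s (clamp hs0 x y')) := by
    intro y' h0 h1
    have := represents_toSurface (clamp hs0 x y')
    simpa [clamp, hx0, hx1, h0, h1] using this
  rcases hy1.eq_or_lt with rfl | hy1
  · have := h 1 hy0 hy1
    rw [← clamp_one_eq_clamp_zero] at this
    simpa [strip] using this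
  · have := h y hy0 hy1.le
    rwa [strip, Int.fract_eq_self.2 ⟨hy0, hy1⟩]

theorem represents_strip_sub_int {x y : ℝ} (h : ℤ) (hx0 : 1 - s ≤ x) (hx1 : x ≤ 1)
    (hy0 : 0 ≤ y - h) (hy1 : y - h ≤ 1) : Represents s (x, y - h) (strip hs0 x y) := by
  have := represents_strip hs0 hx0 hx1 hy0 hy1
  rwa [← strip_add_int hs0 x (y - h) h, sub_add_cancel] at this

/-- The interval is open at 0 and closed at 1 because the normal form represents `B` by the top of
`R_s^+`. -/
theorem exists_int_sub_mem_Ioc (y : ℝ) : ∃ h : ℤ, 0 < y - h ∧ y - h ≤ 1 :=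
  ⟨⌈y⌉ - 1, by push_cast; linarith [Int.ceil_lt_add_one y], by push_cast; linarith [Int.le_ceil y]⟩

variable (hs1 : s < 1)
include hs1

theorem strip_notMem_singularSet {x y : ℝ} (hx0 : 1 - s < x) (hx1 : x < 1) :
    strip hs0 x y ∉ singularSet s := by
  obtain ⟨h, h0, h1⟩ := exists_int_sub_mem_Ioc hs0 y
  rw [(represents_strip_sub_int hs0 h hx0.le hx1.le h0.le h1).mem_singularSet_iff hs0 hs1]
  exact not_mem_vertices_of_mem_Ioo hs0 hs1 hx0 hx1 _

theorem strip_one_notMem_singularSet {y : ℝ} (h : ℤ) (h0 : 0 < y - h) (h1 : y - h < 1) :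
    strip hs0 1 y ∉ singularSet s := by
  rw [(represents_strip_sub_int hs0 h (by linarith) le_rfl h0.le h1.le).mem_singularSet_iff hs0 hs1]
  exact not_mem_vertices_A hs0 hs1 h0 h1

theorem strip_one_mem_singularSet (h : ℤ) : strip hs0 1 h ∈ singularSet s := by
  rw [(represents_strip_sub_int hs0 (h - 1) (by linarith) le_rfl (by simp)
    (by simp)).mem_singularSet_iff hs0 hs1, mem_vertices_iff]
  simp

theorem strip_mem_edge_iff {x y : ℝ} (hx0 : 1 - s < x) (hx1 : x < 1) {e : Edge} :
    strip hs0 x y ∈ edge s e ↔ e = .B ∧ ∃ h : ℤ, y = h := by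
  obtain ⟨h, h0, h1⟩ := exists_int_sub_mem_Ioc hs0 y
  rw [(represents_strip_sub_int hs0 h hx0.le hx1.le h0.le h1).mem_edge_iff hs0 hs1
    (not_mem_vertices_of_mem_Ioo hs0 hs1 hx0 hx1 _), normalForm_right hs0 hs1 hx0 hx1 h0.ne',
    mem_side_iff]
  have : (∃ h : ℤ, y = h) ↔ y - h = 1 := by
    constructor
    · rintro ⟨k, rfl⟩
      have h2 : (0 : ℤ) < k - h := by exact_mod_cast h0
      have h3 : k - h ≤ 1 := by exact_mod_cast h1
      have : k - h = 1 := by omega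
      exact_mod_cast this
    · intro h2
      exact ⟨h + 1, by push_cast; linarith⟩
  rw [this]
  grind

theorem strip_one_mem_edge_iff {y : ℝ} (h : ℤ) (h0 : 0 < y - h) (h1 : y - h < 1) {e : Edge} :
    strip hs0 1 y ∈ edge s e ↔ e = .A := by
  rw [(represents_strip_sub_int hs0 h (by linarith) le_rfl h0.le h1.le).mem_edge_iff hs0 hs1
    (not_mem_vertices_A hs0 hs1 h0 h1), normalForm_A hs0 hs1 h0 h1, mem_side_iff]
  grind

theorem strip_one_eq {y : ℝ} (h : ℤ) (h0 : 0 ≤ y - h) (h1 : y - h ≤ 1) :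
    strip hs0 1 y = strip hs0 (1 - s) (s * (y - h)) := by
  have h2 := represents_strip_sub_int hs0 h (by linarith) le_rfl h0 h1
  have h3 := represents_strip hs0 (x := 1 - s) (y := s * (y - h)) le_rfl (by linarith)
    (by positivity) (by nlinarith)
  have hside : ((1 : ℝ), y - h) ∈ side s .A := by rw [mem_side_iff]; grind
  have hg : glue s .A (1, y - h) = (1 - s, s * (y - h)) := by simp [glue]
  rw [← hg] at h3
  exact h2.unique ((Represents.glue_iff hside h2.1 h3.1).1 h3)

theorem linearAt_strip {m z t : ℝ} (h0 : 0 < t) (h1 : t < s) :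
    LinearAt m (fun u => strip hs0 (1 - s + u) (z + m * u)) t := by
  obtain ⟨h, hy0, hy1⟩ := exists_int_sub_mem_Ioc hs0 (z + m * t)
  refine ⟨(1 - s + t, z + m * t - h), 1, one_pos,
    represents_strip_sub_int hs0 h (by linarith) (by linarith) hy0.le hy1, ?_⟩
  have hc : Continuous fun u => z + m * u - h := by fun_prop
  have hnear : ∀ᶠ u in 𝓝 t, 0 < u ∧ u < s ∧ 0 < z + m * u - h ∧ z + m * u - h < 2 ∧
      (z + m * t - h < 1 → z + m * u - h < 1) := by
    refine (lt_mem_nhds h0).and ((gt_mem_nhds h1).and (((hc.tendsto t).eventually_const_lt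
      hy0).and (((hc.tendsto t).eventually_lt_const (by linarith)).and ?_)))
    by_cases hlt : z + m * t - h < 1
    · exact ((hc.tendsto t).eventually_lt_const hlt).mono fun u hu _ => hu
    · exact Eventually.of_forall fun u hu => absurd hu hlt
  filter_upwards [hnear] with u ⟨hu0, hu1, hu2, hu3, hu4⟩
  have hline : line (1 - s + t, z + m * t - h) 1 m (u - t) = (1 - s + u, z + m * u - h) := by
    simp only [line, Prod.mk.injEq]; constructor <;> ring
  -- Near `t`, heights above 1 occur only if the base point lies on `B`; the chart then continues at
  -- the bottom of the rectangle, one integer higher.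
  rw [hline]
  by_cases hle : z + m * u - h ≤ 1
  · exact .inl (represents_strip_sub_int hs0 h (by linarith) (by linarith) hu2.le hle)
  · right
    refine ⟨.B, ?_, ?_⟩
    · rw [mem_side_iff]
      have : z + m * t - h = 1 := by
        by_contra hne
        exact hle (hu4 (lt_of_le_of_ne hy1 hne)).le
      grind
    · have := represents_strip_sub_int hs0 (x := 1 - s + u) (y := z + m * u) (h + 1) (by linarith)
        (by linarith) (by push_cast; linarith) (by push_cast; linarith)
      have hg : glue s .B (1 - s + u, z + m * u - h) = (1 - s + u, z + m * u - (h + 1 : ℤ)) := by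
        simp only [glue, Prod.mk.injEq]; push_cast; exact ⟨trivial, by ring⟩
      rwa [hg]

theorem isLinearTrajectory_strip {m z : ℝ} :
    IsLinearTrajectory m (Icc 0 s) (fun u => strip hs0 (1 - s + u) (z + m * u)) := by
  refine ⟨ordConnected_Icc, ⟨0, by simp [hs0.le], s, by simp [hs0.le], hs0.ne⟩,
    (continuous_strip hs0 (by fun_prop) (by fun_prop)).continuousOn, fun t ht => ?_, fun t ht => ?_⟩
  · rw [interior_Icc] at ht
    exact strip_notMem_singularSet hs0 hs1 (by linarith [ht.1]) (by linarith [ht.2])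
  · rw [interior_Icc] at ht
    exact linearAt_strip hs0 hs1 ht.1 ht.2

open Classical in
/-- The trajectory through the right rectangle that continues across the edge `A`. -/
theorem isLinearTrajectory_crossing {m z : ℝ} (b : ℤ) (h0 : 0 < z + m * s - b)
    (h1 : z + m * s - b < 1) :
    IsLinearTrajectory m (Icc 0 (s + 1)) ((Iic s).piecewise
      (fun u => strip hs0 (1 - s + u) (z + m * u))
      (fun u => strip hs0 (1 - s + s * (u - s)) (s * (z + m * s - b) + m * (s * (u - s))))) := by
  set f : ℝ → Surface s := fun u => strip hs0 (1 - s + u) (z + m * u) with hf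
  -- Beyond `A` the homothety multiplies the horizontal speed by `s`; the time since the crossing is
  -- `u - s`.
  set g : ℝ → Surface s := fun u => strip hs0 (1 - s + s * (u - s))
    (s * (z + m * s - b) + m * (s * (u - s))) with hg
  have hfg : f s = g s := by
    have := strip_one_eq hs0 hs1 b h0.le h1.le
    simp only [hf, hg]
    simpa using this
  have hcf : Continuous f := continuous_strip hs0 (by fun_prop) (by fun_prop)
  have hcg : Continuous g := continuous_strip hs0 (by fun_prop) (by fun_prop)
  have hleft : ∀ t < s, f =ᶠ[𝓝 t] (Iic s).piecewise f g := fun t ht =>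
    ((piecewise_eqOn (Iic s) f g).symm).eventuallyEq_of_mem (Iic_mem_nhds ht)
  have hright : ∀ t, s < t → g =ᶠ[𝓝 t] (Iic s).piecewise f g := fun t ht => by
    filter_upwards [Ioi_mem_nhds ht] with u hu
    exact (piecewise_eq_of_notMem _ _ _ (by simpa using hu)).symm
  have hval : (Iic s).piecewise f g s = f s := piecewise_eq_of_mem _ _ _ (by simp)
  refine ⟨ordConnected_Icc, ⟨0, by constructor <;> linarith, s, by constructor <;> linarith,
    hs0.ne⟩, Continuous.continuousOn ?_, fun t ht => ?_, fun t ht => ?_⟩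
  · refine hcf.piecewise ?_ hcg
    intro a ha
    rw [frontier_Iic] at ha
    rw [mem_singleton_iff.1 ha, hfg]
  · rw [interior_Icc] at ht
    rcases lt_trichotomy t s with hts | rfl | hts
    · rw [← (hleft t hts).self_of_nhds]
      exact strip_notMem_singularSet hs0 hs1 (by linarith [ht.1]) (by linarith [ht.2])
    · rw [hval, hf]
      simp only [sub_add_cancel]
      exact strip_one_notMem_singularSet hs0 hs1 b h0 h1
    · rw [← (hright t hts).self_of_nhds]
      have h2 : 0 < s * (t - s) := mul_pos hs0 (by linarith)
      have h3 : s * (t - s) < s := by nlinarith [ht.2]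
      exact strip_notMem_singularSet hs0 hs1 (by linarith [ht.1]) (by linarith [ht.2])
  · rw [interior_Icc] at ht
    rcases lt_trichotomy t s with hts | hts | hts
    · exact (linearAt_strip hs0 hs1 ht.1 hts).congr (hleft t hts)
    · subst hts
      have hrep := represents_strip_sub_int hs0 (x := 1) b (by linarith) le_rfl h0.le h1.le
      refine ⟨(1, z + m * t - b), 1, one_pos, ?_, ?_⟩
      · rw [hval, hf]
        simpa using hrep
      have hc1 : Continuous fun u => z + m * u - b := by fun_prop
      have hc2 : Continuous fun u => t * (z + m * u - b) := by fun_prop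
      filter_upwards [lt_mem_nhds hs0, gt_mem_nhds (show t < 2 * t by linarith),
        (hc1.tendsto t).eventually_const_lt h0, (hc1.tendsto t).eventually_lt_const h1,
        gt_mem_nhds (show t < t + 1 by linarith)] with u hu0 hu2 hu3 hu4 hu5
      have hline : line (1, z + m * t - b) 1 m (u - t) = (1 + (u - t), z + m * u - b) := by
        simp only [line, Prod.mk.injEq]; constructor <;> ring
      rw [hline]
      rcases le_or_gt u t with hut | hut
      · left
        rw [piecewise_eq_of_mem _ _ _ (show u ∈ Iic t from hut)]
        have := represents_strip_sub_int hs0 (x := 1 - t + u) (y := z + m * u) b (by linarith)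
          (by linarith) hu3.le hu4.le
        rwa [show 1 + (u - t) = 1 - t + u by ring]
      · right
        refine ⟨.A, by rw [mem_side_iff]; grind, ?_⟩
        rw [piecewise_eq_of_notMem _ _ _ (show u ∉ Iic t by simpa using hut)]
        have hpos : 0 ≤ t * (u - t) := mul_nonneg hs0.le (by linarith)
        have := represents_strip hs0 (x := 1 - t + t * (u - t))
          (y := t * (z + m * u - b)) (by linarith)
          (by nlinarith) (by positivity) (by nlinarith)
        have e1 : glue t .A (1 + (u - t), z + m * u - b) =
            (1 - t + t * (u - t), t * (z + m * u - b)) := by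
          simp [glue]
        have e2 : t * (z + m * t - b) + m * (t * (u - t)) = t * (z + m * u - b) := by ring
        rw [e1, hg]
        simp only [e2]
        exact this
    · have h2 : 0 < s * (t - s) := mul_pos hs0 (by linarith)
      have h3 : s * (t - s) < s := by nlinarith [ht.2]
      have := LinearAt.comp_affine (a := s) (b := -s * s) (t := t) hs0
        (linearAt_strip hs0 hs1 (m := m) (z := s * (z + m * s - b)) (t := s * t + -s * s) (by linarith)
          (by linarith))
      refine this.congr (EventuallyEq.trans (EventuallyEq.of_eq ?_) (hright t hts))
      funext u
      simp only [hg]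
      congr 1 <;> ring

/-! ### Passing through the right rectangle -/

omit hs1 in
/-- Immediately after the time `t` the curve is the line that enters `R_s^+` with horizontal speed
`c` at the height `z` of its left side. -/
def Enters (m : ℝ) (I : Set ℝ) (τ : ℝ → Surface s) (t c z : ℝ) : Prop :=
  ∀ᶠ u in 𝓝[>] t, u ∈ I ∧ τ u = strip hs0 (1 - s + c * (u - t)) (z + m * (c * (u - t)))

/-- Rescaling time by `c` gives the model curve `σ` the germ of `τ` to the right of `t`, and
maximality does the rest. Only this one-sided germ is used, so `t` may be a singular starting time.
-/
theorem Enters.eqOn {m t c z : ℝ} {I : Set ℝ} {τ σ : ℝ → Surface s} {r : ℝ} (hr : 0 < r)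
    (hm : 0 ≤ m) (hc : 0 < c) (hτ : IsMaximalTrajectory m I τ) (h : Enters hs0 m I τ t c z)
    (hσ : IsLinearTrajectory m (Icc 0 r) σ)
    (heq : ∀ u, 0 < u → u < s → u < r → σ u = strip hs0 (1 - s + u) (z + m * u)) :
    Icc t (t + r / c) ⊆ I ∧ ∀ u ∈ Icc t (t + r / c), τ u = σ (c * (u - t)) := by
  have hσ' := hσ.comp_affine (a := c) (b := -c * t) hc
  have hpre : ∀ u, u ∈ Icc t (t + r / c) ↔ c * u + -c * t ∈ Icc 0 r := by
    intro u
    simp only [mem_Icc]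
    rw [← sub_le_iff_le_add', le_div_iff₀ hc]
    constructor
    · rintro ⟨h1, h2⟩
      exact ⟨by nlinarith, by linarith⟩
    · rintro ⟨h1, h2⟩
      refine ⟨?_, by linarith⟩
      by_contra! hlt
      nlinarith
  obtain ⟨b, hb, hsub⟩ := mem_nhdsGT_iff_exists_Ioo_subset.1 h
  have hb' : t < b := hb
  obtain ⟨b', hb'1, hb'2⟩ : ∃ b', t < b' ∧ b' ≤ b ∧ b' ≤ t + r / c ∧ b' ≤ t + s / c :=
    ⟨min b (min (t + r / c) (t + s / c)), by
      have := div_pos hr hc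
      have := div_pos hs0 hc
      simp only [lt_min_iff]
      exact ⟨hb', by linarith, by linarith⟩, by simp⟩
  have hsm : ∀ u ∈ Ioo t b', 0 < c * (u - t) ∧ c * (u - t) < r ∧ c * (u - t) < s := by
    intro u hu
    have h1 : u - t < r / c := by linarith [hu.2, hb'2.2.1]
    have h2 : u - t < s / c := by linarith [hu.2, hb'2.2.2]
    rw [lt_div_iff₀ hc] at h1 h2
    exact ⟨mul_pos hc (by linarith [hu.1]), by linarith, by linarith⟩
  have := hτ.subset hs0 hs1 hm hσ' hb'1 (fun u hu => (hsub ⟨hu.1, hu.2.trans_le hb'2.1⟩).1)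
    (fun u hu => by
      obtain ⟨h1, h2, -⟩ := hsm u hu
      exact ⟨by linarith, by linarith⟩)
    (fun u hu => by
      obtain ⟨h1, h2, h3⟩ := hsm u hu
      rw [(hsub ⟨hu.1, hu.2.trans_le hb'2.1⟩).2]
      have e : c * u + -c * t = c * (u - t) := by ring
      rw [e, heq _ h1 h3 h2])
  refine ⟨fun u hu => this.1 ((hpre u).1 hu), fun u hu => ?_⟩
  rw [this.2 ((hpre u).1 hu), show c * (u - t) = c * u + -c * t by ring]

theorem Enters.eqOn_column {m t c z : ℝ} {I : Set ℝ} {τ : ℝ → Surface s}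
    (hm : 0 ≤ m) (hc : 0 < c) (hτ : IsMaximalTrajectory m I τ) (h : Enters hs0 m I τ t c z) :
    Icc t (t + s / c) ⊆ I ∧ ∀ u ∈ Icc t (t + s / c),
      τ u = strip hs0 (1 - s + c * (u - t)) (z + m * (c * (u - t))) :=
  h.eqOn hs0 hs1 hs0 hm hc hτ (isLinearTrajectory_strip hs0 hs1) fun _ _ _ _ => rfl

/-- One step of the return map. The model curve continues past `A` for one more unit of time, enough
to read off the next germ, whose height and speed are both scaled by `s`. -/
theorem Enters.next {m t c z : ℝ} {I : Set ℝ} {τ : ℝ → Surface s}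
    (hm : 0 ≤ m) (hc : 0 < c) (hτ : IsMaximalTrajectory m I τ) (h : Enters hs0 m I τ t c z)
    (b : ℤ) (h0 : 0 < z + m * s - b) (h1 : z + m * s - b < 1) :
    Enters hs0 m I τ (t + s / c) (c * s) (s * (z + m * s - b)) := by
  classical
  have := h.eqOn hs0 hs1 (r := s + 1) (by linarith) hm hc hτ
    (isLinearTrajectory_crossing hs0 hs1 b h0 h1) (fun u _ hu _ =>
      piecewise_eq_of_mem _ _ _ hu.le)
  have hlt : t + s / c < t + (s + 1) / c := by
    gcongr; linarith
  filter_upwards [Ioo_mem_nhdsGT hlt] with u hu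
  have hu1 : u ∈ Icc t (t + (s + 1) / c) := ⟨by linarith [hu.1, div_pos hs0 hc], hu.2.le⟩
  refine ⟨this.1 hu1, ?_⟩
  rw [this.2 u hu1, piecewise_eq_of_notMem]
  · have e : c * s * (u - (t + s / c)) = s * (c * (u - t) - s) := by field_simp; ring
    rw [e]
  · have : s / c < u - t := by linarith [hu.1]
    rw [div_lt_iff₀ hc] at this
    simp only [mem_Iic, not_le]
    linarith

/-- The column ends at the upper right corner, and a singular time cannot be interior to the domain.
-/
theorem Enters.le_of_singular {m t c z : ℝ} {I : Set ℝ} {τ : ℝ → Surface s}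
    (hm : 0 ≤ m) (hc : 0 < c) (hτ : IsMaximalTrajectory m I τ) (h : Enters hs0 m I τ t c z)
    (b : ℤ) (h1 : z + m * s - b = 1) {u : ℝ} (hu : u ∈ I) : u ≤ t + s / c := by
  obtain ⟨h2, h3⟩ := h.eqOn_column hs0 hs1 hm hc hτ
  have hpos := div_pos hs0 hc
  by_contra! hlt
  have hint := mem_interior_of_lt_of_lt hτ.1.ordConnected (h2 (left_mem_Icc.2 (by linarith))) hu
    (show t < t + s / c by linarith) hlt
  refine hτ.1.regular _ hint ?_
  rw [h3 _ (right_mem_Icc.2 (by linarith))]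
  have e1 : c * (t + s / c - t) = s := by field_simp; ring
  have e2 : z + m * s = ((b + 1 : ℤ) : ℝ) := by push_cast; linarith
  rw [e1, e2, sub_add_cancel]
  exact strip_one_mem_singularSet hs0 hs1 _

end

/-! ### Words composed of blocks `B ⋯ B A` -/

/-- The position of the first letter of the block `j`, if the block `l` has `b l` letters `B`
followed by one letter `A`. -/
def blockStart (b : ℕ → ℕ) (j : ℕ) : ℕ := ∑ l ∈ Finset.range j, (b l + 1)

/-- The block and the place in it of the letter at a given position. -/
def letterIndex (b : ℕ → ℕ) : ℕ → ℕ × ℕ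
  | 0 => (0, 0)
  | k + 1 =>
    if (letterIndex b k).2 < b (letterIndex b k).1 then
      ((letterIndex b k).1, (letterIndex b k).2 + 1)
    else ((letterIndex b k).1 + 1, 0)

/-- The word `B^{b 0} A B^{b 1} A ⋯`. -/
def blockWord (b : ℕ → ℕ) (k : ℕ) : Edge :=
  if (letterIndex b k).2 < b (letterIndex b k).1 then .B else .A

open Classical in
/-- The length of the word that consists of the first `L` blocks. -/
def blockLength (b : ℕ → ℕ) (L : ℕ∞) : ℕ∞ := if L = ⊤ then ⊤ else blockStart b L.toNat

theorem blockStart_succ (b : ℕ → ℕ) (j : ℕ) :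
    blockStart b (j + 1) = blockStart b j + (b j + 1) := Finset.sum_range_succ _ _

theorem blockStart_mono (b : ℕ → ℕ) : Monotone (blockStart b) :=
  monotone_nat_of_le_succ fun j => by rw [blockStart_succ]; omega

theorem letterIndex_spec (b : ℕ → ℕ) (k : ℕ) : (letterIndex b k).2 ≤ b (letterIndex b k).1 ∧
    k = blockStart b (letterIndex b k).1 + (letterIndex b k).2 := by
  induction k with
  | zero => simp [letterIndex, blockStart]
  | succ k ih =>
    rw [letterIndex]
    split_ifs with h
    · exact ⟨h, by dsimp only; omega⟩
    · refine ⟨Nat.zero_le _, ?_⟩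
      dsimp only
      rw [blockStart_succ]
      omega

theorem letterIndex_blockStart_add (b : ℕ → ℕ) {j i : ℕ} (hi : i ≤ b j) :
    letterIndex b (blockStart b j + i) = (j, i) := by
  obtain ⟨h1, h2⟩ := letterIndex_spec b (blockStart b j + i)
  rcases lt_trichotomy j (letterIndex b (blockStart b j + i)).1 with h | h | h
  · have := blockStart_mono b (Nat.succ_le_of_lt h)
    rw [Nat.succ_eq_add_one, blockStart_succ] at this
    omega
  · refine Prod.ext h.symm ?_
    rw [← h] at h2
    dsimp only
    omega
  · have := blockStart_mono b (Nat.succ_le_of_lt h)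
    rw [Nat.succ_eq_add_one, blockStart_succ] at this
    omega

theorem lt_blockLength_iff (b : ℕ → ℕ) (L : ℕ∞) (k : ℕ) :
    (k : ℕ∞) < blockLength b L ↔ ((letterIndex b k).1 : ℕ∞) < L := by
  induction L using ENat.recTopCoe with
  | top => simp [blockLength]
  | coe n =>
    obtain ⟨h1, h2⟩ := letterIndex_spec b k
    simp only [blockLength, ENat.natCast_ne_top, if_false, ENat.toNat_natCast, Nat.cast_lt]
    constructor
    · intro h
      by_contra! h3
      have := blockStart_mono b h3
      omega
    · intro h
      have := blockStart_mono b (Nat.succ_le_of_lt h)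
      rw [Nat.succ_eq_add_one, blockStart_succ] at this
      omega

/-- The double family `T j i` is flattened into one sequence, with `i = b j` standing for the final
`A` of block `j`. Monotonicity then has to be checked only inside blocks and from one block to the
next. -/
theorem isCuttingSequence_of_blocks {R : ℝ → Edge → Prop} {b : ℕ → ℕ} {L : ℕ∞} {T : ℕ → ℕ → ℝ}
    (h1 : ∀ j i : ℕ, (j : ℕ∞) < L → i < b j → T j i < T j (i + 1))
    (h2 : ∀ j : ℕ, ((j + 1 : ℕ) : ℕ∞) < L → T j (b j) < T (j + 1) 0)
    (hB : ∀ j i : ℕ, (j : ℕ∞) < L → i < b j → R (T j i) .B)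
    (hA : ∀ j : ℕ, (j : ℕ∞) < L → R (T j (b j)) .A)
    (hR : ∀ u e, R u e → ∃ j i : ℕ, (j : ℕ∞) < L ∧ i ≤ b j ∧ T j i = u) :
    IsCuttingSequence R (blockLength b L) (blockWord b) := by
  refine ⟨fun k => T (letterIndex b k).1 (letterIndex b k).2, ?_, ?_, ?_⟩
  · have hstep : ∀ k : ℕ, ((k + 1 : ℕ) : ℕ∞) < blockLength b L →
        T (letterIndex b k).1 (letterIndex b k).2 <
          T (letterIndex b (k + 1)).1 (letterIndex b (k + 1)).2 := by
      intro k hk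
      have hk' : (k : ℕ∞) < blockLength b L := lt_trans (by exact_mod_cast k.lt_succ_self) hk
      rw [lt_blockLength_iff] at hk hk'
      have hspec := (letterIndex_spec b k).1
      rw [letterIndex] at hk ⊢
      split_ifs at hk ⊢ with h
      · exact h1 _ _ hk' h
      · have : (letterIndex b k).2 = b (letterIndex b k).1 := by omega
        rw [this]
        exact h2 _ hk
    intro i j hij
    induction j, hij using Nat.le_induction with
    | base => exact hstep i
    | succ j hij ih =>
      intro hj
      exact (ih (lt_trans (by exact_mod_cast j.lt_succ_self) hj)).trans (hstep j hj)
  · intro k hk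
    rw [lt_blockLength_iff] at hk
    have hspec := (letterIndex_spec b k).1
    unfold blockWord
    split_ifs with h
    · exact hB _ _ hk h
    · have : (letterIndex b k).2 = b (letterIndex b k).1 := by omega
      dsimp only
      rw [this]
      exact hA _ hk
  · intro u e hu
    obtain ⟨j, i, hj, hi, rfl⟩ := hR u e hu
    refine ⟨blockStart b j + i, ?_, ?_⟩
    · rw [lt_blockLength_iff, letterIndex_blockStart_add b hi]; exact hj
    · dsimp only
      rw [letterIndex_blockStart_add b hi]

/-! ### Trajectories on the torus -/

theorem coe_unitAddCircle_eq_zero_iff {u : ℝ} : (u : UnitAddCircle) = 0 ↔ ∃ n : ℤ, u = n := by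
  rw [AddCircle.coe_eq_zero_iff]
  simp [eq_comm]

theorem torusTrajectory_eq (ξ θ u : ℝ) :
    torusTrajectory ξ (0, (θ : UnitAddCircle)) u =
      ((u : UnitAddCircle), ((θ + ξ * u : ℝ) : UnitAddCircle)) := by
  simp [torusTrajectory]

theorem torusTrajectory_eq_zero_iff {ξ θ u : ℝ} :
    torusTrajectory ξ (0, (θ : UnitAddCircle)) u = 0 ↔
      (∃ n : ℤ, u = n) ∧ ∃ h : ℤ, θ + ξ * u = h := by
  rw [torusTrajectory_eq, Prod.mk_eq_zero, coe_unitAddCircle_eq_zero_iff,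
    coe_unitAddCircle_eq_zero_iff]

theorem coe_lt_of_forall_eq {j : ℕ} {L : ℕ∞} (h : ∀ n : ℕ, (n : ℕ∞) = L → j < n) :
    (j : ℕ∞) < L := by
  induction L using ENat.recTopCoe with
  | top => exact ENat.natCast_lt_top j
  | coe n => exact_mod_cast h n rfl

/-- The cutting sequence of a trajectory of slope `ξ` on the torus that starts at the corner or
slightly below it on the vertical edge, if it meets the corner after crossing `L` vertical edges. -/
theorem isCuttingSequence_torusRecord {ξ θ : ℝ} (hξ : 0 ≤ ξ) (hθ0 : θ ≤ 0) (hθ1 : -1 < θ)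
    {b : ℕ → ℕ} (hb : ∀ j : ℕ, (b j : ℤ) = ⌈((j + 1 : ℕ) : ℝ) * ξ⌉ - ⌈(j : ℝ) * ξ⌉)
    (hθ : ∀ j : ℕ, ⌈(j : ℝ) * ξ + θ⌉ = ⌈(j : ℝ) * ξ⌉) {L : ℕ∞} (hL : 0 < L)
    (hreg : ∀ j : ℕ, 0 < j → (j : ℕ∞) < L → ∀ h : ℤ, (j : ℝ) * ξ + θ ≠ h)
    (hend : ∀ n : ℕ, (n : ℕ∞) = L → ∃ h : ℤ, (n : ℝ) * ξ + θ = h) :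
    IsCuttingSequence (torusRecord ξ (0, (θ : UnitAddCircle))) (blockLength b L)
      (blockWord b) := by
  have hξ0 : ∀ {j i : ℕ}, i < b j → 0 < ξ := by
    intro j i hi
    refine hξ.lt_of_ne fun h => ?_
    have := hb j
    simp only [← h, mul_zero, Int.ceil_zero, sub_zero] at this
    omega
  have hrange : ∀ {j i : ℕ}, i < b j → (j : ℝ) ≤ (⌈(j : ℝ) * ξ⌉ + i - θ) / ξ ∧
      (⌈(j : ℝ) * ξ⌉ + i - θ) / ξ < j + 1 := by
    intro j i hi
    have hpos := hξ0 hi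
    rw [le_div_iff₀ hpos, div_lt_iff₀ hpos]
    constructor
    · have := Int.le_ceil ((j : ℝ) * ξ)
      have : (0 : ℝ) ≤ i := Nat.cast_nonneg i
      linarith
    · have h1 : ⌈(j : ℝ) * ξ⌉ + i < ⌈((j + 1 : ℕ) : ℝ) * ξ + θ⌉ := by
        rw [hθ]
        have := hb j
        omega
      have := Int.lt_ceil.1 h1
      push_cast at this
      linarith
  have hfirst : ∀ {j : ℕ} {u : ℝ}, (j : ℕ∞) < L → u ≤ j + 1 → ∀ v, 0 < v → v < u →
      torusTrajectory ξ (0, (θ : UnitAddCircle)) v ≠ 0 := by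
    intro j u hj hu v hv0 hvu hv
    rw [torusTrajectory_eq_zero_iff] at hv
    obtain ⟨⟨n, rfl⟩, h, hh⟩ := hv
    lift n to ℕ using (by exact_mod_cast hv0.le)
    have hn0 : 0 < n := by exact_mod_cast hv0
    have hnj : n < j + 1 := by exact_mod_cast hvu.trans_le hu
    refine hreg n hn0 (lt_of_le_of_lt (by exact_mod_cast Nat.lt_succ_iff.1 hnj) hj) h ?_
    push_cast at hh
    linarith
  have hq : (0, (θ : UnitAddCircle)) = (0 : UnitAddCircle × UnitAddCircle) ↔ θ = 0 := by
    rw [Prod.mk_eq_zero, coe_unitAddCircle_eq_zero_iff]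
    constructor
    · rintro ⟨-, n, rfl⟩
      have h1 : n ≤ 0 := by exact_mod_cast hθ0
      have h2 : -1 < n := by exact_mod_cast hθ1
      have : n = 0 := by omega
      simp [this]
    · rintro rfl
      exact ⟨rfl, 0, by simp⟩
  -- For `j ≤ u < j + 1` the integers met by the height `θ + ξ * u` are `⌈jξ⌉ + i` with `i < b j`;
  -- solving for `u` gives the times of the letters `B`. The letter `A` follows at `u = j + 1`.
  refine isCuttingSequence_of_blocks
    (T := fun j i => if i < b j then (⌈(j : ℝ) * ξ⌉ + i - θ) / ξ else j + 1) ?_ ?_ ?_ ?_ ?_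
  · intro j i hj hi
    have hpos := hξ0 hi
    rw [if_pos hi]
    split_ifs
    · gcongr
      exact i.lt_succ_self
    · exact (hrange hi).2
  · intro j hj
    simp only [lt_irrefl, if_false]
    split_ifs with h
    · have hpos := hξ0 h
      have h1 := (hrange h).1
      push_cast at h1 ⊢
      refine lt_of_le_of_ne h1 fun heq => ?_
      rw [eq_div_iff hpos.ne'] at heq
      refine hreg (j + 1) (Nat.succ_pos j) hj ⌈((j + 1 : ℕ) : ℝ) * ξ⌉ ?_
      push_cast
      linarith
    · push_cast; linarith
  · intro j i hj hi
    have hpos := hξ0 hi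
    obtain ⟨h1, h2⟩ := hrange hi
    rw [if_pos hi]
    refine ⟨hfirst hj h2.le, ?_⟩
    have hval : θ + ξ * ((⌈(j : ℝ) * ξ⌉ + i - θ) / ξ) = (⌈(j : ℝ) * ξ⌉ + i : ℤ) := by
      field_simp
      push_cast
      ring
    generalize hu : (⌈(j : ℝ) * ξ⌉ + i - θ) / ξ = u at *
    have hu0 : 0 ≤ u := le_trans (Nat.cast_nonneg j) h1
    -- Time 0 occurs only for a start at the corner: the integral height there equals `θ`, which
    -- lies in `(-1, 0]`, so it is 0.
    rcases hu0.eq_or_lt with rfl | hu0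
    · refine .inl ⟨rfl, ?_, hpos.ne', rfl⟩
      rw [hq]
      have h3 : (-1 : ℤ) < ⌈(j : ℝ) * ξ⌉ + i := by
        have : ((-1 : ℤ) : ℝ) < (⌈(j : ℝ) * ξ⌉ + i : ℤ) := by rw [← hval]; push_cast; linarith
        exact_mod_cast this
      have h4 : ⌈(j : ℝ) * ξ⌉ + i ≤ (0 : ℤ) := by
        have : ((⌈(j : ℝ) * ξ⌉ + i : ℤ) : ℝ) ≤ (0 : ℤ) := by rw [← hval]; push_cast; linarith
        exact_mod_cast this
      rw [show ⌈(j : ℝ) * ξ⌉ + (i : ℤ) = 0 by omega] at hval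
      simpa using hval
    · refine .inr (.inr ⟨hu0, ?_, .inr ⟨?_, hpos.ne', rfl⟩⟩)
      · rw [Ne, torusTrajectory_eq_zero_iff]
        rintro ⟨⟨n, rfl⟩, -⟩
        have h3 : (j : ℤ) ≤ n := by exact_mod_cast h1
        have h4 : n < (j : ℤ) + 1 := by exact_mod_cast h2
        obtain rfl : n = j := by omega
        refine hreg j (by exact_mod_cast hu0) hj _ (Eq.trans ?_ hval)
        push_cast; ring
      · rw [torusTrajectory_eq]
        exact coe_unitAddCircle_eq_zero_iff.2 ⟨_, hval⟩
  · intro j hj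
    simp only [lt_irrefl, if_false]
    refine ⟨hfirst hj le_rfl, .inr ?_⟩
    have hpos : (0 : ℝ) < j + 1 := by positivity
    by_cases h : torusTrajectory ξ (0, (θ : UnitAddCircle)) (j + 1) = 0
    · exact .inl ⟨hpos, h, rfl⟩
    · refine .inr ⟨hpos, h, .inl ⟨?_, rfl⟩⟩
      rw [torusTrajectory_eq]
      exact coe_unitAddCircle_eq_zero_iff.2 ⟨j + 1, by push_cast; rfl⟩
  · rintro u e ⟨hfst, h⟩
    rcases h with ⟨rfl, h0, hne, -⟩ | h
    · rw [hq] at h0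
      subst h0
      have hpos : 0 < ξ := hξ.lt_of_ne' hne
      have : 0 < b 0 := by
        have h1 := hb 0
        have : 0 < ⌈ξ⌉ := Int.ceil_pos.2 hpos
        simp at h1
        omega
      exact ⟨0, 0, hL, Nat.zero_le _, by simp [this]⟩
    · have hu0 : 0 < u := by rcases h with h | h <;> exact h.1
      have huL : ∀ n : ℕ, (n : ℕ∞) = L → u ≤ n := by
        intro n hn
        by_contra! hlt
        have hn0 : 0 < n := by rw [← hn] at hL; exact_mod_cast hL
        obtain ⟨k, hk⟩ := hend n hn
        exact hfst n (by exact_mod_cast hn0) hlt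
          (torusTrajectory_eq_zero_iff.2 ⟨⟨n, by simp⟩, k, by linarith⟩)
      have h' : (∃ n : ℤ, u = n) ∨ ξ ≠ 0 ∧ ∃ k : ℤ, θ + ξ * u = k := by
        rcases h with ⟨-, h, -⟩ | ⟨-, -, ⟨h, -⟩ | ⟨h, hne, -⟩⟩
        · exact .inl (torusTrajectory_eq_zero_iff.1 h).1
        · rw [torusTrajectory_eq] at h
          exact .inl (coe_unitAddCircle_eq_zero_iff.1 h)
        · rw [torusTrajectory_eq] at h
          exact .inr ⟨hne, coe_unitAddCircle_eq_zero_iff.1 h⟩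
      by_cases hint : ∃ n : ℤ, u = n
      · obtain ⟨n, rfl⟩ := hint
        lift n to ℕ using (by exact_mod_cast hu0.le)
        obtain ⟨j, rfl⟩ : ∃ j, n = j + 1 := Nat.exists_eq_succ_of_ne_zero (by
          have : 0 < n := by exact_mod_cast hu0
          omega)
        refine ⟨j, b j, coe_lt_of_forall_eq fun n hn => ?_, le_rfl, by simp⟩
        have := huL n hn
        have : j + 1 ≤ n := by exact_mod_cast this
        omega
      · obtain ⟨hne, k, hk⟩ := h'.resolve_left hint
        have hpos : 0 < ξ := hξ.lt_of_ne' hne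
        have h1 : ((⌊u⌋₊ : ℕ) : ℝ) < u := lt_of_le_of_ne (Nat.floor_le hu0.le) fun h =>
          hint ⟨⌊u⌋₊, by push_cast; exact h.symm⟩
        have h2 : u < (⌊u⌋₊ : ℝ) + 1 := Nat.lt_floor_add_one u
        generalize ⌊u⌋₊ = j at h1 h2
        have h3 : ⌈(j : ℝ) * ξ⌉ ≤ k := by
          rw [← hθ, Int.ceil_le, ← hk]
          nlinarith
        have h4 : k < ⌈((j + 1 : ℕ) : ℝ) * ξ⌉ := by
          rw [← hθ, Int.lt_ceil, ← hk]
          push_cast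
          nlinarith
        have h5 := hb j
        obtain ⟨i, hi⟩ := Int.eq_ofNat_of_zero_le (sub_nonneg.2 h3)
        have hib : i < b j := by omega
        refine ⟨j, i, coe_lt_of_forall_eq fun n hn => ?_, hib.le, ?_⟩
        · have := h1.trans_le (huL n hn)
          exact_mod_cast this
        · rw [if_pos hib, div_eq_iff hpos.ne']
          have : (k : ℝ) - ⌈(j : ℝ) * ξ⌉ = i := by exact_mod_cast hi
          linarith

/-! ### Itineraries through the right rectangle -/

/-- A trajectory of slope `m` passes `L` times through `R_s^+`: the `j`-th time it enters at the
height `z j` (with `1` in place of `0` at the start), crosses the edge `B` `b j` times, and leaves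
at the height `z j + m * s - b j`; if `L` is finite it finally arrives at the upper corner. -/
structure IsItinerary (s m : ℝ) (z : ℕ → ℝ) (b : ℕ → ℕ) (L : ℕ∞) : Prop where
  pos : 0 < L
  zero_pos : 0 < z 0
  zero_le : z 0 ≤ 1
  out_pos : ∀ j : ℕ, ((j + 1 : ℕ) : ℕ∞) < L → 0 < z j + m * s - b j
  out_lt : ∀ j : ℕ, ((j + 1 : ℕ) : ℕ∞) < L → z j + m * s - b j < 1
  succ : ∀ j : ℕ, ((j + 1 : ℕ) : ℕ∞) < L → z (j + 1) = s * (z j + m * s - b j)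
  last : ∀ j : ℕ, ((j + 1 : ℕ) : ℕ∞) = L → z j + m * s - b j = 1

/-- The time at which a trajectory of initial horizontal speed `c` enters `R_s^+` for the `j`-th
time. -/
def columnTime (s c : ℝ) (j : ℕ) : ℝ := ∑ l ∈ Finset.range j, s / (c * s ^ l)

theorem columnTime_succ (s c : ℝ) (j : ℕ) :
    columnTime s c (j + 1) = columnTime s c j + s / (c * s ^ j) := Finset.sum_range_succ _ _

@[simp]
theorem columnTime_zero (s c : ℝ) : columnTime s c 0 = 0 := rfl

theorem coe_add_one_lt_or_eq {j : ℕ} {L : ℕ∞} (h : (j : ℕ∞) < L) :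
    ((j + 1 : ℕ) : ℕ∞) < L ∨ ((j + 1 : ℕ) : ℕ∞) = L := by
  rw [← le_iff_lt_or_eq]
  exact Order.add_one_le_of_lt h

theorem coe_lt_of_coe_add_one_lt {j : ℕ} {L : ℕ∞} (h : ((j + 1 : ℕ) : ℕ∞) < L) : (j : ℕ∞) < L :=
  lt_trans (by exact_mod_cast j.lt_succ_self) h

section

variable {s : ℝ} (hs0 : 0 < s)
include hs0

theorem columnTime_lt_succ {c : ℝ} (hc : 0 < c) (j : ℕ) :
    columnTime s c j < columnTime s c (j + 1) := by
  rw [columnTime_succ]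
  have : 0 < s / (c * s ^ j) := by positivity
  linarith

theorem columnTime_strictMono {c : ℝ} (hc : 0 < c) : StrictMono (columnTime s c) :=
  strictMono_nat_of_lt_succ (columnTime_lt_succ hs0 hc)

theorem columnTime_nonneg {c : ℝ} (hc : 0 < c) (j : ℕ) : 0 ≤ columnTime s c j := by
  rw [← columnTime_zero s c]
  exact (columnTime_strictMono hs0 hc).monotone j.zero_le

theorem le_columnTime (hs1 : s < 1) {c : ℝ} (hc : 0 < c) (j : ℕ) :
    j * (s / c) ≤ columnTime s c j := by
  have := Finset.card_nsmul_le_sum (Finset.range j) (fun l => s / (c * s ^ l)) (s / c) fun l _ => by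
    gcongr
    exact mul_le_of_le_one_right hc.le (pow_le_one₀ hs0.le hs1.le)
  rwa [Finset.card_range, nsmul_eq_mul] at this

variable {m : ℝ} {z : ℕ → ℝ} {b : ℕ → ℕ} {L : ℕ∞}

theorem IsItinerary.exit_pos (h : IsItinerary s m z b L) {j : ℕ} (hj : (j : ℕ∞) < L) :
    0 < z j + m * s - b j := by
  rcases coe_add_one_lt_or_eq hj with h1 | h1
  · exact h.out_pos j h1
  · rw [h.last j h1]; exact one_pos

theorem IsItinerary.exit_le (h : IsItinerary s m z b L) {j : ℕ} (hj : (j : ℕ∞) < L) :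
    z j + m * s - b j ≤ 1 := by
  rcases coe_add_one_lt_or_eq hj with h1 | h1
  · exact (h.out_lt j h1).le
  · exact (h.last j h1).le

theorem IsItinerary.enter_pos (h : IsItinerary s m z b L) {j : ℕ} (hj : (j : ℕ∞) < L) :
    0 < z j := by
  cases j with
  | zero => exact h.zero_pos
  | succ j => rw [h.succ j hj]; exact mul_pos hs0 (h.out_pos j hj)

variable (hs1 : s < 1)
include hs1

theorem IsItinerary.enter_lt (h : IsItinerary s m z b L) {j : ℕ}
    (hj : ((j + 1 : ℕ) : ℕ∞) < L) : z (j + 1) < s := by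
  rw [h.succ j hj]
  have := h.out_pos j hj
  have := h.out_lt j hj
  nlinarith

theorem IsItinerary.enter_le (h : IsItinerary s m z b L) {j : ℕ} (hj : (j : ℕ∞) < L) :
    z j ≤ 1 := by
  cases j with
  | zero => exact h.zero_le
  | succ j => exact ((h.enter_lt hs0 hs1 hj).trans hs1).le

theorem IsTrajectoryFrom.exists_enters {I : Set ℝ} {τ : ℝ → Surface s} {y : ℝ}
    (h : IsTrajectoryFrom m (1 - s, y) I τ) (hy0 : 0 ≤ y) (hy1 : y < 1) (hm : 0 ≤ m) :
    0 ∈ I ∧ Represents s (1 - s, y) (τ 0) ∧ ∃ c, 0 < c ∧ Enters hs0 m I τ 0 c y := by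
  obtain ⟨hmax, c, hc, h⟩ := h
  have h0 := h.self_of_nhdsWithin (by simp)
  refine ⟨h0.1, by simpa [line] using h0.2, c, hc, ?_⟩
  have hc1 : Continuous fun u => 1 - s + c * u := by fun_prop
  have hc2 : Continuous fun u => y + c * u * m := by fun_prop
  filter_upwards [h.filter_mono (nhdsWithin_mono _ Ioi_subset_Ici_self), self_mem_nhdsWithin,
    nhdsWithin_le_nhds ((hc1.tendsto 0).eventually_lt_const (u := 1) (by simpa using hs0)),
    nhdsWithin_le_nhds ((hc2.tendsto 0).eventually_lt_const (u := 1) (by simpa using hy1))]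
    with u hu hu0 hu1 hu2
  refine ⟨hu.1, ?_⟩
  have hcu : 0 < c * u := mul_pos hc hu0
  have hrep := represents_strip hs0 (x := 1 - s + c * u) (y := y + c * u * m) (by linarith) hu1.le
    (by positivity) hu2.le
  rw [sub_zero, mul_comm m]
  exact hu.2.unique hrep

theorem exists_isTrajectoryFrom {y : ℝ} (hy0 : 0 ≤ y) (hy1 : y < 1) (hm : 0 ≤ m) :
    ∃ (I : Set ℝ) (τ : ℝ → Surface s), IsTrajectoryFrom m (1 - s, y) I τ := by
  obtain ⟨I, τ, hmax, hI, hτ⟩ := (isLinearTrajectory_strip hs0 hs1 (m := m) (z := y)).exists_maximal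
  refine ⟨I, τ, hmax, 1, one_pos, ?_⟩
  have hc2 : Continuous fun u => y + m * u := by fun_prop
  filter_upwards [self_mem_nhdsWithin, nhdsWithin_le_nhds (gt_mem_nhds hs0),
    nhdsWithin_le_nhds ((hc2.tendsto 0).eventually_lt_const (u := 1) (by simpa using hy1))]
    with u hu0 hu1 hu2
  have hu0' : 0 ≤ u := hu0
  have hu : u ∈ Icc 0 s := ⟨hu0, hu1.le⟩
  refine ⟨hI hu, ?_⟩
  rw [hτ hu]
  have := represents_strip hs0 (x := 1 - s + u) (y := y + m * u) (by linarith) (by linarith)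
    (by positivity) hu2.le
  simpa [line, mul_comm] using this

/-- Heights matter only modulo 1. A start at the lower left corner can therefore be counted as
height 1, and then its conventional initial `B` is the ordinary crossing at time 0. -/
theorem Enters.add_int {I : Set ℝ} {τ : ℝ → Surface s} {t c y : ℝ} (h : Enters hs0 m I τ t c y)
    (k : ℤ) : Enters hs0 m I τ t c (y + k) := by
  filter_upwards [h] with u hu
  rw [add_right_comm, strip_add_int]
  exact hu

theorem IsItinerary.enters (h : IsItinerary s m z b L) (hm : 0 ≤ m) {I : Set ℝ}
    {τ : ℝ → Surface s} (hτ : IsMaximalTrajectory m I τ) {c : ℝ} (hc : 0 < c)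
    (h0 : Enters hs0 m I τ 0 c (z 0)) {j : ℕ} (hj : (j : ℕ∞) < L) :
    Enters hs0 m I τ (columnTime s c j) (c * s ^ j) (z j) := by
  induction j with
  | zero => simpa using h0
  | succ j ih =>
    have := (ih (coe_lt_of_coe_add_one_lt hj)).next hs0 hs1 hm (by positivity) hτ (b j)
      (by exact_mod_cast h.out_pos j hj) (by exact_mod_cast h.out_lt j hj)
    rw [columnTime_succ, h.succ j hj, pow_succ, ← mul_assoc]
    exact_mod_cast this

theorem IsItinerary.eqOn_column (h : IsItinerary s m z b L) (hm : 0 ≤ m) {I : Set ℝ}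
    {τ : ℝ → Surface s} (hτ : IsMaximalTrajectory m I τ) {c : ℝ} (hc : 0 < c)
    (h0 : Enters hs0 m I τ 0 c (z 0)) {j : ℕ} (hj : (j : ℕ∞) < L) {u : ℝ}
    (hu0 : columnTime s c j ≤ u) (hu1 : u ≤ columnTime s c (j + 1)) :
    u ∈ I ∧ τ u = strip hs0 (1 - s + c * s ^ j * (u - columnTime s c j))
      (z j + m * (c * s ^ j * (u - columnTime s c j))) := by
  have := (h.enters hs0 hs1 hm hτ hc h0 hj).eqOn_column hs0 hs1 hm (by positivity) hτ
  rw [← columnTime_succ] at this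
  exact ⟨this.1 ⟨hu0, hu1⟩, this.2 u ⟨hu0, hu1⟩⟩

theorem IsItinerary.apply_columnTime_succ (h : IsItinerary s m z b L) (hm : 0 ≤ m) {I : Set ℝ}
    {τ : ℝ → Surface s} (hτ : IsMaximalTrajectory m I τ) {c : ℝ} (hc : 0 < c)
    (h0 : Enters hs0 m I τ 0 c (z 0)) {j : ℕ} (hj : (j : ℕ∞) < L) :
    columnTime s c (j + 1) ∈ I ∧ τ (columnTime s c (j + 1)) = strip hs0 1 (z j + m * s) := by
  have := h.eqOn_column hs0 hs1 hm hτ hc h0 hj (columnTime_lt_succ hs0 hc j).le le_rfl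
  have e : c * s ^ j * (columnTime s c (j + 1) - columnTime s c j) = s := by
    rw [columnTime_succ, add_sub_cancel_left]
    field_simp
  rwa [e, sub_add_cancel] at this

/-- Each column lasts at least `s / c`, so the column times are unbounded; for finite `L` the
trajectory stops at the end of the last column. -/
theorem IsItinerary.exists_column (h : IsItinerary s m z b L) (hm : 0 ≤ m) {I : Set ℝ}
    {τ : ℝ → Surface s} (hτ : IsMaximalTrajectory m I τ) {c : ℝ} (hc : 0 < c)
    (h0 : Enters hs0 m I τ 0 c (z 0)) {u : ℝ} (hu : u ∈ I) (hu0 : 0 < u) :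
    ∃ j : ℕ, (j : ℕ∞) < L ∧ columnTime s c j < u ∧ u ≤ columnTime s c (j + 1) := by
  classical
  have hex : ∃ j, u ≤ columnTime s c (j + 1) := by
    obtain ⟨n, hn⟩ := exists_nat_ge (u / (s / c))
    rw [div_le_iff₀ (by positivity)] at hn
    exact ⟨n, hn.trans ((le_columnTime hs0 hs1 hc n).trans (columnTime_lt_succ hs0 hc n).le)⟩
  refine ⟨Nat.find hex, coe_lt_of_forall_eq fun n hn => ?_, ?_, Nat.find_spec hex⟩
  · obtain ⟨k, rfl⟩ : ∃ k, n = k + 1 := Nat.exists_eq_succ_of_ne_zero (by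
      rintro rfl
      exact h.pos.ne hn)
    have hk : (k : ℕ∞) < L := by rw [← hn]; exact_mod_cast k.lt_succ_self
    refine Nat.lt_succ_of_le (Nat.find_min' hex ?_)
    rw [columnTime_succ]
    exact (h.enters hs0 hs1 hm hτ hc h0 hk).le_of_singular hs0 hs1 hm (by positivity) hτ (b k)
      (by exact_mod_cast h.last k hn) hu
  · rcases hj : Nat.find hex with _ | k
    · simpa using hu0
    · have := Nat.find_min hex (m := k) (by omega)
      simpa using this

/-- Inside column `j` the edge `B` is met when the unwrapped height equals `i + 1` with `i < b j`,
and the column ends on `A` or at the corner. With the convention `z 0 = 1` for a corner start, `i =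
0` gives time 0. -/
theorem IsItinerary.isCuttingSequence (h : IsItinerary s m z b L) (hm : 0 ≤ m) {I : Set ℝ}
    {τ : ℝ → Surface s} {p : ℝ × ℝ} (hτ : IsMaximalTrajectory m I τ) {c : ℝ} (hc : 0 < c)
    (h0I : 0 ∈ I) (h0 : Enters hs0 m I τ 0 c (z 0))
    (hp : (p = (1 - s, z 0) ∧ z 0 < 1) ∨ (p = (1 - s, 0) ∧ z 0 = 1 ∧ (m ≠ 0 → 0 < b 0))) :
    IsCuttingSequence (surfaceRecord m p I τ) (blockLength b L) (blockWord b) := by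
  have hspeed : ∀ j : ℕ, 0 < c * s ^ j := fun j => by positivity
  have hmpos : ∀ {j i : ℕ}, (j : ℕ∞) < L → i < b j → 0 < m := by
    intro j i hj hi
    refine hm.lt_of_ne fun h0 => ?_
    have h1 := h.exit_pos hs0 hj
    have h2 := h.enter_le hs0 hs1 hj
    have h3 : (1 : ℝ) ≤ b j := by exact_mod_cast (by omega : 1 ≤ b j)
    rw [← h0] at h1
    linarith
  have hrange : ∀ {j i : ℕ}, (j : ℕ∞) < L → i < b j → 0 ≤ (i + 1 - z j) / (m * (c * s ^ j)) ∧
      (i + 1 - z j) / (m * (c * s ^ j)) < s / (c * s ^ j) := by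
    intro j i hj hi
    have hpos := hmpos hj hi
    have hsp := hspeed j
    have h1 := h.exit_pos hs0 hj
    have h2 := h.enter_le hs0 hs1 hj
    have h3 : (i : ℝ) + 1 ≤ b j := by exact_mod_cast hi
    have h4 : (0 : ℝ) ≤ i := Nat.cast_nonneg i
    constructor
    · apply div_nonneg <;> [linarith; positivity]
    · rw [← div_div]
      gcongr
      rw [div_lt_iff₀ hpos]
      linarith
  have hinner : ∀ {j : ℕ} {u : ℝ}, columnTime s c j < u → u < columnTime s c (j + 1) →
      1 - s < 1 - s + c * s ^ j * (u - columnTime s c j) ∧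
        1 - s + c * s ^ j * (u - columnTime s c j) < 1 := by
    intro j u h1 h2
    rw [columnTime_succ] at h2
    have h3 : u - columnTime s c j < s / (c * s ^ j) := by linarith
    rw [lt_div_iff₀ (hspeed j)] at h3
    have := mul_pos (hspeed j) (sub_pos.2 h1)
    constructor <;> linarith
  refine isCuttingSequence_of_blocks (T := fun j i => if i < b j then
    columnTime s c j + (i + 1 - z j) / (m * (c * s ^ j)) else columnTime s c (j + 1)) ?_ ?_ ?_ ?_ ?_
  · intro j i hj hi
    have hpos := hmpos hj hi
    have hsp := hspeed j
    rw [if_pos hi]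
    split_ifs
    · gcongr
      exact i.lt_succ_self
    · rw [columnTime_succ]
      linarith [(hrange hj hi).2]
  · intro j hj
    simp only [lt_irrefl, if_false]
    split_ifs with hb
    · have hpos := hmpos hj hb
      have hsp := hspeed (j + 1)
      have := h.enter_lt hs0 hs1 hj
      have : 0 < (((0 : ℕ) : ℝ) + 1 - z (j + 1)) / (m * (c * s ^ (j + 1))) := by
        apply div_pos
        · push_cast; linarith
        · positivity
      linarith
    · exact columnTime_lt_succ hs0 hc _
  · intro j i hj hi
    have hpos := hmpos hj hi
    have hsp := hspeed j
    obtain ⟨h1, h2⟩ := hrange hj hi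
    rw [if_pos hi]
    rcases h1.eq_or_lt with h3 | h3
    · rw [← h3, add_zero]
      have h4 : (i : ℝ) + 1 - z j = 0 := by
        rcases div_eq_zero_iff.1 h3.symm with h | h
        · exact h
        · exact absurd h (by positivity)
      cases j with
      | succ j =>
        have := h.enter_lt hs0 hs1 hj
        have : (0 : ℝ) ≤ i := Nat.cast_nonneg i
        linarith
      | zero =>
        rw [columnTime_zero]
        refine ⟨h0I, .inl ⟨rfl, ?_, hpos.ne', rfl⟩⟩
        rcases hp with ⟨-, hz⟩ | ⟨hp, -⟩
        · have : (0 : ℝ) ≤ i := Nat.cast_nonneg i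
          linarith
        · exact hp
    · have hu1 : columnTime s c j < columnTime s c j + (i + 1 - z j) / (m * (c * s ^ j)) := by
        linarith
      have hu2 : columnTime s c j + (i + 1 - z j) / (m * (c * s ^ j)) <
          columnTime s c (j + 1) := by
        rw [columnTime_succ]; linarith
      have e : z j + m * (c * s ^ j * (columnTime s c j + (i + 1 - z j) / (m * (c * s ^ j)) -
          columnTime s c j)) = ((i + 1 : ℕ) : ℤ) := by
        push_cast; field_simp; ring
      obtain ⟨hx0, hx1⟩ := hinner hu1 hu2
      obtain ⟨hI, hval⟩ := h.eqOn_column hs0 hs1 hm hτ hc h0 hj hu1.le hu2.le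
      refine ⟨hI, .inr (.inr ⟨(columnTime_nonneg hs0 hc j).trans_lt hu1, ?_, ?_, fun _ =>
        hpos.ne'⟩)⟩
      · rw [hval]
        exact strip_notMem_singularSet hs0 hs1 hx0 hx1
      · rw [hval, strip_mem_edge_iff hs0 hs1 hx0 hx1]
        exact ⟨rfl, _, e⟩
  · intro j hj
    simp only [lt_irrefl, if_false]
    obtain ⟨hI, hval⟩ := h.apply_columnTime_succ hs0 hs1 hm hτ hc h0 hj
    have hpos := (columnTime_nonneg hs0 hc j).trans_lt (columnTime_lt_succ hs0 hc j)
    refine ⟨hI, .inr ?_⟩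
    rw [hval]
    rcases coe_add_one_lt_or_eq hj with h1 | h1
    · have h2 : 0 < z j + m * s - (b j : ℤ) := by exact_mod_cast h.out_pos j h1
      have h3 : z j + m * s - (b j : ℤ) < 1 := by exact_mod_cast h.out_lt j h1
      exact .inr ⟨hpos, strip_one_notMem_singularSet hs0 hs1 _ h2 h3,
        (strip_one_mem_edge_iff hs0 hs1 _ h2 h3).2 rfl, by simp⟩
    · have e : z j + m * s = ((b j + 1 : ℕ) : ℤ) := by
        have := h.last j h1
        push_cast; linarith
      rw [e]
      exact .inl ⟨hpos, strip_one_mem_singularSet hs0 hs1 _, rfl⟩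
  · rintro u e ⟨huI, hu⟩
    rcases hu with ⟨rfl, hp0, hm0, -⟩ | hu
    · rcases hp with ⟨hp, -⟩ | ⟨-, hz, hb⟩
      · rw [hp] at hp0
        exact absurd (Prod.ext_iff.1 hp0).2 h.zero_pos.ne'
      · refine ⟨0, 0, h.pos, Nat.zero_le _, ?_⟩
        rw [if_pos (hb hm0)]
        simp [hz]
    · have hu0 : 0 < u := by rcases hu with h | h <;> exact h.1
      obtain ⟨j, hj, hju, huj⟩ := h.exists_column hs0 hs1 hm hτ hc h0 huI hu0
      rcases huj.eq_or_lt with rfl | huj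
      · exact ⟨j, b j, hj, le_rfl, by simp⟩
      obtain ⟨hx0, hx1⟩ := hinner hju huj
      obtain ⟨-, hval⟩ := h.eqOn_column hs0 hs1 hm hτ hc h0 hj hju.le huj.le
      have hreg := strip_notMem_singularSet hs0 hs1
        (y := z j + m * (c * s ^ j * (u - columnTime s c j))) hx0 hx1
      rw [hval, strip_mem_edge_iff hs0 hs1 hx0 hx1] at hu
      rcases hu with ⟨-, hu, -⟩ | ⟨-, -, ⟨he, k, hk⟩, hm0⟩
      · exact absurd hu hreg
      have hpos : 0 < m := hm.lt_of_ne' (hm0 (.inl he))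
      have hsp := hspeed j
      have ht0 : 0 < c * s ^ j * (u - columnTime s c j) := by linarith
      have ht1 : c * s ^ j * (u - columnTime s c j) < s := by linarith
      have hk0 : 0 < k := by
        have : (0 : ℝ) < k := by
          rw [← hk]
          have := h.enter_pos hs0 hj
          positivity
        exact_mod_cast this
      have hk1 : k ≤ b j := by
        have h1 : (k : ℝ) < (b j : ℤ) + 1 := by
          rw [← hk]
          have h2 := h.exit_le hs0 hj
          have h3 := mul_lt_mul_of_pos_left ht1 hpos
          push_cast
          linarith
        have h2 : k < (b j : ℤ) + 1 := by exact_mod_cast h1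
        omega
      obtain ⟨i, rfl⟩ : ∃ i : ℕ, k = i + 1 := ⟨(k - 1).toNat, by omega⟩
      refine ⟨j, i, hj, by omega, ?_⟩
      rw [if_pos (by omega)]
      push_cast at hk
      rw [← hk]
      field_simp
      ring

/-- Both time 0 and the end of the last column are singular, so neither can be interior to the
domain, which is therefore exactly the interval between them. -/
theorem IsItinerary.isSaddleConnection {n : ℕ} (h : IsItinerary s m z b (n + 1 : ℕ)) (hm : 0 ≤ m)
    {I : Set ℝ} {τ : ℝ → Surface s} (hτ : IsMaximalTrajectory m I τ) {c : ℝ} (hc : 0 < c)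
    (h0 : Enters hs0 m I τ 0 c (z 0)) (h0I : 0 ∈ I) (hsing : τ 0 ∈ singularSet s) :
    IsSaddleConnection I τ := by
  have hn : (n : ℕ∞) < (n + 1 : ℕ) := by exact_mod_cast n.lt_succ_self
  obtain ⟨hI, hval⟩ := h.apply_columnTime_succ hs0 hs1 hm hτ hc h0 hn
  have hpos := (columnTime_nonneg hs0 hc n).trans_lt (columnTime_lt_succ hs0 hc n)
  refine ⟨0, columnTime s c (n + 1), hpos, ?_, hsing, ?_⟩
  · refine Subset.antisymm (fun u hu => ⟨?_, ?_⟩) (hτ.1.ordConnected.out h0I hI)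
    · by_contra! hlt
      exact hτ.1.regular 0 (mem_interior_of_lt_of_lt hτ.1.ordConnected hu hI hlt hpos) hsing
    · rw [columnTime_succ]
      exact (h.enters hs0 hs1 hm hτ hc h0 hn).le_of_singular hs0 hs1 hm (by positivity) hτ (b n)
        (by exact_mod_cast h.last n rfl) hu
  · have e : z n + m * s = ((b n + 1 : ℕ) : ℤ) := by
      have := h.last n rfl
      push_cast; linarith
    rw [hval, e]
    exact strip_one_mem_singularSet hs0 hs1 _

end

/-! ### Weighted sums of integer sequences -/

/-- The average of `f` with the weights `(1 - s) * s ^ i`. -/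
def weightedSum (s : ℝ) (f : ℕ → ℤ) : ℝ := (1 - s) * ∑' i : ℕ, s ^ i * (f i : ℝ)

section

variable {s : ℝ} (hs0 : 0 < s) (hs1 : s < 1)
include hs0 hs1

theorem summable_of_abs_le {f : ℕ → ℤ} {A B : ℝ} (h : ∀ i, |(f i : ℝ)| ≤ A + B * i) :
    Summable fun i => s ^ i * (f i : ℝ) := by
  have h1 : Summable fun i : ℕ => A * s ^ i + B * ((i : ℝ) ^ 1 * s ^ i) :=
    ((summable_geometric_of_lt_one hs0.le hs1).mul_left A).add
      ((summable_pow_mul_geometric_of_norm_lt_one 1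
        (by rwa [Real.norm_eq_abs, abs_of_pos hs0])).mul_left B)
  refine Summable.of_norm_bounded h1 fun i => ?_
  rw [norm_mul, Real.norm_eq_abs, Real.norm_eq_abs, abs_of_pos (pow_pos hs0 i)]
  calc s ^ i * |(f i : ℝ)| ≤ s ^ i * (A + B * i) := by gcongr; exact h i
    _ = _ := by ring

theorem weightedSum_le {f g : ℕ → ℤ} (hf : Summable fun i => s ^ i * (f i : ℝ))
    (hg : Summable fun i => s ^ i * (g i : ℝ)) (h : ∀ i, f i ≤ g i) :
    weightedSum s f ≤ weightedSum s g := by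
  refine mul_le_mul_of_nonneg_left (hf.tsum_le_tsum (fun i => ?_) hg) (by linarith)
  have : (f i : ℝ) ≤ g i := by exact_mod_cast h i
  gcongr

theorem weightedSum_lt {f g : ℕ → ℤ} (hf : Summable fun i => s ^ i * (f i : ℝ))
    (hg : Summable fun i => s ^ i * (g i : ℝ)) (h : ∀ i, f i ≤ g i) {i : ℕ} (hi : f i < g i) :
    weightedSum s f < weightedSum s g := by
  refine mul_lt_mul_of_pos_left (hf.tsum_lt_tsum (i := i) (fun i => ?_) ?_ hg) (by linarith)
  · have : (f i : ℝ) ≤ g i := by exact_mod_cast h i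
    dsimp only
    gcongr
  · have : (f i : ℝ) < g i := by exact_mod_cast hi
    gcongr

theorem weightedSum_add_const {f : ℕ → ℤ} (hf : Summable fun i => s ^ i * (f i : ℝ)) (c : ℤ) :
    weightedSum s (fun i => f i + c) = weightedSum s f + c := by
  have hgeo := summable_geometric_of_lt_one hs0.le hs1
  have : ∀ i : ℕ, s ^ i * ((f i + c : ℤ) : ℝ) = s ^ i * (f i : ℝ) + s ^ i * c := fun i => by
    push_cast; ring
  simp only [weightedSum, this]
  rw [hf.tsum_add (hgeo.mul_right _), tsum_mul_right, tsum_geometric_of_lt_one hs0.le hs1]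
  have : 1 - s ≠ 0 := by linarith
  field_simp

theorem weightedSum_eq_zero_add {f : ℕ → ℤ} (hf : Summable fun i => s ^ i * (f i : ℝ)) :
    weightedSum s f = (1 - s) * f 0 + s * weightedSum s fun i => f (i + 1) := by
  have : ∀ i : ℕ, s ^ (i + 1) * (f (i + 1) : ℝ) = s * (s ^ i * (f (i + 1) : ℝ)) := fun i => by ring
  simp only [weightedSum]
  rw [hf.tsum_eq_zero_add, pow_zero, one_mul]
  simp only [this, tsum_mul_left]
  ring

end

/-! ### Rotations -/

/-- The drop of `⌈·⌉` from `x` to `x - (i + 1) * ξ`. -/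
def ceilDrop (ξ x : ℝ) (i : ℕ) : ℤ := ⌈x - ((i : ℝ) + 1) * ξ⌉ - ⌈x⌉

/-- The drop of `⌊·⌋` from `x` to `x - (i + 1) * ξ`. -/
def floorDrop (ξ x : ℝ) (i : ℕ) : ℤ := ⌊x - ((i : ℝ) + 1) * ξ⌋ - ⌊x⌋

theorem ceilDrop_zero (ξ : ℝ) (i : ℕ) : ceilDrop ξ 0 i = -⌊((i : ℝ) + 1) * ξ⌋ := by
  simp [ceilDrop, Int.ceil_neg]

theorem floorDrop_zero (ξ : ℝ) (i : ℕ) : floorDrop ξ 0 i = -⌈((i : ℝ) + 1) * ξ⌉ := by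
  simp [floorDrop, Int.floor_neg]

/-- The drop depends only on `x - ⌈x⌉ ∈ (-1, 0]`, and monotonically. This yields both the period 1
and the maximum at integers; for floors, `x - ⌊x⌋ ∈ [0, 1)` yields the minimum there. -/
theorem ceilDrop_eq (ξ x : ℝ) (i : ℕ) : ceilDrop ξ x i = ⌈x - ⌈x⌉ - ((i : ℝ) + 1) * ξ⌉ := by
  rw [sub_right_comm, Int.ceil_sub_intCast, ceilDrop]

theorem floorDrop_eq (ξ x : ℝ) (i : ℕ) : floorDrop ξ x i = ⌊x - ⌊x⌋ - ((i : ℝ) + 1) * ξ⌋ := by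
  rw [sub_right_comm, Int.floor_sub_intCast, floorDrop]

theorem ceilDrop_le (ξ x : ℝ) (i : ℕ) : ceilDrop ξ x i ≤ ceilDrop ξ 0 i := by
  rw [ceilDrop_eq, ceilDrop_eq]
  apply Int.ceil_mono
  have := Int.le_ceil x
  simp
  linarith

theorem le_floorDrop (ξ x : ℝ) (i : ℕ) : floorDrop ξ 0 i ≤ floorDrop ξ x i := by
  rw [floorDrop_eq, floorDrop_eq]
  apply Int.floor_mono
  simp

theorem le_ceilDrop (ξ x : ℝ) (i : ℕ) : floorDrop ξ 0 i ≤ ceilDrop ξ x i := by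
  rw [floorDrop_zero, ceilDrop]
  have := Int.ceil_add_le (x - ((i : ℝ) + 1) * ξ) (((i : ℝ) + 1) * ξ)
  rw [sub_add_cancel] at this
  omega

theorem floorDrop_le (ξ x : ℝ) (i : ℕ) : floorDrop ξ x i ≤ ceilDrop ξ 0 i := by
  rw [ceilDrop_zero, floorDrop]
  have := Int.le_floor_add (x - ((i : ℝ) + 1) * ξ) (((i : ℝ) + 1) * ξ)
  rw [sub_add_cancel] at this
  omega

/-- At this index the backward rotation returns to 0, so the drop is `-⌈x⌉`, below the bound `-⌊x⌋`
because `x` is not an integer. Together with its floor analogue this keeps saddle connections off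
the corner before their last column. -/
theorem ceilDrop_lt_of_eq {ξ x : ℝ} {i : ℕ} (hx : x = ((i : ℝ) + 1) * ξ) (hn : ∀ k : ℤ, x ≠ k) :
    ceilDrop ξ x i < ceilDrop ξ 0 i := by
  rw [ceilDrop_zero, ceilDrop, ← hx, sub_self, Int.ceil_zero]
  have : ⌊x⌋ < ⌈x⌉ := by
    rw [Int.lt_ceil]
    exact (Int.floor_le x).lt_of_ne (hn _).symm
  omega

theorem lt_floorDrop_of_eq {ξ x : ℝ} {i : ℕ} (hx : x = ((i : ℝ) + 1) * ξ) (hn : ∀ k : ℤ, x ≠ k) :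
    floorDrop ξ 0 i < floorDrop ξ x i := by
  rw [floorDrop_zero, floorDrop, ← hx, sub_self, Int.floor_zero]
  have : ⌊x⌋ < ⌈x⌉ := by
    rw [Int.lt_ceil]
    exact (Int.floor_le x).lt_of_ne (hn _).symm
  omega

theorem ceilDrop_add_int (ξ x : ℝ) (k : ℤ) : ceilDrop ξ (x + k) = ceilDrop ξ x := by
  funext i
  rw [ceilDrop_eq, ceilDrop_eq, Int.ceil_add_intCast]
  push_cast
  ring_nf

theorem floorDrop_add_int (ξ x : ℝ) (k : ℤ) : floorDrop ξ (x + k) = floorDrop ξ x := by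
  funext i
  rw [floorDrop_eq, floorDrop_eq, Int.floor_add_intCast]
  push_cast
  ring_nf

section

variable {s ξ : ℝ} (hs0 : 0 < s) (hs1 : s < 1) (hξ : 0 ≤ ξ)
include hs0 hs1 hξ

theorem summable_of_mem_Icc_drop {f : ℕ → ℤ} (h1 : ∀ i, floorDrop ξ 0 i ≤ f i)
    (h2 : ∀ i, f i ≤ ceilDrop ξ 0 i) : Summable fun i => s ^ i * (f i : ℝ) := by
  refine summable_of_abs_le hs0 hs1 (A := ξ + 1) (B := ξ) fun i => ?_
  have h3 := h1 i
  have h4 := h2 i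
  rw [floorDrop_zero] at h3
  rw [ceilDrop_zero] at h4
  have h5 : (-⌈((i : ℝ) + 1) * ξ⌉ : ℝ) ≤ f i := by exact_mod_cast h3
  have h6 : (f i : ℝ) ≤ -⌊((i : ℝ) + 1) * ξ⌋ := by exact_mod_cast h4
  have h7 := Int.ceil_lt_add_one (((i : ℝ) + 1) * ξ)
  have h8 : (0 : ℝ) ≤ ⌊((i : ℝ) + 1) * ξ⌋ := by
    exact_mod_cast Int.floor_nonneg.2 (by positivity)
  have h9 : (0 : ℝ) ≤ i * ξ := by positivity
  rw [abs_le]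
  constructor <;> linarith

theorem summable_ceilDrop (x : ℝ) : Summable fun i => s ^ i * (ceilDrop ξ x i : ℝ) :=
  summable_of_mem_Icc_drop hs0 hs1 hξ (le_ceilDrop ξ x) (ceilDrop_le ξ x)

theorem summable_floorDrop (x : ℝ) : Summable fun i => s ^ i * (floorDrop ξ x i : ℝ) :=
  summable_of_mem_Icc_drop hs0 hs1 hξ (le_floorDrop ξ x) (floorDrop_le ξ x)

/-- The drops of `x + ξ` are those of `x`, shifted by one place and lowered by the constant `⌈x + ξ⌉
- ⌈x⌉`. Geometric weights turn the shift into multiplication by `s`, so the rotation becomes the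
return map. -/
theorem weightedSum_ceilDrop_add (x : ℝ) : weightedSum s (ceilDrop ξ (x + ξ)) =
    s * weightedSum s (ceilDrop ξ x) - (⌈x + ξ⌉ - ⌈x⌉ : ℤ) := by
  rw [weightedSum_eq_zero_add hs0 hs1 (summable_ceilDrop hs0 hs1 hξ _)]
  have h0 : ceilDrop ξ (x + ξ) 0 = -(⌈x + ξ⌉ - ⌈x⌉) := by simp [ceilDrop]
  have h1 : (fun i => ceilDrop ξ (x + ξ) (i + 1)) =
      fun i => ceilDrop ξ x i + -(⌈x + ξ⌉ - ⌈x⌉) := by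
    funext i
    have : x + ξ - ((i + 1 : ℕ) + 1 : ℝ) * ξ = x - ((i : ℝ) + 1) * ξ := by push_cast; ring
    simp only [ceilDrop, this]
    ring
  rw [h1, weightedSum_add_const hs0 hs1 (summable_ceilDrop hs0 hs1 hξ _), h0]
  push_cast
  ring

theorem weightedSum_floorDrop_add (x : ℝ) : weightedSum s (floorDrop ξ (x + ξ)) =
    s * weightedSum s (floorDrop ξ x) - (⌊x + ξ⌋ - ⌊x⌋ : ℤ) := by
  rw [weightedSum_eq_zero_add hs0 hs1 (summable_floorDrop hs0 hs1 hξ _)]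
  have h0 : floorDrop ξ (x + ξ) 0 = -(⌊x + ξ⌋ - ⌊x⌋) := by simp [floorDrop]
  have h1 : (fun i => floorDrop ξ (x + ξ) (i + 1)) =
      fun i => floorDrop ξ x i + -(⌊x + ξ⌋ - ⌊x⌋) := by
    funext i
    have : x + ξ - ((i + 1 : ℕ) + 1 : ℝ) * ξ = x - ((i : ℝ) + 1) * ξ := by push_cast; ring
    simp only [floorDrop, this]
    ring
  rw [h1, weightedSum_add_const hs0 hs1 (summable_floorDrop hs0 hs1 hξ _), h0]
  push_cast
  ring

-- With `K = s / (1 - s) * m`, this end slope is the one at which the lower bound `K + W⁻(0)` for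
-- the exit heights becomes 0; for `deltaPlus` the upper bound `K + W⁺(0)` becomes 1.
omit hξ in
theorem deltaMinus_eq : s / (1 - s) * deltaMinus s ξ = -weightedSum s (floorDrop ξ 0) := by
  have h1 : 1 - s ≠ 0 := by linarith
  simp only [deltaMinus, weightedSum, floorDrop_zero, pow_succ', mul_assoc, tsum_mul_left]
  push_cast
  simp only [mul_neg, tsum_neg]
  generalize ∑' x : ℕ, s ^ x * ((⌈((x : ℝ) + 1) * ξ⌉ : ℤ) : ℝ) = S
  field_simp

omit hξ in
theorem deltaPlus_eq : s / (1 - s) * deltaPlus s ξ = 1 - weightedSum s (ceilDrop ξ 0) := by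
  have h1 : 1 - s ≠ 0 := by linarith
  simp only [deltaPlus, weightedSum, ceilDrop_zero, pow_succ', mul_assoc, tsum_mul_left]
  push_cast
  simp only [mul_neg, tsum_neg]
  generalize ∑' x : ℕ, s ^ x * ((⌊((x : ℝ) + 1) * ξ⌋ : ℤ) : ℝ) = S
  field_simp
  ring

theorem deltaMinus_nonneg : 0 ≤ deltaMinus s ξ := by
  unfold deltaMinus
  refine mul_nonneg (sq_nonneg _) (tsum_nonneg fun j => ?_)
  have : (0 : ℝ) ≤ ⌈((j : ℝ) + 1) * ξ⌉ := by exact_mod_cast Int.ceil_nonneg (by positivity)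
  positivity

theorem deltaPlus_nonneg : 0 ≤ deltaPlus s ξ := by
  unfold deltaPlus
  have h1 : 0 < 1 - s := by linarith
  refine add_nonneg (by positivity) (mul_nonneg (sq_nonneg _) (tsum_nonneg fun j => ?_))
  have : (0 : ℝ) ≤ ⌊((j : ℝ) + 1) * ξ⌋ := by exact_mod_cast Int.floor_nonneg.2 (by positivity)
  positivity

/-! ### Itineraries with rotation number `ξ` -/

omit hs0 hs1 hξ in
/-- The number of horizontal edges between two consecutive vertical ones on the line of slope `ξ`
through the origin. -/
def blockCount (ξ : ℝ) (j : ℕ) : ℕ := (⌈((j + 1 : ℕ) : ℝ) * ξ⌉ - ⌈(j : ℝ) * ξ⌉).toNat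

omit hs0 hs1 in
theorem coe_blockCount (j : ℕ) :
    (blockCount ξ j : ℤ) = ⌈((j + 1 : ℕ) : ℝ) * ξ⌉ - ⌈(j : ℝ) * ξ⌉ := by
  refine Int.toNat_of_nonneg (sub_nonneg.2 (Int.ceil_mono ?_))
  gcongr
  exact j.le_succ

omit hs0 hs1 in
theorem coe_blockCount_real (j : ℕ) :
    (blockCount ξ j : ℝ) = ⌈((j + 1 : ℕ) : ℝ) * ξ⌉ - ⌈(j : ℝ) * ξ⌉ := by
  exact_mod_cast coe_blockCount hξ j

omit hs0 hs1 hξ in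
/-- The heights at which the trajectory of slope `m` from the height `z₀` enters `R_s^+`. -/
def enterHeight (s m ξ z₀ : ℝ) : ℕ → ℝ
  | 0 => z₀
  | j + 1 => s * (enterHeight s m ξ z₀ j + m * s - blockCount ξ j)

/-- By `K = s * K + m * s` and the rotation identity, the first two terms are the exits of an exact
orbit. The return map is affine of slope `s`, so another starting height contributes its initial
difference times `s ^ j`. -/
theorem exit_eq_ceil (m z₀ : ℝ) (j : ℕ) :
    enterHeight s m ξ z₀ j + m * s - blockCount ξ j =
      s / (1 - s) * m + weightedSum s (ceilDrop ξ (((j + 1 : ℕ) : ℝ) * ξ)) +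
        s ^ j * (z₀ - s * (s / (1 - s) * m + weightedSum s (ceilDrop ξ 0))) := by
  have h1 : 1 - s ≠ 0 := by linarith
  have hK : s / (1 - s) * m = s * (s / (1 - s) * m) + m * s := by field_simp; ring
  generalize s / (1 - s) * m = K at hK
  induction j with
  | zero =>
    have := weightedSum_ceilDrop_add hs0 hs1 hξ 0
    rw [coe_blockCount_real hξ]
    simp [enterHeight] at this ⊢
    linarith
  | succ j ih =>
    have := weightedSum_ceilDrop_add hs0 hs1 hξ (((j + 1 : ℕ) : ℝ) * ξ)
    have e : ((j + 1 : ℕ) : ℝ) * ξ + ξ = ((j + 1 + 1 : ℕ) : ℝ) * ξ := by push_cast; ring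
    rw [e] at this
    rw [enterHeight, ih, coe_blockCount_real hξ, this, pow_succ]
    push_cast
    linarith

/-- The floor orbit starts at height 1, since `K + W⁻(0) = 0` and heights count modulo 1. As
`blockCount` uses ceilings, the term `1 + ⌊·⌋ - ⌈·⌉` corrects the mismatch: it is 0 off the integers
and 1 at an integer, which `hint` permits only at `j + 1`. -/
theorem exit_eq_floor {m : ℝ} (hm : s / (1 - s) * m = -weightedSum s (floorDrop ξ 0)) (z₀ : ℝ)
    (j : ℕ) (hint : ∀ i : ℕ, 0 < i → i ≤ j → ∀ k : ℤ, (i : ℝ) * ξ ≠ k) :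
    enterHeight s m ξ z₀ j + m * s - blockCount ξ j =
      s / (1 - s) * m + weightedSum s (floorDrop ξ (((j + 1 : ℕ) : ℝ) * ξ)) +
        (1 + ⌊((j + 1 : ℕ) : ℝ) * ξ⌋ - ⌈((j + 1 : ℕ) : ℝ) * ξ⌉) + s ^ j * (z₀ - 1) := by
  have h1 : 1 - s ≠ 0 := by linarith
  have hK : s / (1 - s) * m = s * (s / (1 - s) * m) + m * s := by field_simp; ring
  generalize s / (1 - s) * m = K at hK hm
  induction j with
  | zero =>
    have := weightedSum_floorDrop_add hs0 hs1 hξ 0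
    rw [coe_blockCount_real hξ]
    have h2 : weightedSum s (floorDrop ξ 0) = -K := by linarith
    rw [h2] at this
    simp [enterHeight] at this ⊢
    linarith
  | succ j ih =>
    have := weightedSum_floorDrop_add hs0 hs1 hξ (((j + 1 : ℕ) : ℝ) * ξ)
    have e : ((j + 1 : ℕ) : ℝ) * ξ + ξ = ((j + 1 + 1 : ℕ) : ℝ) * ξ := by push_cast; ring
    have hc : (⌈((j + 1 : ℕ) : ℝ) * ξ⌉ : ℝ) = ⌊((j + 1 : ℕ) : ℝ) * ξ⌋ + 1 := by
      exact_mod_cast (Int.ceil_eq_floor_add_one_iff_notMem _).2 (by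
        rintro ⟨k, hk⟩
        exact hint (j + 1) (Nat.succ_pos j) le_rfl k hk.symm)
    rw [e] at this
    rw [enterHeight, ih fun i hi hij => hint i hi (hij.trans j.le_succ), coe_blockCount_real hξ,
      this, pow_succ, hc]
    push_cast
    linarith

end

/-! ### Fractional parts of multiples -/

/-- Take `l = ⌈1 / f⌉` with `f` the fractional part: the first multiple of `f` to reach 1 overshoots
by less than `f`. -/
theorem exists_fract_mul_lt {x : ℝ} (hx : 0 < Int.fract x) :
    ∃ l : ℕ, 0 < l ∧ Int.fract (l * x) < Int.fract x := by
  set f := Int.fract x with hf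
  have hf1 : f < 1 := Int.fract_lt_one x
  have h1 := Nat.le_ceil (1 / f)
  have h2 := Nat.ceil_lt_add_one (a := 1 / f) (by positivity)
  have h0 : 0 < ⌈1 / f⌉₊ := Nat.ceil_pos.2 (by positivity)
  rw [div_le_iff₀ hx] at h1
  rw [← sub_lt_iff_lt_add, lt_div_iff₀ hx] at h2
  refine ⟨⌈1 / f⌉₊, h0, ?_⟩
  have : Int.fract (⌈1 / f⌉₊ * x) = ⌈1 / f⌉₊ * f - 1 := by
    rw [Int.fract_eq_iff]
    refine ⟨by linarith, by nlinarith, ⌈1 / f⌉₊ * ⌊x⌋ + 1, ?_⟩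
    have := Int.self_sub_floor x
    push_cast
    rw [hf, ← this]
    ring
  rw [this]
  nlinarith

theorem exists_lt_fract_mul {x : ℝ} (hx : Irrational x) :
    ∃ l : ℕ, 0 < l ∧ Int.fract x < Int.fract (l * x) := by
  have hne : ∀ {y : ℝ}, Irrational y → Int.fract y ≠ 0 := by
    intro y hy h
    obtain ⟨k, hk⟩ := Int.fract_eq_zero_iff.1 h
    exact hy.ne_int k hk.symm
  have h1 := Int.fract_neg (hne hx)
  obtain ⟨l, hl, h⟩ := exists_fract_mul_lt (x := -x)
    ((Int.fract_nonneg _).lt_of_ne (hne hx.neg).symm)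
  refine ⟨l, hl, ?_⟩
  have h2 := Int.fract_neg (hne (hx.natCast_mul hl.ne'))
  rw [mul_neg, h1, h2] at h
  linarith

theorem ceil_eq_floor_add_one {x : ℝ} (hx : ∀ k : ℤ, x ≠ k) : ⌈x⌉ = ⌊x⌋ + 1 :=
  (Int.ceil_eq_floor_add_one_iff_notMem _).2 fun ⟨k, hk⟩ => hx k hk.symm

/-- At the index with `i + 1 = l * j`, the two drops differ once `l * (j * ξ)` has a smaller
fractional part than `j * ξ`. The companion lemma for floors uses the opposite inequality. -/
theorem exists_lt_ceilDrop {ξ : ℝ} (hξ : Irrational ξ) {j : ℕ} (hj : 0 < j) :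
    ∃ i, floorDrop ξ 0 i < ceilDrop ξ (j * ξ) i := by
  have hx := hξ.natCast_mul hj.ne'
  obtain ⟨l, hl, h⟩ := exists_fract_mul_lt (x := j * ξ)
    ((Int.fract_nonneg _).lt_of_ne fun h => by
      obtain ⟨k, hk⟩ := Int.fract_eq_zero_iff.1 h.symm
      exact hx.ne_int k hk.symm)
  obtain ⟨i, hi⟩ := Nat.exists_eq_succ_of_ne_zero (Nat.mul_pos hl hj).ne'
  have ha : ((i : ℝ) + 1) * ξ = l * (j * ξ) := by
    rw [← mul_assoc]
    congr 1
    exact_mod_cast hi.symm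
  refine ⟨i, ?_⟩
  rw [floorDrop_zero, ceilDrop, ha, ceil_eq_floor_add_one hx.ne_int,
    ceil_eq_floor_add_one (hx.natCast_mul hl.ne').ne_int]
  have h2 : ⌊(j : ℝ) * ξ⌋ - ⌊(l : ℝ) * (j * ξ)⌋ < ⌈(j : ℝ) * ξ - l * (j * ξ)⌉ := by
    rw [Int.lt_ceil]
    have h3 := Int.self_sub_floor ((j : ℝ) * ξ)
    have h4 := Int.self_sub_floor ((l : ℝ) * (j * ξ))
    push_cast
    linarith
  omega

theorem exists_floorDrop_lt {ξ : ℝ} (hξ : Irrational ξ) {j : ℕ} (hj : 0 < j) :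
    ∃ i, floorDrop ξ (j * ξ) i < ceilDrop ξ 0 i := by
  have hx := hξ.natCast_mul hj.ne'
  obtain ⟨l, hl, h⟩ := exists_lt_fract_mul hx
  obtain ⟨i, hi⟩ := Nat.exists_eq_succ_of_ne_zero (Nat.mul_pos hl hj).ne'
  have ha : ((i : ℝ) + 1) * ξ = l * (j * ξ) := by
    rw [← mul_assoc]
    congr 1
    exact_mod_cast hi.symm
  refine ⟨i, ?_⟩
  rw [ceilDrop_zero, floorDrop, ha]
  have h2 : ⌊(j : ℝ) * ξ - l * (j * ξ)⌋ < ⌊(j : ℝ) * ξ⌋ - ⌊(l : ℝ) * (j * ξ)⌋ := by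
    rw [Int.floor_lt]
    have h3 := Int.self_sub_floor ((j : ℝ) * ξ)
    have h4 := Int.self_sub_floor ((l : ℝ) * (j * ξ))
    push_cast
    linarith
  omega

/-! ### Itineraries for irrational rotation number and for the two end slopes -/

section

variable {s ξ : ℝ} (hs0 : 0 < s) (hs1 : s < 1) (hξ : 0 ≤ ξ)
include hs0 hs1 hξ

/-- No `(i + 1) * ξ` is an integer, so the two drop sequences at 0 differ by exactly 1 in every
place. This makes the two end slopes coincide. -/
theorem weightedSum_ceilDrop_eq_add_one (hirr : Irrational ξ) :
    weightedSum s (ceilDrop ξ 0) = weightedSum s (floorDrop ξ 0) + 1 := by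
  have := weightedSum_add_const hs0 hs1 (summable_floorDrop hs0 hs1 hξ 0) 1
  rw [Int.cast_one] at this
  rw [← this]
  congr 1
  funext i
  rw [ceilDrop_zero, floorDrop_zero]
  have h : Irrational (((i + 1 : ℕ) : ℝ) * ξ) := hirr.natCast_mul i.succ_ne_zero
  push_cast at h
  rw [ceil_eq_floor_add_one h.ne_int]
  ring

/-- The drops at 0 differ by at most 1, and by 0 at place `n - 1`, where the multiple of `ξ` is the
integer `k`. This is the gap between the two end slopes. -/
theorem weightedSum_ceilDrop_lt_add_one {n : ℕ} (hn : 0 < n) {k : ℤ} (hk : (n : ℝ) * ξ = k) :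
    weightedSum s (ceilDrop ξ 0) < weightedSum s (floorDrop ξ 0) + 1 := by
  have := weightedSum_add_const hs0 hs1 (summable_floorDrop hs0 hs1 hξ 0) 1
  rw [Int.cast_one] at this
  rw [← this]
  have hsum : Summable fun i => s ^ i * ((floorDrop ξ 0 i + 1 : ℤ) : ℝ) := by
    have := (summable_floorDrop hs0 hs1 hξ 0).add (summable_geometric_of_lt_one hs0.le hs1)
    refine this.congr fun i => ?_
    push_cast; ring
  refine weightedSum_lt hs0 hs1 (summable_ceilDrop hs0 hs1 hξ 0) hsum (fun i => ?_)
    (i := n - 1) ?_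
  · rw [ceilDrop_zero, floorDrop_zero]
    have := Int.ceil_le_floor_add_one (((i : ℝ) + 1) * ξ)
    omega
  · rw [ceilDrop_zero, floorDrop_zero]
    have : ((n - 1 : ℕ) : ℝ) + 1 = n := by exact_mod_cast Nat.sub_add_cancel hn
    rw [this, hk, Int.floor_intCast, Int.ceil_intCast]
    omega

/-- Here `K + W⁺(0) = 1`, so the ceiling orbit starts at `s` and the floor orbit at 1. For `z₀ ∈ [s,
1]` the geometric errors have the right signs: the first orbit bounds the exits from below, the
second from above. -/
theorem isItinerary_of_irrational (hirr : Irrational ξ) {m z₀ : ℝ}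
    (hm : s / (1 - s) * m = -weightedSum s (floorDrop ξ 0)) (hz0 : s ≤ z₀) (hz1 : z₀ ≤ 1) :
    IsItinerary s m (enterHeight s m ξ z₀) (blockCount ξ) ⊤ := by
  have hW := weightedSum_ceilDrop_eq_add_one hs0 hs1 hξ hirr
  refine ⟨by simp, hs0.trans_le hz0, hz1, fun j _ => ?_, fun j _ => ?_, fun j _ => rfl,
    fun j hj => absurd hj (by exact ENat.natCast_ne_top _)⟩
  · rw [exit_eq_ceil hs0 hs1 hξ]
    obtain ⟨i, hi⟩ := exists_lt_ceilDrop hirr j.succ_pos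
    have h1 := weightedSum_lt hs0 hs1 (summable_floorDrop hs0 hs1 hξ 0)
      (summable_ceilDrop hs0 hs1 hξ _) (le_ceilDrop ξ (((j + 1 : ℕ) : ℝ) * ξ)) hi
    have h2 : 0 ≤ s ^ j * (z₀ - s * (s / (1 - s) * m + weightedSum s (ceilDrop ξ 0))) := by
      refine mul_nonneg (by positivity) ?_
      rw [hm, hW]
      linarith
    linarith
  · rw [exit_eq_floor hs0 hs1 hξ hm z₀ j fun i hi _ => (hirr.natCast_mul hi.ne').ne_int,
      ceil_eq_floor_add_one (hirr.natCast_mul j.succ_ne_zero).ne_int]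
    obtain ⟨i, hi⟩ := exists_floorDrop_lt hirr j.succ_pos
    have h1 := weightedSum_lt hs0 hs1 (summable_floorDrop hs0 hs1 hξ _)
      (summable_ceilDrop hs0 hs1 hξ 0) (floorDrop_le ξ (((j + 1 : ℕ) : ℝ) * ξ)) hi
    have h2 : s ^ j * (z₀ - 1) ≤ 0 :=
      mul_nonpos_of_nonneg_of_nonpos (by positivity) (by linarith)
    push_cast at h1 ⊢
    linarith

/-- `K + W⁺(0) = 1` makes `s` the starting height of the ceiling orbit, so there is no error term.
Exits are below 1 until `nξ = k`, where periodicity gives `W⁺(0)` again and the exit is exactly 1.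
-/
theorem isItinerary_deltaPlus {n : ℕ} (hn : 0 < n) {k : ℤ} (hk : (n : ℝ) * ξ = k)
    (hmin : ∀ j : ℕ, 0 < j → j < n → ∀ h : ℤ, (j : ℝ) * ξ ≠ h) {m : ℝ}
    (hm : s / (1 - s) * m = 1 - weightedSum s (ceilDrop ξ 0)) :
    IsItinerary s m (enterHeight s m ξ s) (blockCount ξ) n := by
  have hW := weightedSum_ceilDrop_lt_add_one hs0 hs1 hξ hn hk
  have hexit : ∀ j : ℕ, enterHeight s m ξ s j + m * s - blockCount ξ j =
      1 - weightedSum s (ceilDrop ξ 0) + weightedSum s (ceilDrop ξ (((j + 1 : ℕ) : ℝ) * ξ)) := by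
    intro j
    rw [exit_eq_ceil hs0 hs1 hξ, hm]
    ring
  refine ⟨by exact_mod_cast hn, hs0, hs1.le, fun j _ => ?_, fun j hj => ?_, fun j _ => rfl,
    fun j hj => ?_⟩
  · rw [hexit]
    have := weightedSum_le hs0 hs1 (summable_floorDrop hs0 hs1 hξ 0)
      (summable_ceilDrop hs0 hs1 hξ _) (le_ceilDrop ξ (((j + 1 : ℕ) : ℝ) * ξ))
    linarith
  · rw [hexit]
    have hj' : j + 1 < n := by exact_mod_cast hj
    have := weightedSum_lt hs0 hs1 (summable_ceilDrop hs0 hs1 hξ _)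
      (summable_ceilDrop hs0 hs1 hξ 0) (ceilDrop_le ξ (((j + 1 : ℕ) : ℝ) * ξ))
      (ceilDrop_lt_of_eq (i := j) (by push_cast; rfl) (hmin _ j.succ_pos hj'))
    linarith
  · have hj' : j + 1 = n := by exact_mod_cast hj
    rw [hexit, hj', hk, ← zero_add (k : ℝ), ceilDrop_add_int]
    ring

/-- Mirror image along the floor orbit from height 1. In the last column `W⁻` returns to `W⁻(0)`,
and the integrality correction supplies the exit height 1. -/
theorem isItinerary_deltaMinus {n : ℕ} (hn : 0 < n) {k : ℤ} (hk : (n : ℝ) * ξ = k)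
    (hmin : ∀ j : ℕ, 0 < j → j < n → ∀ h : ℤ, (j : ℝ) * ξ ≠ h) {m : ℝ}
    (hm : s / (1 - s) * m = -weightedSum s (floorDrop ξ 0)) :
    IsItinerary s m (enterHeight s m ξ 1) (blockCount ξ) n := by
  have hW := weightedSum_ceilDrop_lt_add_one hs0 hs1 hξ hn hk
  have hexit : ∀ j : ℕ, j < n → enterHeight s m ξ 1 j + m * s - blockCount ξ j =
      -weightedSum s (floorDrop ξ 0) + weightedSum s (floorDrop ξ (((j + 1 : ℕ) : ℝ) * ξ)) +
        (1 + ⌊((j + 1 : ℕ) : ℝ) * ξ⌋ - ⌈((j + 1 : ℕ) : ℝ) * ξ⌉) := by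
    intro j hj
    rw [exit_eq_floor hs0 hs1 hξ hm 1 j fun i hi hij => hmin i hi (hij.trans_lt hj), hm]
    ring
  refine ⟨by exact_mod_cast hn, one_pos, le_rfl, fun j hj => ?_, fun j hj => ?_, fun j _ => rfl,
    fun j hj => ?_⟩
  · have hj' : j + 1 < n := by exact_mod_cast hj
    have hint := hmin _ j.succ_pos hj'
    rw [hexit j (by omega), ceil_eq_floor_add_one hint]
    have := weightedSum_lt hs0 hs1 (summable_floorDrop hs0 hs1 hξ 0)
      (summable_floorDrop hs0 hs1 hξ _) (le_floorDrop ξ (((j + 1 : ℕ) : ℝ) * ξ))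
      (lt_floorDrop_of_eq (i := j) (by push_cast; rfl) hint)
    push_cast at this ⊢
    linarith
  · have hj' : j + 1 < n := by exact_mod_cast hj
    have hint := hmin _ j.succ_pos hj'
    rw [hexit j (by omega), ceil_eq_floor_add_one hint]
    have := weightedSum_le hs0 hs1 (summable_floorDrop hs0 hs1 hξ _)
      (summable_ceilDrop hs0 hs1 hξ 0) (floorDrop_le ξ (((j + 1 : ℕ) : ℝ) * ξ))
    push_cast at this ⊢
    linarith
  · have hj' : j + 1 = n := by exact_mod_cast hj
    rw [hexit j (by omega), hj', hk, Int.floor_intCast, Int.ceil_intCast, ← zero_add (k : ℝ),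
      floorDrop_add_int]
    ring

/-! ### The periodic itinerary -/

/-- Starting on the ceiling orbit kills the error term, and the two strict inequalities for the
slope leave room on both sides of every exit height. -/
theorem isItinerary_periodic {m : ℝ} (h0 : -weightedSum s (floorDrop ξ 0) < s / (1 - s) * m)
    (h1 : s / (1 - s) * m < 1 - weightedSum s (ceilDrop ξ 0)) :
    IsItinerary s m (enterHeight s m ξ (s * (s / (1 - s) * m + weightedSum s (ceilDrop ξ 0))))
      (blockCount ξ) ⊤ := by
  have hle := weightedSum_le hs0 hs1 (summable_floorDrop hs0 hs1 hξ 0)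
    (summable_ceilDrop hs0 hs1 hξ 0) (le_ceilDrop ξ 0)
  refine ⟨by simp, mul_pos hs0 (by linarith), ?_, fun j _ => ?_, fun j _ => ?_, fun j _ => rfl,
    fun j hj => absurd hj (by exact ENat.natCast_ne_top _)⟩
  · rw [enterHeight]
    nlinarith
  · rw [exit_eq_ceil hs0 hs1 hξ]
    have := weightedSum_le hs0 hs1 (summable_floorDrop hs0 hs1 hξ 0)
      (summable_ceilDrop hs0 hs1 hξ _) (le_ceilDrop ξ (((j + 1 : ℕ) : ℝ) * ξ))
    linarith
  · rw [exit_eq_ceil hs0 hs1 hξ]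
    have := weightedSum_le hs0 hs1 (summable_ceilDrop hs0 hs1 hξ _)
      (summable_ceilDrop hs0 hs1 hξ 0) (ceilDrop_le ξ (((j + 1 : ℕ) : ℝ) * ξ))
    linarith

theorem enterHeight_periodic_eq (m : ℝ) (j : ℕ) :
    enterHeight s m ξ (s * (s / (1 - s) * m + weightedSum s (ceilDrop ξ 0))) j =
      s * (s / (1 - s) * m + weightedSum s (ceilDrop ξ (j * ξ))) := by
  cases j with
  | zero => simp [enterHeight]
  | succ j =>
    rw [enterHeight, exit_eq_ceil hs0 hs1 hξ]
    ring

theorem weightedSum_ceilDrop_injOn {n : ℕ} {k : ℤ} (hk : (n : ℝ) * ξ = k)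
    (hmin : ∀ j : ℕ, 0 < j → j < n → ∀ h : ℤ, (j : ℝ) * ξ ≠ h) {i j : ℕ} (hi : i < n)
    (hj : j < n) (h : weightedSum s (ceilDrop ξ (i * ξ)) = weightedSum s (ceilDrop ξ (j * ξ))) :
    i = j := by
  have key : ∀ {i j : ℕ}, j < n → (j : ℝ) * ξ - ⌈(j : ℝ) * ξ⌉ < i * ξ - ⌈(i : ℝ) * ξ⌉ →
      weightedSum s (ceilDrop ξ (j * ξ)) < weightedSum s (ceilDrop ξ (i * ξ)) := by
    intro i j hj hlt
    refine weightedSum_lt hs0 hs1 (summable_ceilDrop hs0 hs1 hξ _)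
      -- At this place `j * ξ` has been rotated back by `j + n` steps to an integer, so its ceiling
      -- is strictly below that of the larger value. Adding `n` keeps the place meaningful when `j =
      -- 0`.
      (summable_ceilDrop hs0 hs1 hξ _) (fun l => ?_) (i := j + n - 1) ?_
    · rw [ceilDrop_eq, ceilDrop_eq]
      apply Int.ceil_mono
      linarith
    · have e : ((j + n - 1 : ℕ) : ℝ) + 1 = j + n := by
        exact_mod_cast Nat.sub_add_cancel (by omega : 1 ≤ j + n)
      rw [ceilDrop_eq, ceilDrop_eq, e, Int.lt_ceil]
      have h1 : (j : ℝ) * ξ - ⌈(j : ℝ) * ξ⌉ - (j + n) * ξ = ((-⌈(j : ℝ) * ξ⌉ - k : ℤ) : ℝ) := by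
        push_cast
        rw [← hk]
        ring
      rw [h1, Int.ceil_intCast, ← h1]
      linarith
  have hne : ∀ {i j : ℕ}, i < j → j < n →
      (i : ℝ) * ξ - ⌈(i : ℝ) * ξ⌉ ≠ j * ξ - ⌈(j : ℝ) * ξ⌉ := by
    intro i j hij hj heq
    refine hmin (j - i) (by omega) (by omega) (⌈(j : ℝ) * ξ⌉ - ⌈(i : ℝ) * ξ⌉) ?_
    rw [Nat.cast_sub hij.le]
    push_cast
    linarith
  by_contra hij
  have hr : (i : ℝ) * ξ - ⌈(i : ℝ) * ξ⌉ ≠ j * ξ - ⌈(j : ℝ) * ξ⌉ := by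
    rcases lt_or_gt_of_ne hij with hlt | hlt
    · exact hne hlt hj
    · exact (hne hlt hi).symm
  rcases lt_or_gt_of_ne hr with hlt | hlt
  · exact (key hi hlt).ne h
  · exact (key hj hlt).ne h.symm

/-- The rotation identity iterated `J` times. For `J = n` and `nξ = k` the left side is again
`W⁺(0)`, leaving a linear equation that yields the finite formula for the starting height. -/
theorem weightedSum_ceilDrop_mul (J : ℕ) : weightedSum s (ceilDrop ξ (J * ξ)) =
    s ^ J * (weightedSum s (ceilDrop ξ 0) -
      1 / s * ∑ j ∈ Finset.range J, blockCount ξ j * (1 / s) ^ j) := by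
  induction J with
  | zero => simp
  | succ J ih =>
    have := weightedSum_ceilDrop_add hs0 hs1 hξ (J * ξ)
    have e : (J : ℝ) * ξ + ξ = ((J + 1 : ℕ) : ℝ) * ξ := by push_cast; ring
    rw [e, ih] at this
    rw [this, Finset.sum_range_succ, coe_blockCount_real hξ]
    push_cast
    have e2 : s ^ (J + 1) * (1 / s * (1 / s) ^ J) = 1 := by
      rw [← pow_succ', ← mul_pow, mul_one_div_cancel hs0.ne', one_pow]
    generalize ((⌈((J : ℝ) + 1) * ξ⌉ : ℝ) - ⌈(J : ℝ) * ξ⌉) = D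
    generalize weightedSum s (ceilDrop ξ 0) = W0
    generalize (∑ j ∈ Finset.range J, (blockCount ξ j : ℝ) * (1 / s) ^ j) = S
    linear_combination (D : ℝ) * e2

-- Group the terms by the value `j` of the floor: it is attained exactly for `⌈jξ⌉ ≤ l - 1 <
-- ⌈(j+1)ξ⌉`, that is, `blockCount ξ j` times.
omit hs0 hs1 in
theorem sum_floor_eq {k n : ℕ} (hn : 0 < n) (hk : (k : ℝ) = n * ξ) (f : ℕ → ℝ) :
    ∑ l ∈ Finset.Icc 1 k, f ⌊((l : ℝ) - 1) * n / k⌋₊ =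
      ∑ j ∈ Finset.range n, blockCount ξ j * f j := by
  have hn' : (0 : ℝ) < n := by exact_mod_cast hn
  have h1 : ∑ l ∈ Finset.Icc 1 k, f ⌊((l : ℝ) - 1) * n / k⌋₊ =
      ∑ l ∈ Finset.range k, f ⌊(l : ℝ) * n / k⌋₊ := by
    rw [Finset.range_eq_Ico, Finset.sum_Ico_eq_sum_range, ← Finset.Ico_add_one_right_eq_Icc,
      Finset.sum_Ico_eq_sum_range]
    simp
  have hceil : ∀ j : ℕ, ((⌈(j : ℝ) * ξ⌉₊ : ℕ) : ℤ) = ⌈(j : ℝ) * ξ⌉ := fun j =>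
    Int.natCast_ceil_eq_ceil (by positivity)
  have h2 : ∀ J : ℕ, ∑ l ∈ Finset.range ⌈(J : ℝ) * ξ⌉₊, f ⌊(l : ℝ) * n / k⌋₊ =
      ∑ j ∈ Finset.range J, blockCount ξ j * f j := by
    intro J
    induction J with
    | zero => simp
    | succ J ih =>
      have hmono : ⌈(J : ℝ) * ξ⌉₊ ≤ ⌈((J + 1 : ℕ) : ℝ) * ξ⌉₊ := by
        refine Nat.ceil_mono ?_
        gcongr
        exact J.le_succ
      rw [Finset.sum_range_succ, ← ih, ← Finset.sum_range_add_sum_Ico _ hmono]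
      congr 1
      have h3 : ∀ l ∈ Finset.Ico ⌈(J : ℝ) * ξ⌉₊ ⌈((J + 1 : ℕ) : ℝ) * ξ⌉₊,
          f ⌊(l : ℝ) * n / k⌋₊ = f J := by
        intro l hl
        rw [Finset.mem_Ico, Nat.ceil_le, Nat.lt_ceil] at hl
        push_cast at hl
        have hξ0 : 0 < ξ := by
          refine hξ.lt_of_ne fun h => ?_
          rw [← h] at hl
          have : (0 : ℝ) ≤ l := Nat.cast_nonneg l
          linarith [hl.2]
        congr 1
        rw [Nat.floor_eq_iff (by positivity), hk]
        have e : (l : ℝ) * n / (n * ξ) = l / ξ := by field_simp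
        rw [e, le_div_iff₀ hξ0, div_lt_iff₀ hξ0]
        exact hl
      rw [Finset.sum_congr rfl h3, Finset.sum_const, Nat.card_Ico, nsmul_eq_mul]
      congr 2
      have := coe_blockCount hξ J
      rw [← hceil, ← hceil] at this
      omega
  rw [h1, ← h2 n, ← hk, Nat.ceil_natCast]

theorem periodic_height_eq {k n : ℕ} (hn : 0 < n) (hk : (k : ℝ) = n * ξ) (m : ℝ) :
    s ^ 2 / (1 - s) * m - s ^ n / (1 - s ^ n) *
      ∑ l ∈ Finset.Icc 1 k, (1 / s) ^ ⌊((l : ℝ) - 1) * n / k⌋₊ =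
        s * (s / (1 - s) * m + weightedSum s (ceilDrop ξ 0)) := by
  have h1 := weightedSum_ceilDrop_mul hs0 hs1 hξ n
  rw [← hk, ← zero_add (k : ℝ)] at h1
  have h2 := ceilDrop_add_int ξ 0 k
  push_cast at h2
  rw [h2, ← sum_floor_eq hξ hn hk] at h1
  generalize (∑ l ∈ Finset.Icc 1 k, (1 / s) ^ ⌊((l : ℝ) - 1) * n / k⌋₊) = S at *
  generalize weightedSum s (ceilDrop ξ 0) = W at *
  have h3 : s ^ n < 1 := pow_lt_one₀ hs0.le hs1 hn.ne'
  have h4 : 1 - s ^ n ≠ 0 := by linarith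
  have h5 : 1 - s ≠ 0 := by linarith
  field_simp at h1 ⊢
  linear_combination (-(1 - s)) * h1

end

/-! ### Closed trajectories -/

section

variable {s : ℝ} (hs0 : 0 < s) (hs1 : s < 1)
include hs0 hs1

theorem exists_int_of_strip_eq {x y y' : ℝ} (hx0 : 1 - s < x) (hx1 : x < 1)
    (h : strip hs0 x y = strip hs0 x y') : ∃ k : ℤ, y - y' = k := by
  obtain ⟨k, h0, h1⟩ := exists_int_sub_mem_Ioc hs0 y
  obtain ⟨k', h0', h1'⟩ := exists_int_sub_mem_Ioc hs0 y'
  have h2 := represents_strip_sub_int hs0 k hx0.le hx1.le h0.le h1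
  have h3 := represents_strip_sub_int hs0 k' hx0.le hx1.le h0'.le h1'
  rw [h] at h2
  have := h2.normalForm_eq hs0 hs1 h3
  rw [normalForm_right hs0 hs1 hx0 hx1 h0.ne', normalForm_right hs0 hs1 hx0 hx1 h0'.ne'] at this
  have := (Prod.ext_iff.1 this).2
  exact ⟨k - k', by push_cast; dsimp only at this; linarith⟩

theorem eq_of_strip_left_eq {y y' : ℝ} (h0 : 0 < y) (h1 : y < s) (h0' : 0 < y') (h1' : y' < s)
    (h : strip hs0 (1 - s) y = strip hs0 (1 - s) y') : y = y' := by
  have h2 := represents_strip hs0 (x := 1 - s) le_rfl (by linarith) h0.le (by linarith)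
  have h3 := represents_strip hs0 (x := 1 - s) le_rfl (by linarith) h0'.le (by linarith)
  rw [h] at h2
  have := h2.normalForm_eq hs0 hs1 h3
  rw [normalForm_left hs0 hs1 h0 h1, normalForm_left hs0 hs1 h0' h1'] at this
  have := (Prod.ext_iff.1 this).2
  dsimp only at this
  field_simp at this
  exact this

theorem horizontal_strip {x y : ℝ} (hx0 : 1 - s ≤ x) (hx1 : x ≤ 1) :
    horizontal hs0.ne' (strip hs0 x y) = (x : AddCircle s) := by
  obtain ⟨k, h0, h1⟩ := exists_int_sub_mem_Ioc hs0 y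
  exact (represents_strip_sub_int hs0 k hx0 hx1 h0.le h1).horizontal_eq hs0.ne'

variable {m : ℝ} {z : ℕ → ℝ} {b : ℕ → ℕ} {n : ℕ}

theorem exists_column_of_lt {c : ℝ} {u : ℝ} (hu0 : 0 ≤ u)
    (hu : u < columnTime s c n) :
    ∃ j < n, columnTime s c j ≤ u ∧ u < columnTime s c (j + 1) := by
  classical
  have hex : ∃ j, u < columnTime s c j := ⟨n, hu⟩
  obtain ⟨k, hk⟩ : ∃ k, Nat.find hex = k + 1 := Nat.exists_eq_succ_of_ne_zero (by
    intro h
    have := Nat.find_spec hex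
    rw [h] at this
    simp at this
    linarith)
  have h1 := Nat.find_spec hex
  have h2 := Nat.find_min hex (m := k) (by omega)
  have h3 := Nat.find_min' hex hu
  rw [hk] at h1
  exact ⟨k, by omega, not_lt.1 h2, h1⟩

theorem mul_sub_columnTime_lt {c u : ℝ} (hc : 0 < c) {j : ℕ} (hu : u < columnTime s c (j + 1)) :
    c * s ^ j * (u - columnTime s c j) < s := by
  rw [columnTime_succ] at hu
  have h : u - columnTime s c j < s / (c * s ^ j) := by linarith
  rw [lt_div_iff₀ (by positivity)] at h
  linarith

/-- Columns are half-open of width `s`, so the horizontal coordinate modulo `s` fixes the position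
inside the column. The heights then agree modulo 1, and entry heights in `(0, s)` must be equal;
hence the column is the same. -/
theorem IsItinerary.injOn (h : IsItinerary s m z b ⊤) (hm : 0 ≤ m) {I : Set ℝ}
    {τ : ℝ → Surface s} (hτ : IsMaximalTrajectory m I τ) {c : ℝ} (hc : 0 < c)
    (h0 : Enters hs0 m I τ 0 c (z 0)) (hlt : ∀ j, z j < s)
    (hinj : ∀ i < n, ∀ j < n, z i = z j → i = j) :
    InjOn τ (Ico 0 (columnTime s c n)) := by
  intro u hu v hv huv
  obtain ⟨i, hi, hiu, hui⟩ := exists_column_of_lt hs0 hs1 hu.1 hu.2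
  obtain ⟨j, hj, hjv, hvj⟩ := exists_column_of_lt hs0 hs1 hv.1 hv.2
  have hu2 := (h.eqOn_column hs0 hs1 hm hτ hc h0 (ENat.natCast_lt_top i) hiu hui.le).2
  have hv2 := (h.eqOn_column hs0 hs1 hm hτ hc h0 (ENat.natCast_lt_top j) hjv hvj.le).2
  have hci : 0 < c * s ^ i := by positivity
  have hcj : 0 < c * s ^ j := by positivity
  have hu3 := mul_sub_columnTime_lt hs0 hs1 hc hui
  have hv3 := mul_sub_columnTime_lt hs0 hs1 hc hvj
  have hu4 : 0 ≤ c * s ^ i * (u - columnTime s c i) := mul_nonneg hci.le (by linarith)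
  have hv4 : 0 ≤ c * s ^ j * (v - columnTime s c j) := mul_nonneg hcj.le (by linarith)
  rw [huv] at hu2
  have hs := hu2.symm.trans hv2
  have hx := congrArg (horizontal hs0.ne') hs
  rw [horizontal_strip hs0 hs1 (by linarith) (by linarith),
    horizontal_strip hs0 hs1 (by linarith) (by linarith)] at hx
  have hx' := eq_of_coe_eq_of_abs_lt hx (by rw [abs_lt]; constructor <;> linarith)
  have ht : c * s ^ i * (u - columnTime s c i) = c * s ^ j * (v - columnTime s c j) := by linarith
  rw [← ht] at hs
  have hzi := h.enter_pos hs0 (ENat.natCast_lt_top i)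
  have hzj := h.enter_pos hs0 (ENat.natCast_lt_top j)
  have hz : z i = z j := by
    rcases hu4.eq_or_lt with h5 | h5
    · rw [← h5] at hs
      simp only [add_zero, mul_zero] at hs
      exact eq_of_strip_left_eq hs0 hs1 hzi (hlt i) hzj (hlt j) hs
    · obtain ⟨k, hk⟩ := exists_int_of_strip_eq hs0 hs1 (by linarith) (by linarith) hs
      have h6 : z i - z j = k := by linarith
      have h7 : |(k : ℝ)| < 1 := by
        rw [← h6, abs_lt]
        constructor <;> linarith [hlt i, hlt j]
      have h8 : k = 0 := by
        rw [← Int.abs_lt_one_iff]; exact_mod_cast h7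
      rw [h8] at h6
      push_cast at h6
      linarith
  obtain rfl := hinj i hi j hj hz
  have := mul_left_cancel₀ hci.ne' ht
  linarith

theorem IsItinerary.Ici_subset (h : IsItinerary s m z b ⊤) (hm : 0 ≤ m) {I : Set ℝ}
    {τ : ℝ → Surface s} (hτ : IsMaximalTrajectory m I τ) {c : ℝ} (hc : 0 < c)
    (h0 : Enters hs0 m I τ 0 c (z 0)) : Ici 0 ⊆ I := by
  intro u hu
  obtain ⟨N, hN⟩ := exists_nat_gt (u / (s / c))
  rw [div_lt_iff₀ (by positivity)] at hN
  obtain ⟨j, -, h1, h2⟩ := exists_column_of_lt hs0 hs1 hu (hN.trans_le (le_columnTime hs0 hs1 hc N))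
  exact (h.eqOn_column hs0 hs1 hm hτ hc h0 (ENat.natCast_lt_top j) h1 h2.le).1

/-- A trajectory with a periodic itinerary runs through the same loop at all times. -/
theorem IsItinerary.image_eq (h : IsItinerary s m z b ⊤) (hm : 0 ≤ m) {I : Set ℝ}
    {τ : ℝ → Surface s} (hτ : IsMaximalTrajectory m I τ) {c : ℝ} (hc : 0 < c)
    (h0 : Enters hs0 m I τ 0 c (z 0)) (hn : 0 < n) (hper : ∀ j, z (j % n) = z j) :
    τ 0 = τ (columnTime s c n) ∧ τ '' I = τ '' Ico 0 (columnTime s c n) := by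
  have := t2Space_surface hs0 hs1
  have hsub := h.Ici_subset hs0 hs1 hm hτ hc h0
  set T := columnTime s c n with hT
  have hTpos : 0 < T := by
    rw [hT, ← columnTime_zero s c]
    exact columnTime_strictMono hs0 hc hn
  -- After one period the trajectory repeats itself slowed down by `s ^ n`; in time this is the
  -- expanding map `u ↦ a * u + T`.
  set a : ℝ := (s ^ n)⁻¹ with ha
  have hsn : s ^ n < 1 := pow_lt_one₀ hs0.le hs1 hn.ne'
  have ha1 : 1 < a := (one_lt_inv₀ (by positivity)).2 hsn
  have ha0 : 0 < a := by linarith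
  -- The fixed point `e` of the return map is the time at which the backward laps accumulate.
  obtain ⟨e, he⟩ : ∃ e, a * e + T = e := ⟨-T / (a - 1), by
    have : a - 1 ≠ 0 := by linarith
    field_simp; ring⟩
  have he0 : e < 0 := by nlinarith
  have hz : z n = z 0 := by rw [← hper n, Nat.mod_self]
  have h0T : Enters hs0 m I τ T (c * s ^ n) (z 0) := by
    rw [← hz]; exact h.enters hs0 hs1 hm hτ hc h0 (ENat.natCast_lt_top n)
  -- invariance under the return map
  have hback : ∀ u, a * u + T ∈ I → u ∈ I ∧ τ u = τ (a * u + T) := by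
    have htend : Tendsto (fun u => a * u + T) (𝓝[>] 0) (𝓝[>] T) := by
      refine tendsto_nhdsWithin_iff.2 ⟨?_, ?_⟩
      · have : Continuous fun u => a * u + T := by fun_prop
        simpa using (this.tendsto 0).mono_left nhdsWithin_le_nhds
      · filter_upwards [self_mem_nhdsWithin] with u hu
        have : 0 < a * u := mul_pos ha0 hu
        simpa using this
    have hev : ∀ᶠ u in 𝓝[>] (0 : ℝ), u ∈ I ∧ a * u + T ∈ I ∧ τ u = τ (a * u + T) := by
      filter_upwards [h0, htend.eventually h0T] with u hu hu'
      refine ⟨hu.1, hu'.1, ?_⟩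
      rw [hu.2, hu'.2]
      have e : c * s ^ n * (a * u + T - T) = c * (u - 0) := by
        rw [ha]; field_simp; ring
      rw [e]
    obtain ⟨r, hr, hsub'⟩ := mem_nhdsGT_iff_exists_Ioo_subset.1 hev
    have := hτ.subset hs0 hs1 hm (hτ.1.comp_affine (b := T) ha0) hr (fun u hu => (hsub' hu).1)
      (fun u hu => (hsub' hu).2.1) (fun u hu => (hsub' hu).2.2)
    exact fun u hu => ⟨this.1 hu, this.2 hu⟩
  have hiter : ∀ (N : ℕ) (u : ℝ), u ∈ I → e + (s ^ n) ^ N * (u - e) ∈ I ∧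
      τ (e + (s ^ n) ^ N * (u - e)) = τ u := by
    intro N u hu
    induction N with
    | zero => simpa using hu
    | succ N ih =>
      have e1 : a * (e + (s ^ n) ^ (N + 1) * (u - e)) + T = e + (s ^ n) ^ N * (u - e) := by
        have : a * s ^ n = 1 := inv_mul_cancel₀ (by positivity)
        rw [pow_succ]
        linear_combination he + (s ^ n) ^ N * (u - e) * this
      obtain ⟨h1, h2⟩ := hback _ (by rw [e1]; exact ih.1)
      exact ⟨h1, by rw [h2, e1, ih.2]⟩
  -- If `e` were in the domain, contraction towards `e` and continuity would make the curve
  -- constant, but two points of the first column have different horizontal coordinates.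
  have hlow : ∀ u ∈ I, e < u := by
    intro u hu
    by_contra! hue
    have heI : e ∈ I := hτ.1.ordConnected.out hu (hsub (mem_Ici.2 le_rfl)) ⟨hue, he0.le⟩
    have hconst : ∀ v ∈ I, τ v = τ e := by
      intro v hv
      have h1 : Tendsto (fun N : ℕ => e + (s ^ n) ^ N * (v - e)) atTop (𝓝[I] e) := by
        refine tendsto_nhdsWithin_iff.2 ⟨?_, Eventually.of_forall fun N => (hiter N v hv).1⟩
        have := ((tendsto_pow_atTop_nhds_zero_of_lt_one (by positivity) hsn).mul_const
          (v - e)).const_add e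
        simpa using this
      have h2 := (hτ.1.continuousOn e heI).tendsto.comp h1
      refine tendsto_nhds_unique (tendsto_const_nhds (x := τ v)) (h2.congr fun N => ?_)
      exact (hiter N v hv).2
    have hcol := fun {u} => h.eqOn_column hs0 hs1 hm hτ hc h0 (ENat.natCast_lt_top 0) (u := u)
    have hpos : 0 < s / c := by positivity
    have hT1 : columnTime s c (0 + 1) = s / c := by simp [columnTime_succ]
    have h1 := hcol (u := 0) (by simp) (by rw [hT1]; exact hpos.le)
    have h2 := hcol (u := s / c / 2) (by simp; positivity) (by rw [hT1]; linarith)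
    have h3 := (h1.2.symm.trans (hconst _ h1.1)).trans ((hconst _ h2.1).symm.trans h2.2)
    have e2 : c * s ^ 0 * (s / c / 2 - columnTime s c 0) = s / 2 := by
      rw [columnTime_zero]; field_simp; ring
    have h4 := congrArg (horizontal hs0.ne') h3
    rw [e2, horizontal_strip hs0 hs1 (by simp) (by simp [hs0.le]),
      horizontal_strip hs0 hs1 (by linarith) (by linarith)] at h4
    simp only [columnTime_zero, sub_zero, mul_zero, add_zero] at h4
    have := eq_of_coe_eq_of_abs_lt h4 (by rw [abs_lt]; constructor <;> linarith)
    linarith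
  -- Iterating the return map pushes every time to the right of `e` past 0 without changing the
  -- point.
  have hforw : ∀ u ∈ I, ∃ v, 0 < v ∧ v ∈ I ∧ τ v = τ u := by
    intro u hu
    have hue := sub_pos.2 (hlow u hu)
    obtain ⟨N, hN⟩ := pow_unbounded_of_one_lt (-e / (u - e)) ha1
    rw [div_lt_iff₀ hue] at hN
    have hv : 0 < e + a ^ N * (u - e) := by linarith
    refine ⟨_, hv, hsub hv.le, ?_⟩
    rw [← (hiter N _ (hsub hv.le)).2]
    congr 1
    have : (s ^ n) ^ N * a ^ N = 1 := by
      rw [← mul_pow, ha, mul_inv_cancel₀ (by positivity), one_pow]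
    linear_combination (u - e) * this
  have hend : τ 0 = τ T := by
    have := (hback 0 (hsub (by simp [hTpos.le]))).2
    simpa using this
  refine ⟨hend, Subset.antisymm ?_ (image_mono fun u hu => hsub hu.1)⟩
  rintro _ ⟨u, hu, rfl⟩
  obtain ⟨v, hv0, hv, hvu⟩ := hforw u hu
  obtain ⟨j, hj, h1, h2⟩ := h.exists_column hs0 hs1 hm hτ hc h0 hv hv0
  have h3 := (h.eqOn_column hs0 hs1 hm hτ hc h0 hj h1.le h2).2
  set t := c * s ^ j * (v - columnTime s c j) with ht
  have ht0 : 0 ≤ t := mul_nonneg (by positivity) (by linarith)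
  have hts : t ≤ s := by
    rw [columnTime_succ] at h2
    have h : v - columnTime s c j ≤ s / (c * s ^ j) := by linarith
    rw [le_div_iff₀ (by positivity)] at h
    linarith
  have hw0 : columnTime s c (j % n) ≤ columnTime s c (j % n) + t / (c * s ^ (j % n)) := by
    have : 0 ≤ t / (c * s ^ (j % n)) := by positivity
    linarith
  have hw1 : columnTime s c (j % n) + t / (c * s ^ (j % n)) ≤ columnTime s c (j % n + 1) := by
    rw [columnTime_succ]
    gcongr
  have h4 := (h.eqOn_column hs0 hs1 hm hτ hc h0 (ENat.natCast_lt_top (j % n)) hw0 hw1).2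
  -- The same offset `t` in the column `j % n` of the first lap gives the same point, since the
  -- entry heights agree.
  set w := columnTime s c (j % n) + t / (c * s ^ (j % n)) with hw
  have e3 : c * s ^ (j % n) * (w - columnTime s c (j % n)) = t := by
    rw [hw, add_sub_cancel_left]
    field_simp
  rw [e3, hper, ← h3, hvu] at h4
  have hwT : w ≤ T := hw1.trans
    ((columnTime_strictMono hs0 hc).monotone (Nat.succ_le_of_lt (Nat.mod_lt j hn)))
  have hw00 : 0 ≤ w := (columnTime_nonneg hs0 hc _).trans hw0
  rcases hwT.eq_or_lt with hwT | hwT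
  · exact ⟨0, ⟨le_rfl, hTpos⟩, by rw [hend, ← hwT, h4]⟩
  · exact ⟨w, ⟨hw00, hwT⟩, h4⟩

/-- One period descends to a continuous injection of a circle into a Hausdorff space, hence to an
embedding, and its image is the whole trajectory. The domain is unbounded to the right, so it is not
compact. -/
theorem IsItinerary.isClosedTrajectory (h : IsItinerary s m z b ⊤) (hm : 0 ≤ m) {I : Set ℝ}
    {τ : ℝ → Surface s} (hτ : IsMaximalTrajectory m I τ) {c : ℝ} (hc : 0 < c)
    (h0 : Enters hs0 m I τ 0 c (z 0)) (hn : 0 < n) (hper : ∀ j, z (j % n) = z j)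
    (hinj : ∀ i < n, ∀ j < n, z i = z j → i = j) : IsClosedTrajectory I τ := by
  have := t2Space_surface hs0 hs1
  have hsub := h.Ici_subset hs0 hs1 hm hτ hc h0
  refine ⟨?_, ?_⟩
  · obtain ⟨hend, himg⟩ := h.image_eq hs0 hs1 hm hτ hc h0 hn hper
    have hlt : ∀ j, z j < s := by
      intro j
      cases j with
      | zero =>
        have := hper n
        rw [Nat.mod_self] at this
        -- `enter_lt` concerns later columns only; periodicity replaces `z 0` by `z n`.
        rw [this, ← Nat.sub_add_cancel hn]
        exact h.enter_lt hs0 hs1 (ENat.natCast_lt_top _)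
      | succ j => exact h.enter_lt hs0 hs1 (ENat.natCast_lt_top _)
    have hi := h.injOn hs0 hs1 hm hτ hc h0 hlt hinj
    have hTpos : 0 < columnTime s c n := by
      rw [← columnTime_zero s c]
      exact columnTime_strictMono hs0 hc hn
    generalize columnTime s c n = T at *
    have : Fact (0 < T) := ⟨hTpos⟩
    have hcont : Continuous (AddCircle.liftIco T 0 τ) :=
      AddCircle.liftIco_zero_continuous hend
        (hτ.1.continuousOn.mono fun u hu => hsub hu.1)
    have hsurj : ∀ x : AddCircle T, ∃ u ∈ Ico 0 T, (u : AddCircle T) = x := by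
      intro x
      have := AddCircle.coe_image_Ico_eq T 0
      rw [zero_add] at this
      have hx : x ∈ ((↑) : ℝ → AddCircle T) '' Ico 0 T := by rw [this]; trivial
      exact hx
    have hinjective : Function.Injective (AddCircle.liftIco T 0 τ) := by
      intro x y hxy
      obtain ⟨u, hu, rfl⟩ := hsurj x
      obtain ⟨v, hv, rfl⟩ := hsurj y
      rw [AddCircle.liftIco_zero_coe_apply hu, AddCircle.liftIco_zero_coe_apply hv] at hxy
      rw [hi hu hv hxy]
    have hrange : range (AddCircle.liftIco T 0 τ) = τ '' I := by
      rw [himg]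
      ext x
      constructor
      · rintro ⟨y, rfl⟩
        obtain ⟨u, hu, rfl⟩ := hsurj y
        exact ⟨u, hu, (AddCircle.liftIco_zero_coe_apply hu).symm⟩
      · rintro ⟨u, hu, rfl⟩
        exact ⟨u, AddCircle.liftIco_zero_coe_apply hu⟩
    have hemb := (hcont.isClosedEmbedding hinjective).isEmbedding
    exact ⟨(Homeomorph.setCongr hrange).symm.trans
      (hemb.toHomeomorph.symm.trans (AddCircle.homeomorphCircle hTpos.ne'))⟩
  · rintro ⟨x, y, hxy, rfl, -⟩
    have h1 : max 0 (y + 1) ∈ Icc x y := hsub (mem_Ici.2 (le_max_left 0 (y + 1)))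
    have := h1.2
    have := le_max_right 0 (y + 1)
    linarith

end

/-! ### Trajectories with a prescribed cutting sequence -/

theorem exists_coprime_of_not_irrational {ξ : ℝ} (hξ : 0 ≤ ξ) (h : ¬ Irrational ξ) :
    ∃ k n : ℕ, 0 < n ∧ Nat.Coprime k n ∧ ξ = (k : ℝ) / n := by
  obtain ⟨q, rfl⟩ := not_not.1 h
  have hq : 0 ≤ q := by exact_mod_cast hξ
  refine ⟨q.num.natAbs, q.den, q.pos, q.reduced, ?_⟩
  have h1 : ((q.num.natAbs : ℤ) : ℚ) = q.num := by
    rw [Int.natAbs_of_nonneg (Rat.num_nonneg.2 hq)]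
  have h2 : (q.num.natAbs : ℚ) / q.den = q := by
    rw [← Int.cast_natCast, h1, Rat.num_div_den]
  have h3 : (((q.num.natAbs : ℚ) / q.den : ℚ) : ℝ) = (q : ℝ) := by rw [h2]
  rw [← h3, Rat.cast_div, Rat.cast_natCast, Rat.cast_natCast]

theorem mul_coprime_div_ne_int {k n : ℕ} (hn : 0 < n) (hkn : Nat.Coprime k n) {j : ℕ} (hj : 0 < j)
    (hjn : j < n) (h : ℤ) : (j : ℝ) * ((k : ℝ) / n) ≠ h := by
  intro he
  have hn' : (n : ℝ) ≠ 0 := by positivity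
  field_simp at he
  have h1 : (n : ℤ) ∣ j * k := ⟨h, by exact_mod_cast he⟩
  have h2 : n ∣ j * k := by exact_mod_cast h1
  exact absurd (Nat.le_of_dvd hj (hkn.symm.dvd_of_dvd_mul_right h2)) (by omega)

theorem blockCount_zero_pos {ξ : ℝ} (hξ : 0 < ξ) : 0 < blockCount ξ 0 := by
  have h1 := coe_blockCount hξ.le 0
  have h2 : 0 < ⌈ξ⌉ := Int.ceil_pos.2 hξ
  simp only [zero_add, Nat.cast_one, one_mul, Nat.cast_zero, zero_mul, Int.ceil_zero, sub_zero] at h1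
  omega

theorem deltaMinus_zero_right (s : ℝ) : deltaMinus s 0 = 0 := by
  simp [deltaMinus]

theorem isCuttingSequence_torusRecord_zero {ξ : ℝ} (hξ : 0 ≤ ξ) {L : ℕ∞} (hL : 0 < L)
    (hreg : ∀ j : ℕ, 0 < j → (j : ℕ∞) < L → ∀ h : ℤ, (j : ℝ) * ξ ≠ h)
    (hend : ∀ n : ℕ, (n : ℕ∞) = L → ∃ h : ℤ, (n : ℝ) * ξ = h) :
    IsCuttingSequence (torusRecord ξ 0) (blockLength (blockCount ξ) L)
      (blockWord (blockCount ξ)) := by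
  have := isCuttingSequence_torusRecord hξ le_rfl (by norm_num : (-1 : ℝ) < 0)
    (coe_blockCount hξ) (fun j => by rw [add_zero]) hL (by simpa using hreg) (by simpa using hend)
  rwa [AddCircle.coe_zero] at this

section

variable {s : ℝ} (hs0 : 0 < s) (hs1 : s < 1) {ξ : ℝ} (hξ : 0 ≤ ξ)
include hs0 hs1 hξ

theorem sameCuttingSequence_of_irrational (hirr : Irrational ξ) {m : ℝ}
    (hm : m = deltaMinus s ξ ∨ m = deltaPlus s ξ) {p : ℝ × ℝ}
    (hp : (p.1 = 1 - s ∧ s ≤ p.2 ∧ p.2 < 1) ∨ p = (1 - s, 0)) :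
    (∃ (I : Set ℝ) (τ : ℝ → Surface s), IsTrajectoryFrom m p I τ) ∧
      ∀ (I : Set ℝ) (τ : ℝ → Surface s), IsTrajectoryFrom m p I τ →
        SameCuttingSequence (surfaceRecord m p I τ) (torusRecord ξ 0) := by
  have hm0 : 0 ≤ m := by
    rcases hm with rfl | rfl
    exacts [deltaMinus_nonneg hs0 hs1 hξ, deltaPlus_nonneg hs0 hs1 hξ]
  have hmW : s / (1 - s) * m = -weightedSum s (floorDrop ξ 0) := by
    have := weightedSum_ceilDrop_eq_add_one hs0 hs1 hξ hirr
    rcases hm with rfl | rfl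
    · exact deltaMinus_eq hs0 hs1
    · rw [deltaPlus_eq hs0 hs1, this]
      ring
  have hξ0 : 0 < ξ := hξ.lt_of_ne fun h => hirr ⟨0, by simp [h]⟩
  obtain ⟨y, rfl, hy0, hy1⟩ : ∃ y, p = (1 - s, y) ∧ 0 ≤ y ∧ y < 1 := by
    rcases hp with ⟨h1, h2, h3⟩ | rfl
    · exact ⟨p.2, Prod.ext h1 rfl, by linarith, h3⟩
    · exact ⟨0, rfl, le_rfl, one_pos⟩
  refine ⟨exists_isTrajectoryFrom hs0 hs1 hy0 hy1 hm0, fun I τ hτ =>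
    ⟨blockLength (blockCount ξ) ⊤, blockWord (blockCount ξ), ?_,
      isCuttingSequence_torusRecord_zero hξ (by simp) (fun j hj _ h he => ?_) (by simp)⟩⟩
  · obtain ⟨h0I, -, c, hc, hent⟩ := hτ.exists_enters hs0 hs1 hy0 hy1 hm0
    rcases hp with ⟨-, h2, h3⟩ | h
    · exact (isItinerary_of_irrational hs0 hs1 hξ hirr hmW h2 h3.le).isCuttingSequence hs0 hs1 hm0
        hτ.1 hc h0I hent (Or.inl ⟨rfl, h3⟩)
    · obtain rfl : y = 0 := congrArg Prod.snd h
      have h1 := hent.add_int hs0 hs1 1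
      rw [Int.cast_one, zero_add] at h1
      exact (isItinerary_of_irrational hs0 hs1 hξ hirr hmW hs1.le le_rfl).isCuttingSequence hs0 hs1
        hm0 hτ.1 hc h0I h1 (Or.inr ⟨rfl, rfl, fun _ => blockCount_zero_pos hξ0⟩)
  · exact ((hirr.natCast_mul hj.ne').ne_int h) he

theorem isSaddleConnection_deltaPlus {k n : ℕ} (hn : 0 < n) (hkn : Nat.Coprime k n)
    (hξk : ξ = (k : ℝ) / n) :
    (∃ (I : Set ℝ) (τ : ℝ → Surface s), IsTrajectoryFrom (deltaPlus s ξ) (1 - s, s) I τ) ∧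
      ∀ (I : Set ℝ) (τ : ℝ → Surface s), IsTrajectoryFrom (deltaPlus s ξ) (1 - s, s) I τ →
        IsSaddleConnection I τ ∧
        SameCuttingSequence (surfaceRecord (deltaPlus s ξ) (1 - s, s) I τ) (torusRecord ξ 0) := by
  have hm0 := deltaPlus_nonneg hs0 hs1 hξ
  have hmin : ∀ j : ℕ, 0 < j → j < n → ∀ h : ℤ, (j : ℝ) * ξ ≠ h := fun j hj hjn h =>
    hξk ▸ mul_coprime_div_ne_int hn hkn hj hjn h
  have hk : (n : ℝ) * ξ = (k : ℤ) := by
    rw [hξk]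
    push_cast
    field_simp
  have hit := isItinerary_deltaPlus hs0 hs1 hξ hn hk hmin (deltaPlus_eq hs0 hs1)
  refine ⟨exists_isTrajectoryFrom hs0 hs1 hs0.le hs1 hm0, fun I τ hτ => ?_⟩
  obtain ⟨h0I, hrep, c, hc, hent⟩ := hτ.exists_enters hs0 hs1 hs0.le hs1 hm0
  refine ⟨?_, blockLength (blockCount ξ) n, blockWord (blockCount ξ),
    hit.isCuttingSequence hs0 hs1 hm0 hτ.1 hc h0I hent (Or.inl ⟨rfl, hs1⟩),
    isCuttingSequence_torusRecord_zero hξ (by exact_mod_cast hn)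
      (fun j hj hjn => hmin j hj (by exact_mod_cast hjn)) fun j hj => ?_⟩
  · obtain ⟨n, rfl⟩ := Nat.exists_eq_add_one_of_ne_zero hn.ne'
    exact hit.isSaddleConnection hs0 hs1 hm0 hτ.1 hc hent h0I
      ((hrep.mem_singularSet_iff hs0 hs1).2 (by simp [vertices]))
  · obtain rfl : j = n := by exact_mod_cast hj
    exact ⟨k, hk⟩

theorem isSaddleConnection_deltaMinus {k n : ℕ} (hn : 0 < n) (hkn : Nat.Coprime k n)
    (hξk : ξ = (k : ℝ) / n) :
    (∃ (I : Set ℝ) (τ : ℝ → Surface s), IsTrajectoryFrom (deltaMinus s ξ) (1 - s, 0) I τ) ∧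
      ∀ (I : Set ℝ) (τ : ℝ → Surface s), IsTrajectoryFrom (deltaMinus s ξ) (1 - s, 0) I τ →
        IsSaddleConnection I τ ∧
        SameCuttingSequence (surfaceRecord (deltaMinus s ξ) (1 - s, 0) I τ) (torusRecord ξ 0) := by
  have hm0 := deltaMinus_nonneg hs0 hs1 hξ
  have hmin : ∀ j : ℕ, 0 < j → j < n → ∀ h : ℤ, (j : ℝ) * ξ ≠ h := fun j hj hjn h =>
    hξk ▸ mul_coprime_div_ne_int hn hkn hj hjn h
  have hk : (n : ℝ) * ξ = (k : ℤ) := by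
    rw [hξk]
    push_cast
    field_simp
  have hit := isItinerary_deltaMinus hs0 hs1 hξ hn hk hmin (deltaMinus_eq hs0 hs1)
  refine ⟨exists_isTrajectoryFrom hs0 hs1 le_rfl one_pos hm0, fun I τ hτ => ?_⟩
  obtain ⟨h0I, hrep, c, hc, hent⟩ := hτ.exists_enters hs0 hs1 le_rfl one_pos hm0
  have hent1 := hent.add_int hs0 hs1 1
  rw [Int.cast_one, zero_add] at hent1
  refine ⟨?_, blockLength (blockCount ξ) n, blockWord (blockCount ξ),
    hit.isCuttingSequence hs0 hs1 hm0 hτ.1 hc h0I hent1 (Or.inr ⟨rfl, rfl, fun hm => ?_⟩),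
    isCuttingSequence_torusRecord_zero hξ (by exact_mod_cast hn)
      (fun j hj hjn => hmin j hj (by exact_mod_cast hjn)) fun j hj => ?_⟩
  · obtain ⟨n, rfl⟩ := Nat.exists_eq_add_one_of_ne_zero hn.ne'
    exact hit.isSaddleConnection hs0 hs1 hm0 hτ.1 hc hent1 h0I
      ((hrep.mem_singularSet_iff hs0 hs1).2 (by simp [vertices]))
  -- A nonzero slope excludes `ξ = 0`, so the first block really contains the initial `B`.
  · refine blockCount_zero_pos (hξ.lt_of_ne ?_)
    rintro rfl
    exact hm (deltaMinus_zero_right s)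
  · obtain rfl : j = n := by exact_mod_cast hj
    exact ⟨k, hk⟩

-- Parity: after multiplication by `2 * n`, an odd integer would equal an even one. The height `-1 /
-- (2 * n)` lies midway between neighbouring multiples of `1 / n`.
omit hs0 hs1 in
theorem half_shift_ne_int {k n : ℕ} (hn : 0 < n) (hξk : ξ = (k : ℝ) / n) (N h : ℤ) :
    -1 / (2 * n : ℝ) + ξ * N ≠ h := by
  intro he
  have hn' : (n : ℝ) ≠ 0 := by positivity
  rw [hξk] at he
  field_simp at he
  have h1 : -1 + 2 * (k : ℤ) * N = 2 * n * h := by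
    have : (-1 + 2 * (k : ℝ) * N) = 2 * n * h := by linarith
    exact_mod_cast this
  have h2 : (2 : ℤ) ∣ 1 := ⟨k * N - n * h, by linarith⟩
  norm_num at h2

-- `j * ξ` is a multiple of `1 / n`, so lowering it by half that step crosses no integer from above.
-- The shifted line avoids the corner but keeps the block lengths.
omit hs0 hs1 in
theorem ceil_mul_add_half_shift {k n : ℕ} (hn : 0 < n) (hξk : ξ = (k : ℝ) / n) (j : ℕ) :
    ⌈(j : ℝ) * ξ + -1 / (2 * n : ℝ)⌉ = ⌈(j : ℝ) * ξ⌉ := by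
  have hn' : (0 : ℝ) < n := by exact_mod_cast hn
  rw [Int.ceil_eq_iff]
  have h1 := Int.le_ceil ((j : ℝ) * ξ)
  have h2 := Int.ceil_lt_add_one ((j : ℝ) * ξ)
  have h3 : -1 / (2 * n : ℝ) < 0 := div_neg_of_neg_of_pos (by norm_num) (by positivity)
  refine ⟨?_, by linarith⟩
  have h4 : (j : ℝ) * ξ * n = ((j * k : ℤ) : ℝ) := by
    rw [hξk]
    push_cast
    field_simp
  have h5 : (⌈(j : ℝ) * ξ⌉ - 1) * n + 1 ≤ (j * k : ℤ) := by
    have : ((⌈(j : ℝ) * ξ⌉ : ℝ) - 1) * n < ((j * k : ℤ) : ℝ) := by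
      rw [← h4]
      exact mul_lt_mul_of_pos_right (by linarith) hn'
    exact_mod_cast this
  have h6 : ((⌈(j : ℝ) * ξ⌉ : ℝ) - 1) * n + 1 ≤ (j : ℝ) * ξ * n := by
    rw [h4]
    exact_mod_cast h5
  have h7 : -1 / (2 * n : ℝ) * n = -1 / 2 := by field_simp
  refine lt_of_mul_lt_mul_right ?_ hn'.le
  rw [add_mul, h7]
  linarith

omit hs0 hs1 in
theorem exists_isCuttingSequence_torusRecord_regular {k n : ℕ} (hn : 0 < n)
    (hξk : ξ = (k : ℝ) / n) :
    ∃ q : UnitAddCircle × UnitAddCircle, (∀ u : ℝ, torusTrajectory ξ q u ≠ 0) ∧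
      IsCuttingSequence (torusRecord ξ q) (blockLength (blockCount ξ) ⊤)
        (blockWord (blockCount ξ)) := by
  have hn' : (1 : ℝ) ≤ n := by exact_mod_cast hn
  refine ⟨(0, ((-1 / (2 * n : ℝ) : ℝ) : UnitAddCircle)), fun u hu => ?_, ?_⟩
  · obtain ⟨⟨N, rfl⟩, h, hh⟩ := torusTrajectory_eq_zero_iff.1 hu
    exact half_shift_ne_int hξ hn hξk N h hh
  · refine isCuttingSequence_torusRecord hξ (div_nonpos_of_nonpos_of_nonneg (by norm_num)
      (by positivity)) ?_ (coe_blockCount hξ) (ceil_mul_add_half_shift hξ hn hξk) (by simp)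
      (fun j _ _ h he => half_shift_ne_int hξ hn hξk j h ?_) (by simp)
    · rw [lt_div_iff₀ (by positivity)]
      linarith
    · rw [← he]
      push_cast
      ring

theorem isClosedTrajectory_of_mem_Ioo {k n : ℕ} (hn : 0 < n) (hkn : Nat.Coprime k n)
    (hξk : ξ = (k : ℝ) / n) {m : ℝ} (hm : m ∈ Ioo (deltaMinus s ξ) (deltaPlus s ξ)) {y₀ : ℝ}
    (hy₀ : y₀ = s * (s / (1 - s) * m + weightedSum s (ceilDrop ξ 0))) :
    (0 < y₀ ∧ y₀ < s) ∧
      (∃ (I : Set ℝ) (τ : ℝ → Surface s), IsTrajectoryFrom m (1 - s, y₀) I τ) ∧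
      ∀ (I : Set ℝ) (τ : ℝ → Surface s), IsTrajectoryFrom m (1 - s, y₀) I τ →
        IsClosedTrajectory I τ ∧
        ∃ q : UnitAddCircle × UnitAddCircle, (∀ u : ℝ, torusTrajectory ξ q u ≠ 0) ∧
          SameCuttingSequence (surfaceRecord m (1 - s, y₀) I τ) (torusRecord ξ q) := by
  have hm0 : 0 ≤ m := (deltaMinus_nonneg hs0 hs1 hξ).trans hm.1.le
  have hpos : 0 < s / (1 - s) := div_pos hs0 (by linarith)
  have h0 : -weightedSum s (floorDrop ξ 0) < s / (1 - s) * m := by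
    rw [← deltaMinus_eq hs0 hs1]
    exact mul_lt_mul_of_pos_left hm.1 hpos
  have h1 : s / (1 - s) * m < 1 - weightedSum s (ceilDrop ξ 0) := by
    rw [← deltaPlus_eq hs0 hs1]
    exact mul_lt_mul_of_pos_left hm.2 hpos
  have hle := weightedSum_le hs0 hs1 (summable_floorDrop hs0 hs1 hξ 0)
    (summable_ceilDrop hs0 hs1 hξ 0) (le_ceilDrop ξ 0)
  have hy0 : 0 < y₀ := hy₀ ▸ mul_pos hs0 (by linarith)
  have hys : y₀ < s := by
    rw [hy₀]
    exact mul_lt_of_lt_one_right hs0 (by linarith)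
  have hy1 : y₀ < 1 := hys.trans hs1
  have hmin : ∀ j : ℕ, 0 < j → j < n → ∀ h : ℤ, (j : ℝ) * ξ ≠ h := fun j hj hjn h =>
    hξk ▸ mul_coprime_div_ne_int hn hkn hj hjn h
  have hk : (n : ℝ) * ξ = (k : ℤ) := by
    rw [hξk]
    push_cast
    field_simp
  refine ⟨⟨hy0, hys⟩, exists_isTrajectoryFrom hs0 hs1 hy0.le hy1 hm0, fun I τ hτ => ?_⟩
  obtain ⟨h0I, -, c, hc, hent⟩ := hτ.exists_enters hs0 hs1 hy0.le hy1 hm0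
  have hit := isItinerary_periodic hs0 hs1 hξ h0 h1
  rw [← hy₀] at hit
  have hz : ∀ j, enterHeight s m ξ y₀ j =
      s * (s / (1 - s) * m + weightedSum s (ceilDrop ξ (j * ξ))) := fun j => by
    rw [hy₀, enterHeight_periodic_eq hs0 hs1 hξ]
  obtain ⟨q, hq, hqc⟩ := exists_isCuttingSequence_torusRecord_regular hξ hn hξk
  refine ⟨hit.isClosedTrajectory hs0 hs1 hm0 hτ.1 hc hent hn (fun j => ?_)
    (fun i hi j hj hij => ?_), q, hq, _, _,
    hit.isCuttingSequence hs0 hs1 hm0 hτ.1 hc h0I hent (Or.inl ⟨rfl, hy1⟩), hqc⟩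
  · rw [hz, hz]
    have : (j : ℝ) * ξ = (j % n : ℕ) * ξ + ((j / n * k : ℕ) : ℤ) := by
      have h2 : (j : ℝ) = n * (j / n : ℕ) + (j % n : ℕ) := by
        exact_mod_cast (Nat.div_add_mod j n).symm
      rw [h2, add_mul, mul_right_comm, hk, Int.cast_natCast, Int.cast_natCast, Nat.cast_mul]
      ring
    rw [this, ceilDrop_add_int]
  · rw [hz, hz] at hij
    exact weightedSum_ceilDrop_injOn hs0 hs1 hξ hk hmin hi hj
      (add_left_cancel (mul_left_cancel₀ hs0.ne' hij))

end

end

end HomothetySurface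

/-! ### Assembly of the four statements -/

open HomothetySurface in
theorem theorem3p5 (s : ℝ) (hs0 : 0 < s) (hs1 : s < 1) (ξ : ℝ) (hξ : 0 ≤ ξ) :
    -- (i) The top endpoint of `E` is the lower left corner `(1 - s, 0)` of `R_s^+`.
    (Irrational ξ → ∀ m : ℝ, m = deltaMinus s ξ ∨ m = deltaPlus s ξ →
      ∀ p : ℝ × ℝ, (p.1 = 1 - s ∧ s ≤ p.2 ∧ p.2 < 1) ∨ p = (1 - s, 0) →
        (∃ (I : Set ℝ) (τ : ℝ → Surface s), IsTrajectoryFrom m p I τ) ∧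
        ∀ (I : Set ℝ) (τ : ℝ → Surface s), IsTrajectoryFrom m p I τ →
          SameCuttingSequence (surfaceRecord m p I τ) (torusRecord ξ 0)) ∧
    -- (ii)
    (¬ Irrational ξ →
      (∃ (I : Set ℝ) (τ : ℝ → Surface s), IsTrajectoryFrom (deltaPlus s ξ) (1 - s, s) I τ) ∧
      ∀ (I : Set ℝ) (τ : ℝ → Surface s), IsTrajectoryFrom (deltaPlus s ξ) (1 - s, s) I τ →
        IsSaddleConnection I τ ∧
        SameCuttingSequence (surfaceRecord (deltaPlus s ξ) (1 - s, s) I τ) (torusRecord ξ 0)) ∧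
    -- (iii)
    (¬ Irrational ξ →
      (∃ (I : Set ℝ) (τ : ℝ → Surface s), IsTrajectoryFrom (deltaMinus s ξ) (1 - s, 0) I τ) ∧
      ∀ (I : Set ℝ) (τ : ℝ → Surface s), IsTrajectoryFrom (deltaMinus s ξ) (1 - s, 0) I τ →
        IsSaddleConnection I τ ∧
        SameCuttingSequence (surfaceRecord (deltaMinus s ξ) (1 - s, 0) I τ) (torusRecord ξ 0)) ∧
    -- (iv)
    (∀ k n : ℕ, 0 < n → Nat.Coprime k n → ξ = (k : ℝ) / n →
      ∀ m ∈ Set.Ioo (deltaMinus s ξ) (deltaPlus s ξ), ∀ y₀ : ℝ,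
        y₀ = s ^ 2 / (1 - s) * m - s ^ n / (1 - s ^ n) *
          ∑ l ∈ Finset.Icc 1 k, (1 / s) ^ ⌊((l : ℝ) - 1) * n / k⌋₊ →
        (0 < y₀ ∧ y₀ < s) ∧
        (∃ (I : Set ℝ) (τ : ℝ → Surface s), IsTrajectoryFrom m (1 - s, y₀) I τ) ∧
        ∀ (I : Set ℝ) (τ : ℝ → Surface s), IsTrajectoryFrom m (1 - s, y₀) I τ →
          IsClosedTrajectory I τ ∧
          ∃ q : UnitAddCircle × UnitAddCircle, (∀ u : ℝ, torusTrajectory ξ q u ≠ 0) ∧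
            SameCuttingSequence (surfaceRecord m (1 - s, y₀) I τ) (torusRecord ξ q)) := by
  refine ⟨fun hirr m hm p hp => sameCuttingSequence_of_irrational hs0 hs1 hξ hirr hm hp,
    fun h => ?_, fun h => ?_, fun k n hn hkn hξk m hm y₀ hy₀ => ?_⟩
  · obtain ⟨k, n, hn, hkn, hξk⟩ := exists_coprime_of_not_irrational hξ h
    exact isSaddleConnection_deltaPlus hs0 hs1 hξ hn hkn hξk
  · obtain ⟨k, n, hn, hkn, hξk⟩ := exists_coprime_of_not_irrational hξ h
    exact isSaddleConnection_deltaMinus hs0 hs1 hξ hn hkn hξk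
  · refine isClosedTrajectory_of_mem_Ioo hs0 hs1 hξ hn hkn hξk hm (hy₀.trans ?_)
    refine periodic_height_eq hs0 hs1 hξ hn ?_ m
    rw [hξk]
    field_simp
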